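/- Let $d\ge 1$ and let $p\ge 2$ be an even integer with $p\ge 8/d$. Consider the defocusing Gabitov--Turitsyn equation on $\mathbb R^d$, $$ i u_t-\Delta u+\int_0^1 e^{-i\sigma\Delta}\Big[\big|e^{i\sigma\Delta}u\big|^p\, e^{i\sigma\Delta}u\Big]\,d\sigma=0,\qquad u(0)=u_0, $$ and write $$ K(f)=\|f\|_{\dot H^1}^2=\int|\nabla f|^2dx,\qquad U(f)=\int_0^1\!\!\int_{\mathbb R^d}|e^{i\sigma\Delta}f|^{p+2}\,dx\,d\sigma, $$ $$ E(f)=\tfrac12K(f)+\tfrac1{p+2}U(f),\qquad V(f)=\int_{\mathbb R^d}|x|^2|f|^2dx. $$ For all $0<\kappa_1\le\kappa_2$ there are constants $c,C>0$, depending only on $d,p,\kappa_1,\kappa_2$, such that the following holds. Let $s\ge 2$ with $s>d/2$, let $-\tfrac12\le T<0$, and let $u\in C([T,0];H^s(\mathbb R^d))$ be a strong solution of the equation on $[T,0]$ (the equation holds in $L^2$ at every $t\in[T,0]$) whose initial datum $u_0=u(0)$ is real-valued with $|x|u_0\in L^2$. Suppose that $$ \kappa_1\,\frac{V(u_0)}{E(u_0)}\le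 T^2\le\kappa_2\,\frac{V(u_0)}{E(u_0)} . $$ Then $$ K(u(T))\ \ge\ c\,U(u(T)). $$ If moreover $K(u_0)\le U(u_0)$, then the kinetic and potential energy become comparable by time $T$: $$ c\,U(u_0)\le K(u(T))\le C\,U(u_0), $$ and there is a time $t\in[T,0]$ with $$ c\,U(u(t))\le K(u(t))\le C\,U(u(t)). $$ -/

import Mathlib

open MeasureTheory Filter Topology Set
open scoped FourierTransform ENNReal

noncomputable section

namespace GabitovTuritsyn

/-- The complex Hilbert space `L²(ℝᵈ; ℂ)`. -/
abbrev L2 (d : ℕ) : Type :=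
  Lp ℂ 2 (volume : Measure (EuclideanSpace ℝ (Fin d)))

/-- The Fourier multiplier operator `f ↦ 𝓕⁻¹ (m · 𝓕 f)` on `L²`, where `f` is in its domain if
`m · 𝓕 f ∈ L²` (and the value is `0` outside of the domain). Mathlib's Fourier transform uses the
kernel `exp (-2πi ⟨x, ξ⟩)`, so that the usual frequency variable is `2πξ`. -/
def fourierMultiplier {d : ℕ} (m : EuclideanSpace ℝ (Fin d) → ℂ) (f : L2 d) : L2 d :=
  open Classical in
  if h : MemLp (fun ξ => m ξ * (𝓕 f : L2 d) ξ) 2 volume then 𝓕⁻ (h.toLp : L2 d) else 0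

/-- The symbol of the free Schrödinger propagator `e^{iσΔ}`. -/
def schrodingerSymbol {d : ℕ} (σ : ℝ) (ξ : EuclideanSpace ℝ (Fin d)) : ℂ :=
  Complex.exp (-(Complex.I * ((σ * (2 * Real.pi * ‖ξ‖) ^ 2 : ℝ) : ℂ)))

/-- The free Schrödinger propagator `e^{iσΔ}` on `L²`. -/
def freeProp {d : ℕ} (σ : ℝ) (f : L2 d) : L2 d :=
  fourierMultiplier (schrodingerSymbol σ) f

/-- Every `f ∈ L²` is in the domain of the free propagator. -/
theorem memLp_schrodingerSymbol_mul {d : ℕ} (σ : ℝ) (f : L2 d) :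
    MemLp (fun ξ => schrodingerSymbol σ ξ * (𝓕 f : L2 d) ξ) 2 volume := by
  refine (Lp.memLp (𝓕 f : L2 d)).of_le ?_ (Eventually.of_forall fun ξ => ?_)
  · refine Continuous.aestronglyMeasurable ?_ |>.mul (Lp.memLp (𝓕 f : L2 d)).1
    unfold schrodingerSymbol
    fun_prop
  · have h : ‖schrodingerSymbol σ ξ‖ = 1 := by
      rw [schrodingerSymbol, Complex.norm_exp]
      simp [-Complex.ofReal_mul, -Complex.ofReal_pow]
    rw [norm_mul, h, one_mul]

/-- The Laplacian as an (unbounded) operator on `L²`, with domain `H²`. -/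
def laplacian {d : ℕ} (f : L2 d) : L2 d :=
  fourierMultiplier (fun ξ => ((-(2 * Real.pi * ‖ξ‖) ^ 2 : ℝ) : ℂ)) f

/-- The Sobolev norm `‖f‖_{Hˢ}`, with value `∞` if `f ∉ Hˢ`. -/
def sobolevNorm {d : ℕ} (s : ℝ) (f : L2 d) : ℝ≥0∞ :=
  eLpNorm (fun ξ => (((1 + (2 * Real.pi * ‖ξ‖) ^ 2) ^ (s / 2) : ℝ) : ℂ) * (𝓕 f : L2 d) ξ) 2 volume

/-- The power nonlinearity `f ↦ |f|ᵖ f`, for those `f` with `|f|ᵖ f ∈ L²`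
(and `0` for the others). -/
def powerNL {d : ℕ} (p : ℕ) (f : L2 d) : L2 d :=
  open Classical in
  if h : MemLp (fun x => ((‖f x‖ ^ p : ℝ) : ℂ) * f x) 2 volume then h.toLp else 0

/-- The averaged nonlinearity `∫₀¹ e^{-iσΔ} [|e^{iσΔ} f|ᵖ e^{iσΔ} f] dσ`. -/
def nonlinearity {d : ℕ} (p : ℕ) (f : L2 d) : L2 d :=
  ∫ σ in (0 : ℝ)..1, freeProp (-σ) (powerNL p (freeProp σ f))

/-- `u` is a strong `Hˢ` solution, on the time interval `J`, of the Gabitov–Turitsyn equation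
`i u_t + γ Δ u + ∫₀¹ e^{-iσΔ} [|e^{iσΔ} u|ᵖ e^{iσΔ} u] dσ = 0`:
it belongs to `C(J; Hˢ)`, and the equation holds in `L²` at every time in `J`
(with one-sided derivatives at the endpoints that belong to `J`).
This is to be used with `s ≥ 2` and `s > d / 2`, when all terms make sense in `L²`. -/
structure IsSolution {d : ℕ} (γ : ℝ) (p : ℕ) (s : ℝ) (J : Set ℝ) (u : ℝ → L2 d) : Prop where
  mem_sobolev : ∀ t ∈ J, sobolevNorm s (u t) < ∞
  continuous_sobolev :
    ∀ t₀ ∈ J, Tendsto (fun t => sobolevNorm s (u t - u t₀)) (𝓝[J] t₀) (𝓝 0)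
  equation : ∀ t ∈ J, ∃ u' : L2 d, HasDerivWithinAt u u' J t ∧
    Complex.I • u' + (γ : ℂ) • laplacian (u t) + nonlinearity p (u t) = 0

/-- `‖f‖²` in the homogeneous Sobolev space `Ḣ¹`, that is `∫ |∇f|² dx`. -/
def kinetic {d : ℕ} (f : L2 d) : ℝ :=
  ∫ ξ, (2 * Real.pi * ‖ξ‖) ^ 2 * ‖(𝓕 f : L2 d) ξ‖ ^ 2

/-- The time-averaged potential term `∫₀¹ ∫ |e^{iσΔ} f|^{p+2} dx dσ`. -/
def potential {d : ℕ} (p : ℕ) (f : L2 d) : ℝ :=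
  ∫ σ in (0 : ℝ)..1, ∫ x, ‖freeProp σ f x‖ ^ (p + 2)

/-- The energy `-(γ/2) ∫ |∇f|² + (1/(p+2)) ∫₀¹ ∫ |e^{iσΔ} f|^{p+2} dx dσ`. -/
def energy {d : ℕ} (γ : ℝ) (p : ℕ) (f : L2 d) : ℝ :=
  -(γ / 2) * kinetic f + 1 / ((p : ℝ) + 2) * potential p f

/-- The variance `∫ |x|² |f(x)|² dx`. -/
def variance {d : ℕ} (f : L2 d) : ℝ :=
  ∫ x, ‖x‖ ^ 2 * ‖f x‖ ^ 2

end GabitovTuritsyn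

end

/-!
Let `P = -i∇`. Commuting `x` through the free flow turns `x e^{iaΔ} u` into `e^{iaΔ} (x + 2aP) u`,
so the difference of the variances of `e^{iaΔ} u` for `a = 1` and `a = -1` is `8 Re ⟨P u, x u⟩`.
The evolution equation is covariant under `e^{iaΔ}`, up to a translation of the window of
propagation times. The lens (pseudoconformal) transformation shows that the nonlinearity
contributes to the derivative of such a variance only the integral of `|e^{iσΔ} u|^{p+2}` at the
two ends of the window and a multiple `2dp - 8` of a first moment of it over the window. For
`dp ≥ 8` these terms have a sign in the difference of `a = 1` and `a = -1`, and `Re ⟨P u, x u⟩`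
grows backwards in time at the rate `4E` at least. It vanishes at time `0` for real data.
The variance identity for `a = 0` bounds the variance at time `T` by `2V + 32ET²`, a multiple of
`ET²`; hence `(4E|T|)² ≤ V(u(T)) K(u(T))` gives `E ≲ K(u(T))`, and the other bounds follow
from conservation of energy and the intermediate value theorem.

A solution has no a priori finite variance at times other than `0`. The position `x_j` is therefore
first replaced by the bounded difference quotients of the modulations `e^{iεx_j}`, and Gronwall's
inequality gives bounds that are uniform in `ε`.
-/

noncomputable section

namespace GabitovTuritsyn

open scoped SchwartzMap

/-! ### Convergence in `L²` -/

section LTwo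

variable {α E : Type*} [MeasurableSpace α] [NormedAddCommGroup E] {μ : Measure α}

theorem norm_eq_of_ae_norm_eq {q : ℝ≥0∞} {f g : Lp E q μ} (h : ∀ᵐ x ∂μ, ‖f x‖ = ‖g x‖) :
    ‖f‖ = ‖g‖ := by
  rw [Lp.norm_def, Lp.norm_def, eLpNorm_congr_norm_ae h]

theorem integrable_norm_sq (f : Lp E 2 μ) : Integrable (fun x => ‖f x‖ ^ 2) μ :=
  (memLp_two_iff_integrable_sq_norm (Lp.memLp f).1).1 (Lp.memLp f)

theorem norm_sq_eq_integral_norm_sq (f : Lp E 2 μ) : ‖f‖ ^ 2 = ∫ x, ‖f x‖ ^ 2 ∂μ := by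
  rw [Lp.norm_def, (Lp.memLp f).eLpNorm_eq_integral_rpow_norm two_ne_zero ENNReal.ofNat_ne_top,
    ENNReal.toReal_ofReal (by positivity), ENNReal.toReal_ofNat, ← Real.rpow_natCast,
    ← Real.rpow_mul (by positivity)]
  simp

theorem tendsto_Lp_two_of_dominated {ι : Type*} {l : Filter ι} [l.IsCountablyGenerated]
    {F : ι → Lp E 2 μ} {f : Lp E 2 μ} {F' : ι → α → E} {f' : α → E}
    (hF : ∀ n, F n =ᵐ[μ] F' n) (hf : f =ᵐ[μ] f') {G : α → ℝ} (hG : MemLp G 2 μ)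
    (hb : ∀ᶠ n in l, ∀ᵐ x ∂μ, ‖F' n x - f' x‖ ≤ G x)
    (hlim : ∀ᵐ x ∂μ, Tendsto (fun n => F' n x) l (𝓝 (f' x))) : Tendsto F l (𝓝 f) := by
  have norm_sq_sub (n : ι) : ‖F n - f‖ ^ 2 = ∫ x, ‖F' n x - f' x‖ ^ 2 ∂μ := by
    rw [norm_sq_eq_integral_norm_sq]
    refine integral_congr_ae ?_
    filter_upwards [Lp.coeFn_sub (F n) f, hF n, hf] with x hsub hFx hfx
    rw [hsub, Pi.sub_apply, hFx, hfx]
  have tendsto_sq : Tendsto (fun n => ‖F n - f‖ ^ 2) l (𝓝 0) := by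
    simp_rw [norm_sq_sub]
    rw [← integral_zero α ℝ (μ := μ)]
    refine tendsto_integral_filter_of_dominated_convergence (fun x => G x ^ 2)
      (Eventually.of_forall fun n => ?_) ?_ hG.integrable_sq ?_
    · exact (((Lp.memLp (F n)).1.congr (hF n)).sub ((Lp.memLp f).1.congr hf)).norm.pow 2
    · filter_upwards [hb] with n hn
      filter_upwards [hn] with x hx
      rw [Real.norm_of_nonneg (by positivity)]
      gcongr
    · filter_upwards [hlim] with x hx
      simpa using (tendsto_iff_norm_sub_tendsto_zero.1 hx).pow 2
  rw [tendsto_iff_norm_sub_tendsto_zero]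
  simpa using tendsto_sq.sqrt

end LTwo

/-! ### Phases and translations -/

section Phase

variable {V : Type*} [TopologicalSpace V] [MeasurableSpace V] [OpensMeasurableSpace V]
  {μ : Measure V} {q : ℝ≥0∞}

theorem memLp_phase_mul (m : C(V, ℝ)) {f : V → ℂ} (hf : MemLp f q μ) :
    MemLp (fun x => Complex.exp (m x * Complex.I) * f x) q μ :=
  hf.of_le ((Continuous.aestronglyMeasurable (by fun_prop)).mul hf.1)
    (Eventually.of_forall fun x => by simp [Complex.norm_exp_ofReal_mul_I])

variable [Fact (1 ≤ q)]

/-- Multiplication by the unimodular function `exp (i m)`, where `m` is a real phase. -/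
def phaseMul (m : C(V, ℝ)) : Lp ℂ q μ →ₗᵢ[ℂ] Lp ℂ q μ where
  toFun f := (memLp_phase_mul m (Lp.memLp f)).toLp
  map_add' f g := by
    refine Lp.ext ?_
    have hf := memLp_phase_mul m (Lp.memLp f)
    have hg := memLp_phase_mul m (Lp.memLp g)
    filter_upwards [(memLp_phase_mul m (Lp.memLp (f + g))).coeFn_toLp, hf.coeFn_toLp,
      hg.coeFn_toLp, Lp.coeFn_add f g, Lp.coeFn_add hf.toLp hg.toLp]
      with x hsum hfx hgx hadd hadd'
    rw [hsum, hadd', Pi.add_apply, hfx, hgx, hadd, Pi.add_apply, mul_add]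
  map_smul' c f := by
    refine Lp.ext ?_
    have hf := memLp_phase_mul m (Lp.memLp f)
    filter_upwards [(memLp_phase_mul m (Lp.memLp (c • f))).coeFn_toLp, hf.coeFn_toLp,
      Lp.coeFn_smul c f, Lp.coeFn_smul c hf.toLp] with x hcf hfx hsmul hsmul'
    simp only [RingHom.id_apply]
    rw [hcf, hsmul', Pi.smul_apply, hfx, hsmul, Pi.smul_apply, smul_eq_mul, smul_eq_mul,
      mul_left_comm]
  norm_map' f := by
    refine norm_eq_of_ae_norm_eq ?_
    filter_upwards [(memLp_phase_mul m (Lp.memLp f)).coeFn_toLp] with x hx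
    simp only [LinearMap.coe_mk, AddHom.coe_mk]
    rw [hx, norm_mul, Complex.norm_exp_ofReal_mul_I, one_mul]

theorem coeFn_phaseMul (m : C(V, ℝ)) (f : Lp ℂ q μ) :
    phaseMul m f =ᵐ[μ] fun x => Complex.exp (m x * Complex.I) * f x :=
  (memLp_phase_mul m (Lp.memLp f)).coeFn_toLp

theorem phaseMul_toLp (m : C(V, ℝ)) {f : V → ℂ} (hf : MemLp f q μ) :
    phaseMul m hf.toLp = (memLp_phase_mul m hf).toLp := by
  refine MemLp.toLp_congr (memLp_phase_mul m (Lp.memLp _)) (memLp_phase_mul m hf) ?_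
  filter_upwards [hf.coeFn_toLp] with x hx
  rw [hx]

theorem phaseMul_phaseMul (m n : C(V, ℝ)) (f : Lp ℂ q μ) :
    phaseMul m (phaseMul n f) = phaseMul (m + n) f := by
  refine Lp.ext ?_
  filter_upwards [coeFn_phaseMul m (phaseMul n f), coeFn_phaseMul n f, coeFn_phaseMul (m + n) f]
    with x hm hn hmn
  rw [hm, hn, hmn]
  simp [← mul_assoc, ← Complex.exp_add, add_mul]

theorem phaseMul_zero (f : Lp ℂ q μ) : phaseMul 0 f = f := by
  refine Lp.ext ?_
  filter_upwards [coeFn_phaseMul 0 f] with x hx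
  simp [hx]

theorem ae_norm_phaseMul_le {M : ℝ} {f : Lp ℂ q μ} (hf : ∀ᵐ x ∂μ, ‖f x‖ ≤ M) (m : C(V, ℝ)) :
    ∀ᵐ x ∂μ, ‖phaseMul m f x‖ ≤ M := by
  filter_upwards [coeFn_phaseMul m f, hf] with x hphase hx
  rwa [hphase, norm_mul, Complex.norm_exp_ofReal_mul_I, one_mul]

end Phase

section Translate

variable {V F : Type*} [AddGroup V] [MeasurableSpace V] [MeasurableAdd V] {μ : Measure V}
  [μ.IsAddRightInvariant] [NormedAddCommGroup F] [NormedSpace ℂ F] {q : ℝ≥0∞} [Fact (1 ≤ q)]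

theorem ae_comp_sub {P : V → Prop} (h : V) (hP : ∀ᵐ x ∂μ, P x) : ∀ᵐ x ∂μ, P (x - h) :=
  (measurePreserving_sub_right μ h).quasiMeasurePreserving.ae hP

/-- Translation by `h`, `f ↦ f (· - h)`. -/
def translate (h : V) : Lp F q μ →ₗᵢ[ℂ] Lp F q μ :=
  Lp.compMeasurePreservingₗᵢ ℂ (fun x => x - h) (measurePreserving_sub_right μ h)

theorem coeFn_translate (h : V) (f : Lp F q μ) : translate h f =ᵐ[μ] fun x => f (x - h) :=
  Lp.coeFn_compMeasurePreserving f (measurePreserving_sub_right μ h)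

theorem translate_zero (f : Lp F q μ) : translate 0 f = f := by
  refine Lp.ext ?_
  filter_upwards [coeFn_translate 0 f] with x hx
  rw [hx, sub_zero]

theorem ae_norm_translate_le {M : ℝ} {f : Lp F q μ} (hf : ∀ᵐ x ∂μ, ‖f x‖ ≤ M) (h : V) :
    ∀ᵐ x ∂μ, ‖translate h f x‖ ≤ M := by
  filter_upwards [coeFn_translate h f, ae_comp_sub h hf] with x htrans hx
  rwa [htrans]

end Translate

/-! ### The Fourier transform on `L²` -/

section Fourier

variable {V F : Type*} [NormedAddCommGroup V] [InnerProductSpace ℝ V] [FiniteDimensional ℝ V]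
  [MeasurableSpace V] [BorelSpace V]

section Hilbert

variable [NormedAddCommGroup F] [InnerProductSpace ℂ F]

theorem Lp_two_ext_of_schwartzMap {Y : Type*} [TopologicalSpace Y] [T2Space Y]
    {A B : Lp F 2 (volume : Measure V) → Y} (hA : Continuous A) (hB : Continuous B)
    (h : ∀ φ : 𝓢(V, F), A (φ.toLp 2) = B (φ.toLp 2)) : A = B := by
  refine DenseRange.equalizer
    (SchwartzMap.denseRange_toLpCLM (F := F) (E := V) (p := 2) (μ := volume)
      ENNReal.ofNat_ne_top) hA hB ?_
  ext1 φ
  exact h φ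

variable [CompleteSpace F]

theorem ae_eq_of_integral_schwartzMap_smul_eq {f g : V → F} (hf : LocallyIntegrable f)
    (hg : LocallyIntegrable g)
    (h : ∀ φ : 𝓢(V, ℂ), ∫ x, φ x • f x = ∫ x, φ x • g x) : f =ᵐ[volume] g := by
  refine ae_eq_of_integral_contDiff_smul_eq hf hg fun φ hφ hφc => ?_
  have hcs : HasCompactSupport (Complex.ofRealCLM ∘ φ) := hφc.comp_left rfl
  simpa using h (hcs.toSchwartzMap (Complex.ofRealCLM.contDiff.comp hφ))

theorem coeFn_fourier_toLp {f : V → F} (hf : Integrable f) (hf₂ : MemLp f 2 volume) :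
    (𝓕 (hf₂.toLp : Lp F 2 (volume : Measure V)) : Lp F 2 (volume : Measure V)) =ᵐ[volume]
      𝓕 f := by
  have hcont : Continuous (𝓕 f) := VectorFourier.fourierIntegral_continuous
    Real.continuous_fourierChar (innerSL ℝ).continuous₂ hf
  refine ae_eq_of_integral_schwartzMap_smul_eq
    ((Lp.memLp _).locallyIntegrable (by norm_num)) hcont.locallyIntegrable fun φ => ?_
  have weak_fourier := congrArg (fun D => D φ)
    (Lp.fourier_toTemperedDistribution_eq (hf₂.toLp : Lp F 2 (volume : Measure V)))
  simp only [TemperedDistribution.fourier_apply, Lp.toTemperedDistribution_apply] at weak_fourier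
  have exchange := VectorFourier.integral_fourierIntegral_smul_eq_flip (L := innerₗ V)
    (μ := volume) (ν := volume) (f := φ) (g := f) Real.continuous_fourierChar
    (by simpa using continuous_inner (𝕜 := ℝ) (E := V)) φ.integrable hf
  rw [flip_innerₗ] at exchange
  rw [← weak_fourier]
  refine Eq.trans (integral_congr_ae ?_) exchange
  filter_upwards [hf₂.coeFn_toLp] with x hx
  rw [hx, SchwartzMap.fourier_coe]
  rfl

theorem coeFn_fourierInv_toLp {f : V → F} (hf : Integrable f) (hf₂ : MemLp f 2 volume) :
    (𝓕⁻ (hf₂.toLp : Lp F 2 (volume : Measure V)) : Lp F 2 (volume : Measure V)) =ᵐ[volume]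
      𝓕⁻ f := by
  have hcont : Continuous (𝓕⁻ f) := by
    rw [show 𝓕⁻ f = fun x => 𝓕 f (-x) from funext fun x => Real.fourierInv_eq_fourier_neg f x]
    exact (VectorFourier.fourierIntegral_continuous Real.continuous_fourierChar
      (innerSL ℝ).continuous₂ hf).comp continuous_neg
  refine ae_eq_of_integral_schwartzMap_smul_eq
    ((Lp.memLp _).locallyIntegrable (by norm_num)) hcont.locallyIntegrable fun φ => ?_
  have weak_fourierInv := congrArg (fun D => D φ)
    (Lp.fourierInv_toTemperedDistribution_eq (hf₂.toLp : Lp F 2 (volume : Measure V)))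
  simp only [TemperedDistribution.fourierInv_apply, Lp.toTemperedDistribution_apply]
    at weak_fourierInv
  have exchange := VectorFourier.integral_fourierIntegral_smul_eq_flip (L := -(innerₗ V))
    (μ := volume) (ν := volume) (f := φ) (g := f) Real.continuous_fourierChar
    (continuous_inner (𝕜 := ℝ) (E := V)).neg φ.integrable hf
  rw [show (-(innerₗ V)).flip = -(innerₗ V) by ext x y; simp [real_inner_comm]] at exchange
  rw [← weak_fourierInv]
  refine Eq.trans (integral_congr_ae ?_) exchange
  filter_upwards [hf₂.coeFn_toLp] with x hx
  rw [hx, SchwartzMap.fourierInv_coe]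
  rfl

end Hilbert

theorem integrable_phase_mul {V : Type*} [TopologicalSpace V] [MeasurableSpace V]
    [OpensMeasurableSpace V] {μ : Measure V} (m : C(V, ℝ)) {f : V → ℂ} (hf : Integrable f μ) :
    Integrable (fun x => Complex.exp (m x * Complex.I) * f x) μ :=
  memLp_one_iff_integrable.1 (memLp_phase_mul m (memLp_one_iff_integrable.2 hf))

theorem coeFn_fourier_phaseMul_toLp (m : C(V, ℝ)) {f : V → ℂ} (hf : Integrable f)
    (hf₂ : MemLp f 2 volume) :
    (𝓕 (phaseMul m hf₂.toLp : Lp ℂ 2 (volume : Measure V)) : Lp ℂ 2 (volume : Measure V))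
      =ᵐ[volume] 𝓕 (fun x => Complex.exp (m x * Complex.I) * f x) := by
  rw [phaseMul_toLp]
  exact coeFn_fourier_toLp (integrable_phase_mul m hf) _

theorem coeFn_fourierInv_phaseMul_toLp (m : C(V, ℝ)) {f : V → ℂ} (hf : Integrable f)
    (hf₂ : MemLp f 2 volume) :
    (𝓕⁻ (phaseMul m hf₂.toLp : Lp ℂ 2 (volume : Measure V)) : Lp ℂ 2 (volume : Measure V))
      =ᵐ[volume] 𝓕⁻ (fun x => Complex.exp (m x * Complex.I) * f x) := by
  rw [phaseMul_toLp]
  exact coeFn_fourierInv_toLp (integrable_phase_mul m hf) _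

/-- The phase `x ↦ ⟨h, x⟩` of a plane wave. -/
def planeWave (h : V) : C(V, ℝ) where
  toFun x := inner ℝ h x

theorem fourier_planeWave_mul (h : V) (f : V → ℂ) (ξ : V) :
    𝓕 (fun x => Complex.exp (planeWave h x * Complex.I) * f x) ξ =
      𝓕 f (ξ - (2 * Real.pi)⁻¹ • h) := by
  rw [Real.fourier_eq', Real.fourier_eq']
  congr 1 with x
  simp only [planeWave, ContinuousMap.coe_mk, smul_eq_mul, ← mul_assoc, ← Complex.exp_add]
  congr 2
  rw [inner_sub_right, inner_smul_right, real_inner_comm x h]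
  push_cast
  have : (Real.pi : ℂ) ≠ 0 := by exact_mod_cast Real.pi_ne_zero
  field_simp
  ring

theorem fourier_comp_sub_right (h : V) (f : V → ℂ) (ξ : V) :
    𝓕 (fun x => f (x - h)) ξ =
      Complex.exp (planeWave (-(2 * Real.pi) • h) ξ * Complex.I) * 𝓕 f ξ := by
  have shift := congrFun
    (VectorFourier.fourierIntegral_comp_add_right Real.fourierChar volume (innerₗ V) f (-h)) ξ
  simp only [innerₗ_apply_apply, Circle.smul_def, Real.fourierChar_apply, smul_eq_mul,
    inner_neg_left] at shift
  simp only [Function.comp_def, ← sub_eq_add_neg] at shift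
  simp only [planeWave, ContinuousMap.coe_mk, inner_smul_left, conj_trivial, neg_mul]
  refine shift.trans ?_
  simp only [mul_neg]
  push_cast
  rfl

theorem fourier_phaseMul_planeWave (h : V) (f : Lp ℂ 2 (volume : Measure V)) :
    𝓕 (phaseMul (planeWave h) f) =
      translate ((2 * Real.pi)⁻¹ • h) (𝓕 f : Lp ℂ 2 (volume : Measure V)) := by
  revert f
  refine congrFun (Lp_two_ext_of_schwartzMap ?_ ?_ fun φ => ?_)
  · exact (Lp.fourierTransformₗᵢ V ℂ).continuous.comp (phaseMul _).continuous
  · exact (translate _).continuous.comp (Lp.fourierTransformₗᵢ V ℂ).continuous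
  rw [SchwartzMap.toLp_fourier_eq]
  refine Lp.ext ?_
  filter_upwards [coeFn_fourier_phaseMul_toLp (planeWave h) φ.integrable (φ.memLp 2),
    coeFn_translate ((2 * Real.pi)⁻¹ • h) ((𝓕 φ).toLp 2),
    ae_comp_sub ((2 * Real.pi)⁻¹ • h) ((𝓕 φ).coeFn_toLp 2 (μ := volume))]
    with ξ hfourier htrans hcoe
  rw [htrans, hcoe, SchwartzMap.fourier_coe, ← fourier_planeWave_mul]
  exact hfourier

theorem fourier_translate (h : V) (f : Lp ℂ 2 (volume : Measure V)) :
    𝓕 (translate h f) =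
      phaseMul (planeWave (-(2 * Real.pi) • h)) (𝓕 f : Lp ℂ 2 (volume : Measure V)) := by
  revert f
  refine congrFun (Lp_two_ext_of_schwartzMap ?_ ?_ fun φ => ?_)
  · exact (Lp.fourierTransformₗᵢ V ℂ).continuous.comp (translate _).continuous
  · exact (phaseMul _).continuous.comp (Lp.fourierTransformₗᵢ V ℂ).continuous
  have hmem : MemLp (fun x => φ (x - h)) 2 volume :=
    (φ.memLp 2).comp_measurePreserving (measurePreserving_sub_right volume h)
  have hint : Integrable (fun x => φ (x - h)) volume := φ.integrable.comp_sub_right h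
  have hφ : translate h (φ.toLp 2 : Lp ℂ 2 (volume : Measure V)) = hmem.toLp := rfl
  rw [hφ, SchwartzMap.toLp_fourier_eq]
  refine Lp.ext ?_
  filter_upwards [coeFn_fourier_toLp hint hmem, coeFn_phaseMul (planeWave (-(2 * Real.pi) • h))
    ((𝓕 φ).toLp 2), (𝓕 φ).coeFn_toLp 2 (μ := volume)] with ξ hfourier hphase hcoe
  rw [hfourier, hphase, hcoe, SchwartzMap.fourier_coe, fourier_comp_sub_right]

end Fourier

theorem ae_norm_fourierInv_le {V F : Type*} [NormedAddCommGroup V] [InnerProductSpace ℝ V]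
    [FiniteDimensional ℝ V] [MeasurableSpace V] [BorelSpace V] [NormedAddCommGroup F]
    [InnerProductSpace ℂ F] [CompleteSpace F] {g : Lp F 2 (volume : Measure V)}
    (hg : Integrable g) :
    ∀ᵐ x, ‖(𝓕⁻ g : Lp F 2 (volume : Measure V)) x‖ ≤ ∫ ξ, ‖g ξ‖ := by
  have coeFn_inv := coeFn_fourierInv_toLp hg (Lp.memLp g)
  rw [Lp.toLp_coeFn] at coeFn_inv
  filter_upwards [coeFn_inv] with x hx
  rw [hx, Real.fourierInv_eq]
  refine (norm_integral_le_integral_norm _).trans_eq ?_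
  simp_rw [Circle.norm_smul]

/-! ### The free propagator -/

/-- The physical space `ℝᵈ`, with its Euclidean norm. -/
abbrev Space (d : ℕ) : Type := EuclideanSpace ℝ (Fin d)

variable {d : ℕ}

/-- The real phase of the symbol of the free propagator, `schrodingerSymbol σ = exp (i ·)`. -/
def schrodingerPhase (σ : ℝ) : C(Space d, ℝ) where
  toFun ξ := -(σ * (2 * Real.pi * ‖ξ‖) ^ 2)

theorem schrodingerSymbol_eq_exp (σ : ℝ) (ξ : Space d) :
    schrodingerSymbol σ ξ = Complex.exp (schrodingerPhase σ ξ * Complex.I) := by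
  rw [schrodingerSymbol, schrodingerPhase]
  congr 1
  simp [-Complex.ofReal_mul, -Complex.ofReal_pow, mul_comm]

/-- The free propagator as a linear isometry. -/
def freePropIsometry (σ : ℝ) : L2 d →ₗᵢ[ℂ] L2 d :=
  (Lp.fourierTransformₗᵢ (Space d) ℂ).symm.toLinearIsometry.comp
    ((phaseMul (schrodingerPhase σ)).comp (Lp.fourierTransformₗᵢ (Space d) ℂ).toLinearIsometry)

theorem freeProp_eq_fourierInv (σ : ℝ) (f : L2 d) :
    freeProp σ f = 𝓕⁻ (phaseMul (schrodingerPhase σ) (𝓕 f : L2 d)) := by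
  rw [freeProp, fourierMultiplier, dif_pos (memLp_schrodingerSymbol_mul σ f)]
  congr 1
  refine MemLp.toLp_congr _ (memLp_phase_mul _ (Lp.memLp _)) (Eventually.of_forall fun ξ => ?_)
  simp only [schrodingerSymbol_eq_exp]

theorem freePropIsometry_apply (σ : ℝ) (f : L2 d) : freePropIsometry σ f = freeProp σ f := by
  rw [freeProp_eq_fourierInv]
  rfl

theorem fourier_freeProp (σ : ℝ) (f : L2 d) :
    (𝓕 (freeProp σ f) : L2 d) = phaseMul (schrodingerPhase σ) (𝓕 f : L2 d) := by
  rw [freeProp_eq_fourierInv, FourierTransform.fourier_fourierInv_eq]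

theorem eq_of_fourier_eq {f g : L2 d} (h : (𝓕 f : L2 d) = 𝓕 g) : f = g :=
  (Lp.fourierTransformₗᵢ (Space d) ℂ).injective h

theorem freeProp_freeProp (σ τ : ℝ) (f : L2 d) :
    freeProp σ (freeProp τ f) = freeProp (σ + τ) f := by
  refine eq_of_fourier_eq ?_
  rw [fourier_freeProp, fourier_freeProp, fourier_freeProp, phaseMul_phaseMul]
  congr 2
  ext ξ
  simp only [schrodingerPhase, ContinuousMap.add_apply, ContinuousMap.coe_mk]
  ring

theorem freeProp_zero (f : L2 d) : freeProp 0 f = f := by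
  have phase_eq_zero : schrodingerPhase 0 = (0 : C(Space d, ℝ)) := by
    ext ξ
    simp [schrodingerPhase]
  exact eq_of_fourier_eq (by rw [fourier_freeProp, phase_eq_zero, phaseMul_zero])

theorem freeProp_sub (σ : ℝ) (f g : L2 d) : freeProp σ (f - g) = freeProp σ f - freeProp σ g := by
  simp only [← freePropIsometry_apply, map_sub]

theorem freeProp_smul (σ : ℝ) (c : ℂ) (f : L2 d) : freeProp σ (c • f) = c • freeProp σ f := by
  simp only [← freePropIsometry_apply, map_smul]

theorem norm_freeProp (σ : ℝ) (f : L2 d) : ‖freeProp σ f‖ = ‖f‖ := by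
  simp only [← freePropIsometry_apply, LinearIsometry.norm_map]

theorem inner_freeProp (σ : ℝ) (f g : L2 d) :
    inner ℂ (freeProp σ f) (freeProp σ g) = inner ℂ f g := by
  simp only [← freePropIsometry_apply, LinearIsometry.inner_map_map]

theorem inner_freeProp_neg_left (σ : ℝ) (f g : L2 d) :
    inner ℂ (freeProp (-σ) f) g = inner ℂ f (freeProp σ g) := by
  rw [← inner_freeProp σ, freeProp_freeProp, add_neg_cancel, freeProp_zero]

theorem continuous_freeProp_left (f : L2 d) : Continuous fun σ => freeProp σ f := by
  have continuous_phase : Continuous fun σ : ℝ => phaseMul (schrodingerPhase σ) (𝓕 f : L2 d) := by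
    rw [continuous_iff_continuousAt]
    intro σ₀
    refine tendsto_Lp_two_of_dominated (fun σ => coeFn_phaseMul _ _) (coeFn_phaseMul _ _)
      (G := fun ξ => 2 * ‖(𝓕 f : L2 d) ξ‖) ((Lp.memLp _).norm.const_mul 2)
      (Eventually.of_forall fun σ => Eventually.of_forall fun ξ => ?_)
      (Eventually.of_forall fun ξ => ?_)
    · refine (norm_sub_le _ _).trans ?_
      simp only [norm_mul, Complex.norm_exp_ofReal_mul_I, one_mul, two_mul, le_refl]
    · refine Continuous.tendsto (?_ : Continuous fun σ : ℝ =>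
        Complex.exp (schrodingerPhase σ ξ * Complex.I) * (𝓕 f : L2 d) ξ) σ₀
      simp only [schrodingerPhase, ContinuousMap.coe_mk]
      fun_prop
  simp_rw [freeProp_eq_fourierInv]
  exact (Lp.fourierTransformₗᵢ (Space d) ℂ).symm.continuous.comp continuous_phase

theorem continuous_freeProp : Continuous fun q : ℝ × L2 d => freeProp q.1 q.2 := by
  rw [continuous_iff_continuousAt]
  rintro ⟨σ₀, f₀⟩
  rw [ContinuousAt, tendsto_iff_norm_sub_tendsto_zero]
  have tendsto_bound :
      Tendsto (fun q : ℝ × L2 d => ‖q.2 - f₀‖ + ‖freeProp q.1 f₀ - freeProp σ₀ f₀‖)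
        (𝓝 (σ₀, f₀)) (𝓝 0) := by
    have hc : Continuous fun q : ℝ × L2 d => ‖q.2 - f₀‖ + ‖freeProp q.1 f₀ - freeProp σ₀ f₀‖ :=
      (continuous_snd.sub continuous_const).norm.add
        (((continuous_freeProp_left f₀).comp continuous_fst).sub continuous_const).norm
    simpa using hc.tendsto (σ₀, f₀)
  refine squeeze_zero (fun _ => norm_nonneg _) (fun q => ?_) tendsto_bound
  calc ‖freeProp q.1 q.2 - freeProp σ₀ f₀‖
      = ‖freeProp q.1 (q.2 - f₀) + (freeProp q.1 f₀ - freeProp σ₀ f₀)‖ := by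
        rw [freeProp_sub, sub_add_sub_cancel]
    _ ≤ ‖q.2 - f₀‖ + ‖freeProp q.1 f₀ - freeProp σ₀ f₀‖ :=
        (norm_add_le _ _).trans_eq (by rw [norm_freeProp])

theorem freeProp_phaseMul_planeWave (σ : ℝ) (h : Space d) (f : L2 d) :
    freeProp σ (phaseMul (planeWave h) f) =
      Complex.exp ((-(σ * ‖h‖ ^ 2) : ℝ) * Complex.I) •
        phaseMul (planeWave h) (translate ((2 * σ) • h) (freeProp σ f)) := by
  refine eq_of_fourier_eq ?_
  rw [fourier_freeProp, fourier_phaseMul_planeWave, FourierTransform.fourier_smul,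
    fourier_phaseMul_planeWave, fourier_translate, fourier_freeProp, phaseMul_phaseMul]
  set g : L2 d := 𝓕 f
  set k : Space d := (2 * Real.pi)⁻¹ • h
  set m : C(Space d, ℝ) := planeWave (-(2 * Real.pi) • (2 * σ) • h) + schrodingerPhase σ
  refine Lp.ext ?_
  filter_upwards [coeFn_phaseMul (schrodingerPhase σ) (translate k g), coeFn_translate k g,
    Lp.coeFn_smul (Complex.exp ((-(σ * ‖h‖ ^ 2) : ℝ) * Complex.I)) (translate k (phaseMul m g)),
    coeFn_translate k (phaseMul m g), ae_comp_sub k (coeFn_phaseMul m g)]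
    with ξ hphase htrans hsmul htrans' hphase'
  rw [hphase, htrans, hsmul, Pi.smul_apply, htrans', hphase', smul_eq_mul, ← mul_assoc,
    ← Complex.exp_add, ← add_mul, ← Complex.ofReal_add]
  congr 4
  have hpi := Real.pi_ne_zero
  simp only [m, k, schrodingerPhase, planeWave, ContinuousMap.coe_mk, ContinuousMap.add_apply,
    inner_sub_right, inner_smul_left, inner_smul_right, mul_pow, norm_sub_sq_real, norm_smul,
    real_inner_self_eq_norm_sq, real_inner_comm h ξ, map_neg, map_mul, map_ofNat, conj_trivial,
    Real.norm_eq_abs, sq_abs]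
  field_simp
  ring

/-! ### Sobolev embedding along the free flow -/

/-- The free evolution of `f` is bounded by `M` at all the times in `I`. -/
def FlowBoundedOn (I : Set ℝ) (M : ℝ) (f : L2 d) : Prop :=
  ∀ σ ∈ I, ∀ᵐ x, ‖freeProp σ f x‖ ≤ M

theorem FlowBoundedOn.mono {I J : Set ℝ} {M N : ℝ} {f : L2 d} (h : FlowBoundedOn I M f)
    (hJ : J ⊆ I) (hM : M ≤ N) : FlowBoundedOn J N f := fun σ hσ => by
  filter_upwards [h σ (hJ hσ)] with x hx using hx.trans hM

/-- The weight `(1 + |2πξ|²)^{s/2}` of the Sobolev norm of order `s`. -/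
def sobolevWeight (s : ℝ) (ξ : Space d) : ℝ := (1 + (2 * Real.pi * ‖ξ‖) ^ 2) ^ (s / 2)

theorem sobolevWeight_pos (s : ℝ) (ξ : Space d) : 0 < sobolevWeight s ξ := by
  unfold sobolevWeight; positivity

theorem continuous_sobolevWeight (s : ℝ) : Continuous (sobolevWeight s : Space d → ℝ) := by
  unfold sobolevWeight
  refine Continuous.rpow_const (by fun_prop) fun ξ => Or.inl ?_
  positivity

theorem memLp_inv_sobolevWeight {s : ℝ} (hs : (d : ℝ) / 2 < s) :
    MemLp (fun ξ : Space d => (sobolevWeight s ξ)⁻¹) 2 volume := by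
  have hcont : Continuous fun ξ : Space d => (sobolevWeight s ξ)⁻¹ :=
    (continuous_sobolevWeight s).inv₀ fun ξ => (sobolevWeight_pos s ξ).ne'
  rw [memLp_two_iff_integrable_sq hcont.aestronglyMeasurable]
  have integrable_japanese : Integrable fun ξ : Space d => (1 + ‖ξ‖ ^ 2) ^ (-(2 * s) / 2) :=
    integrable_rpow_neg_one_add_norm_sq (by rw [finrank_euclideanSpace_fin]; linarith)
  refine integrable_japanese.mono' (hcont.pow 2).aestronglyMeasurable
    (Eventually.of_forall fun ξ => ?_)
  have hs0 : 0 ≤ s := le_trans (by positivity) hs.le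
  rw [Real.norm_of_nonneg (by positivity), sobolevWeight, ← Real.rpow_neg (by positivity),
    ← Real.rpow_natCast, ← Real.rpow_mul (by positivity),
    show -(s / 2) * ((2 : ℕ) : ℝ) = -(2 * s) / 2 by push_cast; ring]
  refine Real.rpow_le_rpow_of_nonpos (by positivity) ?_ (by linarith)
  have hpi : 1 ≤ 2 * Real.pi := by linarith [Real.pi_gt_three]
  gcongr
  exact le_mul_of_one_le_left (norm_nonneg _) hpi

theorem eLpNorm_one_fourier_le (s : ℝ) (f : L2 d) :
    eLpNorm (𝓕 f : L2 d) 1 volume ≤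
      eLpNorm (fun ξ : Space d => (sobolevWeight s ξ)⁻¹) 2 volume * sobolevNorm s f := by
  set g : L2 d := 𝓕 f
  have factor : ((fun ξ : Space d => (sobolevWeight s ξ)⁻¹) • fun ξ =>
      ((sobolevWeight s ξ : ℝ) : ℂ) * g ξ) = g := by
    ext ξ
    rw [Pi.smul_apply', Complex.real_smul, ← mul_assoc, ← Complex.ofReal_mul,
      inv_mul_cancel₀ (sobolevWeight_pos s ξ).ne', Complex.ofReal_one, one_mul]
  have hweighted : AEStronglyMeasurable (fun ξ : Space d => ((sobolevWeight s ξ : ℝ) : ℂ) * g ξ) :=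
    (Complex.continuous_ofReal.comp (continuous_sobolevWeight s)).aestronglyMeasurable.mul
      (Lp.memLp g).1
  have hinv : AEStronglyMeasurable (fun ξ : Space d => (sobolevWeight s ξ)⁻¹) :=
    ((continuous_sobolevWeight s).inv₀ fun ξ => (sobolevWeight_pos s ξ).ne').aestronglyMeasurable
  have holder := eLpNorm_smul_le_mul_eLpNorm (p := 2) (q := 2) (r := 1) hweighted hinv
  rwa [factor] at holder

theorem exists_flowBoundedOn_of_sobolevNorm_le {s : ℝ} (hs : (d : ℝ) / 2 < s) {R : ℝ≥0∞}
    (hR : R ≠ ∞) :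
    ∃ M : ℝ, 0 ≤ M ∧ ∀ f : L2 d, sobolevNorm s f ≤ R → FlowBoundedOn univ M f := by
  set A := eLpNorm (fun ξ : Space d => (sobolevWeight s ξ)⁻¹) 2 volume
  have hAR : A * R ≠ ∞ := ENNReal.mul_ne_top (memLp_inv_sobolevWeight hs).2.ne hR
  refine ⟨(A * R).toReal, ENNReal.toReal_nonneg, fun f hf σ _ => ?_⟩
  set g : L2 d := phaseMul (schrodingerPhase σ) (𝓕 f : L2 d)
  have eLpNorm_le : eLpNorm g 1 volume ≤ A * R := by
    have : eLpNorm g 1 volume = eLpNorm (𝓕 f : L2 d) 1 volume := by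
      refine eLpNorm_congr_norm_ae ?_
      filter_upwards [coeFn_phaseMul (schrodingerPhase σ) (𝓕 f : L2 d)] with ξ hξ
      rw [hξ, norm_mul, Complex.norm_exp_ofReal_mul_I, one_mul]
    rw [this]
    exact (eLpNorm_one_fourier_le s f).trans (mul_le_mul_right hf A)
  have hg : Integrable g := memLp_one_iff_integrable.1
    ⟨(Lp.memLp g).1, eLpNorm_le.trans_lt hAR.lt_top⟩
  rw [freeProp_eq_fourierInv]
  filter_upwards [ae_norm_fourierInv_le hg] with x hx
  refine hx.trans ?_
  rw [integral_norm_eq_lintegral_enorm hg.1, ← eLpNorm_one_eq_lintegral_enorm]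
  exact ENNReal.toReal_mono hAR eLpNorm_le

/-! ### The power nonlinearity -/

theorem norm_pow_smul_sub_le {E : Type*} [SeminormedAddCommGroup E] [NormedSpace ℝ E] (p : ℕ)
    {M : ℝ} {a b : E} (ha : ‖a‖ ≤ M) (hb : ‖b‖ ≤ M) :
    ‖‖a‖ ^ p • a - ‖b‖ ^ p • b‖ ≤ (p + 1) * M ^ p * ‖a - b‖ := by
  have hM : 0 ≤ M := (norm_nonneg a).trans ha
  induction p with
  | zero => simp
  | succ p ih =>
    have split : ‖a‖ ^ (p + 1) • a - ‖b‖ ^ (p + 1) • b =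
        ‖a‖ • (‖a‖ ^ p • a - ‖b‖ ^ p • b) + (‖a‖ - ‖b‖) • ‖b‖ ^ p • b := by
      simp only [smul_sub, smul_smul, pow_succ', sub_smul (‖a‖)]
      abel
    have bound_left : ‖‖a‖ • (‖a‖ ^ p • a - ‖b‖ ^ p • b)‖ ≤ M * ((p + 1) * M ^ p * ‖a - b‖) := by
      rw [norm_smul, norm_norm]
      gcongr
    have bound_right : ‖(‖a‖ - ‖b‖) • ‖b‖ ^ p • b‖ ≤ ‖a - b‖ * (M ^ p * M) := by
      rw [norm_smul, norm_smul, Real.norm_eq_abs, Real.norm_of_nonneg (by positivity)]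
      gcongr
      exact abs_norm_sub_norm_le a b
    rw [split]
    refine (norm_add_le _ _).trans ((add_le_add bound_left bound_right).trans_eq ?_)
    push_cast
    ring

theorem exists_pow_taylor_bound (n : ℕ) (R : ℝ) : ∃ C : ℝ, 0 ≤ C ∧ ∀ r s : ℝ, |r| ≤ R → |s| ≤ R →
    |r ^ (n + 1) - s ^ (n + 1) - (n + 1) * s ^ n * (r - s)| ≤ C * (r - s) ^ 2 := by
  induction n with
  | zero => exact ⟨0, le_rfl, fun r s _ _ => by simp⟩
  | succ n ih =>
    obtain ⟨C, hC, h⟩ := ih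
    refine ⟨|R| * C + (n + 1) * |R| ^ n, by positivity, fun r s hr hs => ?_⟩
    have split :
        r ^ (n + 1 + 1) - s ^ (n + 1 + 1) - ((n + 1 : ℕ) + 1) * s ^ (n + 1) * (r - s) =
          r * (r ^ (n + 1) - s ^ (n + 1) - (n + 1) * s ^ n * (r - s)) +
            (n + 1) * s ^ n * (r - s) ^ 2 := by
      push_cast; ring
    rw [split]
    refine (abs_add_le _ _).trans ?_
    rw [abs_mul, abs_mul, abs_mul, abs_pow, abs_of_nonneg (by positivity : (0 : ℝ) ≤ n + 1),
      abs_of_nonneg (sq_nonneg (r - s)), add_mul (|R| * C), mul_assoc |R|]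
    have hr' := hr.trans (le_abs_self R)
    have hs' := hs.trans (le_abs_self R)
    gcongr
    exact h r s hr hs

theorem exists_norm_pow_taylor_bound {E : Type*} [SeminormedAddCommGroup E]
    [InnerProductSpace ℝ E] (p : ℕ) (M : ℝ) : ∃ C : ℝ, 0 ≤ C ∧ ∀ a b : E, ‖a‖ ≤ M → ‖b‖ ≤ M →
    |‖a‖ ^ (p + 2) - ‖b‖ ^ (p + 2) - (p + 2) * inner ℝ (‖b‖ ^ p • b) (a - b)| ≤
      C * ‖a - b‖ ^ 2 := by
  obtain ⟨C, hC, taylor⟩ := exists_pow_taylor_bound (p + 1) M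
  refine ⟨C + (p + 2) * |M| ^ p, by positivity, fun a b ha hb => ?_⟩
  have sq_sub_le : (‖a‖ - ‖b‖) ^ 2 ≤ ‖a - b‖ ^ 2 :=
    sq_le_sq.2 ((abs_norm_sub_norm_le a b).trans (le_abs_self _))
  have angle_nonneg : 0 ≤ ‖a‖ * ‖b‖ - inner ℝ b a := by
    linarith [real_inner_le_norm b a, mul_comm ‖a‖ ‖b‖]
  have angle_le : ‖a‖ * ‖b‖ - inner ℝ b a ≤ ‖a - b‖ ^ 2 := by
    rw [norm_sub_sq_real, real_inner_comm b a]
    nlinarith [sq_nonneg (‖a‖ - ‖b‖)]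
  have split : ‖a‖ ^ (p + 2) - ‖b‖ ^ (p + 2) - (p + 2) * inner ℝ (‖b‖ ^ p • b) (a - b) =
      (‖a‖ ^ (p + 1 + 1) - ‖b‖ ^ (p + 1 + 1) -
        ((p + 1 : ℕ) + 1) * ‖b‖ ^ (p + 1) * (‖a‖ - ‖b‖)) +
        (p + 2) * ‖b‖ ^ p * (‖a‖ * ‖b‖ - inner ℝ b a) := by
    rw [real_inner_smul_left, inner_sub_right, real_inner_self_eq_norm_sq]
    push_cast
    ring
  rw [split, add_mul C]
  refine (abs_add_le _ _).trans (add_le_add ?_ ?_)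
  · refine (taylor _ _ (by rwa [abs_norm]) (by rwa [abs_norm])).trans ?_
    gcongr
  · have := hb.trans (le_abs_self M)
    rw [abs_of_nonneg (by positivity)]
    gcongr

theorem memLp_norm_pow_mul {p : ℕ} {M : ℝ} {f : L2 d} (hf : ∀ᵐ x, ‖f x‖ ≤ M) :
    MemLp (fun x => ((‖f x‖ ^ p : ℝ) : ℂ) * f x) 2 volume := by
  have hm := (Lp.memLp f).1
  refine (Lp.memLp f).of_le_mul (c := M ^ p)
    ((Complex.continuous_ofReal.comp_aestronglyMeasurable (hm.norm.pow p)).mul hm) ?_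
  filter_upwards [hf] with x hx
  rw [norm_mul, Complex.norm_real, Real.norm_of_nonneg (by positivity)]
  gcongr

theorem coeFn_powerNL {p : ℕ} {M : ℝ} {f : L2 d} (hf : ∀ᵐ x, ‖f x‖ ≤ M) :
    powerNL p f =ᵐ[volume] fun x => ((‖f x‖ ^ p : ℝ) : ℂ) * f x := by
  rw [powerNL, dif_pos (memLp_norm_pow_mul hf)]
  exact MemLp.coeFn_toLp _

theorem norm_powerNL_sub_le {p : ℕ} {M : ℝ} {f g : L2 d} (hf : ∀ᵐ x, ‖f x‖ ≤ M)
    (hg : ∀ᵐ x, ‖g x‖ ≤ M) : ‖powerNL p f - powerNL p g‖ ≤ (p + 1) * M ^ p * ‖f - g‖ := by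
  refine Lp.norm_le_mul_norm_of_ae_le_mul ?_
  filter_upwards [Lp.coeFn_sub (powerNL p f) (powerNL p g), coeFn_powerNL (p := p) hf,
    coeFn_powerNL (p := p) hg, Lp.coeFn_sub f g, hf, hg] with x hsubNL hfNL hgNL hsub hfx hgx
  rw [hsubNL, Pi.sub_apply, hfNL, hgNL, hsub]
  exact norm_pow_smul_sub_le p hfx hgx

/-- The integral `∫ |f|^{p+2}`. -/
def lpMass (p : ℕ) (f : L2 d) : ℝ := ∫ x, ‖f x‖ ^ (p + 2)

theorem lpMass_nonneg (p : ℕ) (f : L2 d) : 0 ≤ lpMass p f :=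
  integral_nonneg fun _ => by positivity

theorem integrable_norm_pow_add_two {p : ℕ} {M : ℝ} {f : L2 d} (hf : ∀ᵐ x, ‖f x‖ ≤ M) :
    Integrable fun x => ‖f x‖ ^ (p + 2) := by
  refine ((integrable_norm_sq f).const_mul (M ^ p)).mono' ((Lp.memLp f).1.norm.pow _) ?_
  filter_upwards [hf] with x hx
  rw [Real.norm_of_nonneg (by positivity), pow_add]
  gcongr

theorem re_inner_eq_integral (f g : L2 d) : (inner ℂ f g).re = ∫ x, (inner ℂ (f x) (g x)).re := by
  rw [L2.inner_def]
  exact (integral_re (𝕜 := ℂ) (L2.integrable_inner f g)).symm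

theorem exists_lpMass_taylor_bound (p : ℕ) (M : ℝ) : ∃ C : ℝ, 0 ≤ C ∧ ∀ f g : L2 d,
    (∀ᵐ x, ‖f x‖ ≤ M) → (∀ᵐ x, ‖g x‖ ≤ M) →
    |lpMass p g - lpMass p f - (p + 2) * (inner ℂ (powerNL p f) (g - f)).re| ≤
      C * ‖g - f‖ ^ 2 := by
  obtain ⟨C, hC, taylor⟩ := exists_norm_pow_taylor_bound (E := ℂ) p M
  refine ⟨C, hC, fun f g hf hg => ?_⟩
  have hinner : Integrable fun x => (inner ℂ (powerNL p f x) ((g - f : L2 d) x)).re :=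
    (L2.integrable_inner (𝕜 := ℂ) (powerNL p f) (g - f)).re
  have hpow : Integrable fun x => ‖g x‖ ^ (p + 2) - ‖f x‖ ^ (p + 2) :=
    (integrable_norm_pow_add_two hg).sub (integrable_norm_pow_add_two hf)
  rw [re_inner_eq_integral, norm_sq_eq_integral_norm_sq, lpMass, lpMass,
    ← integral_sub (integrable_norm_pow_add_two hg) (integrable_norm_pow_add_two hf),
    ← integral_const_mul, ← integral_const_mul, ← integral_sub hpow (hinner.const_mul _)]
  refine abs_integral_le_integral_abs.trans (integral_mono_ae ?_ ?_ ?_)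
  · exact (hpow.sub (hinner.const_mul _)).abs
  · exact (integrable_norm_sq _).const_mul C
  · filter_upwards [hf, hg, coeFn_powerNL (p := p) hf, Lp.coeFn_sub g f] with x hfx hgx hNL hsub
    rw [hNL, hsub]
    exact taylor _ _ hgx hfx

theorem exists_abs_lpMass_sub_le (p : ℕ) {M : ℝ} {f : L2 d} (hf : ∀ᵐ x, ‖f x‖ ≤ M) :
    ∃ A C : ℝ, ∀ g : L2 d, (∀ᵐ x, ‖g x‖ ≤ M) →
      |lpMass p g - lpMass p f| ≤ A * ‖g - f‖ + C * ‖g - f‖ ^ 2 := by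
  obtain ⟨C, -, taylor⟩ := exists_lpMass_taylor_bound (d := d) p M
  refine ⟨(p + 2) * ‖powerNL p f‖, C, fun g hg => ?_⟩
  have linear_le : |(p + 2) * (inner ℂ (powerNL p f) (g - f)).re| ≤
      (p + 2) * ‖powerNL p f‖ * ‖g - f‖ := by
    rw [abs_mul, abs_of_nonneg (by positivity : (0 : ℝ) ≤ p + 2), mul_assoc]
    gcongr
    exact (Complex.abs_re_le_norm _).trans (norm_inner_le_norm _ _)
  calc |lpMass p g - lpMass p f|
      = |(p + 2) * (inner ℂ (powerNL p f) (g - f)).re +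
          (lpMass p g - lpMass p f - (p + 2) * (inner ℂ (powerNL p f) (g - f)).re)| := by
        rw [add_sub_cancel]
    _ ≤ _ := (abs_add_le _ _).trans (add_le_add linear_le (taylor f g hf hg))

/-! ### Windows of propagation times -/

/-- The integrand `e^{-iσΔ} [|e^{iσΔ} f|ᵖ e^{iσΔ} f]` of the averaged nonlinearity. -/
def conjugatedNL (p : ℕ) (f : L2 d) (σ : ℝ) : L2 d := freeProp (-σ) (powerNL p (freeProp σ f))

/-- The averaged nonlinearity over the window `[α, β]` of propagation times. The equation uses the
window `[0, 1]`, and the other windows appear when the free flow is applied to a solution. -/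
def windowNL (p : ℕ) (α β : ℝ) (f : L2 d) : L2 d := ∫ σ in α..β, conjugatedNL p f σ

/-- The potential energy over the window `[α, β]` of propagation times. -/
def windowPotential (p : ℕ) (α β : ℝ) (f : L2 d) : ℝ := ∫ σ in α..β, lpMass p (freeProp σ f)

section Window

variable {I : Set ℝ} {M : ℝ} {f g : L2 d}

theorem FlowBoundedOn.continuousOn_powerNL (hf : FlowBoundedOn I M f) (p : ℕ) :
    ContinuousOn (fun σ => powerNL p (freeProp σ f)) I := by
  intro σ₀ hσ₀
  rw [ContinuousWithinAt, tendsto_iff_norm_sub_tendsto_zero]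
  have hbound : Continuous fun σ => (p + 1) * M ^ p * ‖freeProp σ f - freeProp σ₀ f‖ :=
    continuous_const.mul ((continuous_freeProp_left f).sub continuous_const).norm
  refine squeeze_zero' (Eventually.of_forall fun _ => norm_nonneg _) ?_
    ((hbound.tendsto' σ₀ 0 (by simp)).mono_left nhdsWithin_le_nhds)
  filter_upwards [self_mem_nhdsWithin] with σ hσ
  exact norm_powerNL_sub_le (hf σ hσ) (hf σ₀ hσ₀)

theorem FlowBoundedOn.continuousOn_conjugatedNL (hf : FlowBoundedOn I M f) (p : ℕ) :
    ContinuousOn (conjugatedNL p f) I := by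
  have hpair : ContinuousOn (fun σ => (-σ, powerNL p (freeProp σ f))) I :=
    continuousOn_neg.prodMk (hf.continuousOn_powerNL p)
  have := (continuous_freeProp (d := d)).comp_continuousOn hpair
  exact this

theorem FlowBoundedOn.continuousOn_lpMass (hf : FlowBoundedOn I M f) (p : ℕ) :
    ContinuousOn (fun σ => lpMass p (freeProp σ f)) I := by
  intro σ₀ hσ₀
  obtain ⟨A, C, hAC⟩ := exists_abs_lpMass_sub_le p (hf σ₀ hσ₀)
  rw [ContinuousWithinAt, tendsto_iff_norm_sub_tendsto_zero]
  have hnorm : Continuous fun σ => ‖freeProp σ f - freeProp σ₀ f‖ :=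
    ((continuous_freeProp_left f).sub continuous_const).norm
  have hbound : Continuous fun σ => A * ‖freeProp σ f - freeProp σ₀ f‖ +
      C * ‖freeProp σ f - freeProp σ₀ f‖ ^ 2 := by fun_prop
  refine squeeze_zero' (Eventually.of_forall fun _ => norm_nonneg _) ?_
    ((hbound.tendsto' σ₀ 0 (by simp)).mono_left nhdsWithin_le_nhds)
  filter_upwards [self_mem_nhdsWithin] with σ hσ
  exact hAC _ (hf σ hσ)

variable {α β : ℝ}

theorem FlowBoundedOn.intervalIntegrable_conjugatedNL (hαβ : α ≤ β)
    (hf : FlowBoundedOn (Icc α β) M f) (p : ℕ) :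
    IntervalIntegrable (conjugatedNL p f) volume α β :=
  (hf.continuousOn_conjugatedNL p).intervalIntegrable_of_Icc hαβ

theorem FlowBoundedOn.intervalIntegrable_lpMass (hαβ : α ≤ β)
    (hf : FlowBoundedOn (Icc α β) M f) (p : ℕ) :
    IntervalIntegrable (fun σ => lpMass p (freeProp σ f)) volume α β :=
  (hf.continuousOn_lpMass p).intervalIntegrable_of_Icc hαβ

theorem norm_windowNL_sub_le {p : ℕ} (hαβ : α ≤ β) (hf : FlowBoundedOn (Icc α β) M f)
    (hg : FlowBoundedOn (Icc α β) M g) :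
    ‖windowNL p α β f - windowNL p α β g‖ ≤ (β - α) * ((p + 1) * M ^ p) * ‖f - g‖ := by
  rw [windowNL, windowNL, ← intervalIntegral.integral_sub
    (hf.intervalIntegrable_conjugatedNL hαβ p) (hg.intervalIntegrable_conjugatedNL hαβ p)]
  refine (intervalIntegral.norm_integral_le_of_norm_le_const
    (C := (p + 1) * M ^ p * ‖f - g‖) fun σ hσ => ?_).trans_eq ?_
  · rw [uIoc_of_le hαβ] at hσ
    have hσ' := Ioc_subset_Icc_self hσ
    rw [conjugatedNL, conjugatedNL, ← freeProp_sub, norm_freeProp]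
    refine (norm_powerNL_sub_le (hf σ hσ') (hg σ hσ')).trans_eq ?_
    rw [← freeProp_sub, norm_freeProp]
  · rw [abs_of_nonneg (sub_nonneg.2 hαβ)]
    ring

theorem inner_windowNL {p : ℕ} (hαβ : α ≤ β) (hf : FlowBoundedOn (Icc α β) M f) (g : L2 d) :
    inner ℂ (windowNL p α β f) g =
      ∫ σ in α..β, inner ℂ (powerNL p (freeProp σ f)) (freeProp σ g) := by
  have inner_comm_integral := (innerSL ℂ g).intervalIntegral_comp_comm
    (hf.intervalIntegrable_conjugatedNL hαβ p)
  rw [← inner_conj_symm, ← innerSL_apply_apply ℂ g, windowNL, ← inner_comm_integral,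
    ← intervalIntegral.intervalIntegral_conj]
  refine intervalIntegral.integral_congr fun σ _ => ?_
  simp only [innerSL_apply_apply, inner_conj_symm]
  rw [conjugatedNL, inner_freeProp_neg_left]

theorem FlowBoundedOn.continuousOn_inner_powerNL (hf : FlowBoundedOn I M f) (p : ℕ) (g : L2 d) :
    ContinuousOn (fun σ => inner ℂ (powerNL p (freeProp σ f)) (freeProp σ g)) I :=
  (hf.continuousOn_powerNL p).inner (𝕜 := ℂ) (continuous_freeProp_left g).continuousOn

theorem re_inner_windowNL {p : ℕ} (hαβ : α ≤ β) (hf : FlowBoundedOn (Icc α β) M f) (g : L2 d) :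
    (inner ℂ (windowNL p α β f) g).re =
      ∫ σ in α..β, (inner ℂ (powerNL p (freeProp σ f)) (freeProp σ g)).re := by
  rw [inner_windowNL hαβ hf]
  exact (Complex.reCLM.intervalIntegral_comp_comm
    ((hf.continuousOn_inner_powerNL p g).intervalIntegrable_of_Icc hαβ)).symm

theorem exists_windowPotential_taylor_bound (p : ℕ) (M : ℝ) (hαβ : α ≤ β) :
    ∃ C : ℝ, 0 ≤ C ∧ ∀ f g : L2 d, FlowBoundedOn (Icc α β) M f → FlowBoundedOn (Icc α β) M g →
      |windowPotential p α β g - windowPotential p α β f -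
        (p + 2) * (inner ℂ (windowNL p α β f) (g - f)).re| ≤ C * ‖g - f‖ ^ 2 := by
  obtain ⟨C, hC, taylor⟩ := exists_lpMass_taylor_bound (d := d) p M
  refine ⟨C * (β - α), mul_nonneg hC (sub_nonneg.2 hαβ), fun f g hf hg => ?_⟩
  have hre : IntervalIntegrable (fun σ =>
      (inner ℂ (powerNL p (freeProp σ f)) (freeProp σ (g - f))).re) volume α β :=
    (Complex.continuous_re.comp_continuousOn
      (hf.continuousOn_inner_powerNL p (g - f))).intervalIntegrable_of_Icc hαβ
  have hf_mass := hf.intervalIntegrable_lpMass hαβ p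
  have hg_mass := hg.intervalIntegrable_lpMass hαβ p
  rw [re_inner_windowNL hαβ hf, windowPotential, windowPotential,
    ← intervalIntegral.integral_sub hg_mass hf_mass, ← intervalIntegral.integral_const_mul,
    ← intervalIntegral.integral_sub (hg_mass.sub hf_mass) (hre.const_mul _), ← Real.norm_eq_abs]
  refine (intervalIntegral.norm_integral_le_of_norm_le_const (C := C * ‖g - f‖ ^ 2)
    fun σ hσ => ?_).trans_eq ?_
  · rw [uIoc_of_le hαβ] at hσ
    have hσ' := Ioc_subset_Icc_self hσ
    have := taylor _ _ (hf σ hσ') (hg σ hσ')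
    rwa [← freeProp_sub, norm_freeProp] at this
  · rw [abs_of_nonneg (sub_nonneg.2 hαβ)]
    ring

end Window

/-! ### The chirp factorization of the free propagator -/

section Gaussian

variable {V : Type*} [NormedAddCommGroup V] [InnerProductSpace ℝ V]

theorem re_neg_mul_sq_add_inner (b : ℂ) (x ξ : V) :
    (-b * ‖ξ‖ ^ 2 + 2 * Real.pi * Complex.I * (inner ℝ x ξ : ℝ) : ℂ).re = -(b.re * ‖ξ‖ ^ 2) := by
  rw [show (-b * ‖ξ‖ ^ 2 + 2 * Real.pi * Complex.I * (inner ℝ x ξ : ℝ) : ℂ) =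
    ((-‖ξ‖ ^ 2 : ℝ) : ℂ) * b + ((2 * Real.pi * inner ℝ x ξ : ℝ) : ℂ) * Complex.I by
      push_cast; ring, Complex.add_re, Complex.re_ofReal_mul, Complex.re_ofReal_mul, Complex.I_re]
  ring

variable [FiniteDimensional ℝ V] [MeasurableSpace V] [BorelSpace V]

theorem continuousOn_integral_mul_gaussian {g : V → ℂ} (hg : Integrable g) (x : V) :
    ContinuousOn (fun b : ℂ => ∫ ξ, g ξ *
      Complex.exp (-b * ‖ξ‖ ^ 2 + 2 * Real.pi * Complex.I * (inner ℝ x ξ : ℝ))) {b | 0 ≤ b.re} := by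
  refine continuousOn_of_dominated (bound := fun ξ => ‖g ξ‖) (fun b _ =>
    hg.1.mul (Continuous.aestronglyMeasurable (by fun_prop)))
    (fun b hb => Eventually.of_forall fun ξ => ?_) hg.norm
    (Eventually.of_forall fun ξ => (Continuous.continuousOn (by fun_prop)))
  rw [norm_mul, Complex.norm_exp, re_neg_mul_sq_add_inner]
  refine mul_le_of_le_one_right (norm_nonneg _) (Real.exp_le_one_iff.2 (neg_nonpos.2 ?_))
  exact mul_nonneg hb (sq_nonneg _)

theorem norm_cexp_neg_div_le_one {b : ℂ} (hb : 0 ≤ b.re) {r : ℝ} (hr : 0 ≤ r) :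
    ‖Complex.exp (-(r : ℂ) / b)‖ ≤ 1 := by
  rw [Complex.norm_exp, Real.exp_le_one_iff, neg_div, Complex.neg_re, neg_nonpos, div_eq_mul_inv,
    Complex.re_ofReal_mul, Complex.inv_re]
  exact mul_nonneg hr (div_nonneg hb (Complex.normSq_nonneg _))

theorem continuousOn_integral_mul_gaussian_inv {f : V → ℂ} (hf : Integrable f) (x : V) :
    ContinuousOn (fun b : ℂ => ∫ y, f y *
      Complex.exp (-((Real.pi ^ 2 * ‖x - y‖ ^ 2 : ℝ) : ℂ) / b)) {b | 0 ≤ b.re ∧ b ≠ 0} := by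
  refine continuousOn_of_dominated (bound := fun y => ‖f y‖) (fun b _ =>
    hf.1.mul (Continuous.aestronglyMeasurable (by fun_prop)))
    (fun b hb => Eventually.of_forall fun y => ?_) hf.norm
    (Eventually.of_forall fun y => continuousOn_const.mul
      (Complex.continuous_exp.comp_continuousOn (continuousOn_const.div continuousOn_id
        fun b hb => hb.2)))
  rw [norm_mul]
  exact mul_le_of_le_one_right (norm_nonneg _) (norm_cexp_neg_div_le_one hb.1 (by positivity))

theorem pi_div_mem_slitPlane {b : ℂ} (hb : 0 ≤ b.re) (hb' : b ≠ 0) :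
    (Real.pi : ℂ) / b ∈ Complex.slitPlane := by
  have normSq_pos : 0 < Complex.normSq b := Complex.normSq_pos.2 hb'
  rw [Complex.mem_slitPlane_iff, div_eq_mul_inv, Complex.re_ofReal_mul, Complex.im_ofReal_mul,
    Complex.inv_re, Complex.inv_im]
  rcases hb.lt_or_eq with hre | hre
  · exact Or.inl (mul_pos Real.pi_pos (div_pos hre normSq_pos))
  · refine Or.inr (mul_ne_zero Real.pi_ne_zero (div_ne_zero (neg_ne_zero.2 fun him => hb' ?_)
      normSq_pos.ne'))
    exact Complex.ext hre.symm him

theorem integral_fourier_mul_gaussian_of_re_pos {b : ℂ} (hb : 0 < b.re) {f : V → ℂ}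
    (hf : Integrable f) (x : V) :
    ∫ ξ, 𝓕 f ξ * Complex.exp (-b * ‖ξ‖ ^ 2 + 2 * Real.pi * Complex.I * (inner ℝ x ξ : ℝ)) =
      (Real.pi / b) ^ (Module.finrank ℝ V / 2 : ℂ) *
        ∫ y, f y * Complex.exp (-((Real.pi ^ 2 * ‖x - y‖ ^ 2 : ℝ) : ℂ) / b) := by
  have fourier_swap := VectorFourier.integral_fourierIntegral_smul_eq_flip (L := innerₗ V)
    (μ := volume) (ν := volume) Real.continuous_fourierChar
    (by simpa using continuous_inner (𝕜 := ℝ) (E := V)) hf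
    (GaussianFourier.integrable_cexp_neg_mul_sq_norm_add hb (2 * Real.pi * Complex.I) x)
  rw [flip_innerₗ] at fourier_swap
  refine Eq.trans fourier_swap ?_
  rw [← integral_const_mul]
  congr 1 with y
  refine (congrArg (fun z => f y • z) (fourier_gaussian_innerProductSpace' hb x y)).trans ?_
  rw [smul_eq_mul, mul_left_comm]
  congr 4
  push_cast
  ring

/-- Analytic continuation of the Gaussian identity to the imaginary axis, by density. -/
theorem integral_fourier_mul_gaussian {b : ℂ} (hb : 0 ≤ b.re) (hb' : b ≠ 0) {f : V → ℂ}
    (hf : Integrable f) (hf' : Integrable (𝓕 f)) (x : V) :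
    ∫ ξ, 𝓕 f ξ * Complex.exp (-b * ‖ξ‖ ^ 2 + 2 * Real.pi * Complex.I * (inner ℝ x ξ : ℝ)) =
      (Real.pi / b) ^ (Module.finrank ℝ V / 2 : ℂ) *
        ∫ y, f y * Complex.exp (-((Real.pi ^ 2 * ‖x - y‖ ^ 2 : ℝ) : ℂ) / b) := by
  have continuousOn_cpow : ContinuousOn
      (fun b : ℂ => (Real.pi / b : ℂ) ^ (Module.finrank ℝ V / 2 : ℂ)) {b | 0 ≤ b.re ∧ b ≠ 0} :=
    (continuousOn_const.div continuousOn_id fun b hb => hb.2).cpow continuousOn_const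
      fun b hb => pi_div_mem_slitPlane hb.1 hb.2
  refine EqOn.of_subset_closure (s := {b : ℂ | 0 < b.re}) (t := {b : ℂ | 0 ≤ b.re ∧ b ≠ 0})
    (fun b hb => integral_fourier_mul_gaussian_of_re_pos hb hf x)
    ((continuousOn_integral_mul_gaussian hf' x).mono fun b hb => hb.1)
    (continuousOn_cpow.mul (continuousOn_integral_mul_gaussian_inv hf x)) (fun b hb => ?_)
    (fun b hb => ?_) ⟨hb, hb'⟩
  · exact ⟨le_of_lt hb, fun h => by simp [h] at hb⟩
  · rw [Complex.closure_setOfPred_lt_re]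
    exact hb.1

end Gaussian

theorem ae_comp_smul {V : Type*} [NormedAddCommGroup V] [NormedSpace ℝ V]
    [FiniteDimensional ℝ V] [MeasurableSpace V] [BorelSpace V] {μ : Measure V}
    [μ.IsAddHaarMeasure] {P : V → Prop} {c : ℝ} (hc : c ≠ 0) (hP : ∀ᵐ x ∂μ, P x) :
    ∀ᵐ x ∂μ, P (c • x) := by
  rw [ae_iff] at hP ⊢
  refine (Measure.addHaar_preimage_smul μ hc {x | ¬ P x}).trans ?_
  rw [hP, mul_zero]

/-- The phase `x ↦ b |x|²`. -/
def chirp (b : ℝ) : C(Space d, ℝ) where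
  toFun x := b * ‖x‖ ^ 2

theorem chirp_add (a b : ℝ) : (chirp a + chirp b : C(Space d, ℝ)) = chirp (a + b) := by
  ext x
  simp only [chirp, ContinuousMap.add_apply, ContinuousMap.coe_mk, add_mul]

/-- The modulus `(4π|σ|)^{-d/2}` of the kernel of the free propagator. -/
def kernelModulus (d : ℕ) (σ : ℝ) : ℝ := (4 * Real.pi * |σ|)⁻¹ ^ ((d : ℝ) / 2)

theorem norm_cpow_pi_div_eq_kernelModulus {σ : ℝ} (hσ : σ ≠ 0) :
    ‖(Real.pi / (4 * Real.pi ^ 2 * σ * Complex.I) : ℂ) ^ (d / 2 : ℂ)‖ = kernelModulus d σ := by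
  have hpi := Real.pi_ne_zero
  have habs : |σ| ≠ 0 := abs_ne_zero.2 hσ
  rw [show (d / 2 : ℂ) = ((d / 2 : ℝ) : ℂ) by push_cast; rfl, Complex.norm_cpow_real,
    kernelModulus]
  congr 1
  simp only [norm_div, norm_mul, Complex.norm_real, Complex.norm_I, norm_pow, Real.norm_eq_abs,
    abs_of_pos Real.pi_pos, Complex.norm_ofNat]
  field_simp

theorem fourierInv_schrodingerPhase_mul (σ : ℝ) (g : Space d → ℂ) (x : Space d) :
    𝓕⁻ (fun ξ => Complex.exp (schrodingerPhase σ ξ * Complex.I) * g ξ) x =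
      ∫ ξ, g ξ * Complex.exp (-(4 * Real.pi ^ 2 * σ * Complex.I) * ‖ξ‖ ^ 2 +
        2 * Real.pi * Complex.I * (inner ℝ x ξ : ℝ)) := by
  rw [Real.fourierInv_eq']
  congr 1 with ξ
  rw [smul_eq_mul, ← mul_assoc, ← Complex.exp_add, mul_comm]
  congr 2
  simp only [schrodingerPhase, ContinuousMap.coe_mk, real_inner_comm x ξ]
  push_cast
  ring

theorem integral_mul_exp_norm_sub_sq {σ : ℝ} (hσ : σ ≠ 0) (f : Space d → ℂ) (x : Space d) :
    ∫ y, f y * Complex.exp (-((Real.pi ^ 2 * ‖x - y‖ ^ 2 : ℝ) : ℂ) /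
        (4 * Real.pi ^ 2 * σ * Complex.I)) =
      Complex.exp (((4 * σ)⁻¹ * ‖x‖ ^ 2 : ℝ) * Complex.I) *
        𝓕 (fun y => Complex.exp (chirp (4 * σ)⁻¹ y * Complex.I) * f y)
          ((4 * Real.pi * σ)⁻¹ • x) := by
  have hpi : (Real.pi : ℂ) ≠ 0 := by exact_mod_cast Real.pi_ne_zero
  have hσ' : (σ : ℂ) ≠ 0 := by exact_mod_cast hσ
  rw [Real.fourier_eq', ← integral_const_mul]
  congr 1 with y
  rw [smul_eq_mul, ← mul_assoc, ← mul_assoc, ← Complex.exp_add, ← Complex.exp_add, mul_comm]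
  congr 2
  simp only [chirp, ContinuousMap.coe_mk, inner_smul_right, norm_sub_sq_real, real_inner_comm y x]
  push_cast
  have hI : Complex.I ^ 2 = -1 := Complex.I_sq
  field_simp
  rw [hI]
  ring

theorem norm_fourierInv_schrodingerPhase_mul_fourier {σ : ℝ} (hσ : σ ≠ 0) {f : Space d → ℂ}
    (hf : Integrable f) (hf' : Integrable (𝓕 f)) (x : Space d) :
    ‖𝓕⁻ (fun ξ => Complex.exp (schrodingerPhase σ ξ * Complex.I) * 𝓕 f ξ) x‖ =
      kernelModulus d σ * ‖𝓕 (fun y => Complex.exp (chirp (4 * σ)⁻¹ y * Complex.I) * f y)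
        ((4 * Real.pi * σ)⁻¹ • x)‖ := by
  have hb_re : 0 ≤ (4 * Real.pi ^ 2 * σ * Complex.I : ℂ).re := by
    rw [show (4 * Real.pi ^ 2 * σ * Complex.I : ℂ) = ((4 * Real.pi ^ 2 * σ : ℝ) : ℂ) * Complex.I by
      push_cast; rfl, Complex.re_ofReal_mul, Complex.I_re, mul_zero]
  have hb_ne : (4 * Real.pi ^ 2 * σ * Complex.I : ℂ) ≠ 0 := by simp [hσ]
  rw [fourierInv_schrodingerPhase_mul, integral_fourier_mul_gaussian hb_re hb_ne hf hf',
    integral_mul_exp_norm_sub_sq hσ, norm_mul, norm_mul, Complex.norm_exp_ofReal_mul_I, one_mul,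
    finrank_euclideanSpace_fin, norm_cpow_pi_div_eq_kernelModulus hσ]

theorem ae_norm_freeProp_toLp_schwartzMap {σ : ℝ} (hσ : σ ≠ 0) (φ : 𝓢(Space d, ℂ)) :
    ∀ᵐ x, ‖freeProp σ (φ.toLp 2 : L2 d) x‖ = kernelModulus d σ *
      ‖(𝓕 (phaseMul (chirp (4 * σ)⁻¹) (φ.toLp 2 : L2 d)) : L2 d) ((4 * Real.pi * σ)⁻¹ • x)‖ := by
  have scale_ne_zero : (4 * Real.pi * σ)⁻¹ ≠ 0 := by simp [hσ, Real.pi_ne_zero]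
  rw [freeProp_eq_fourierInv, SchwartzMap.toLp_fourier_eq]
  filter_upwards [coeFn_fourierInv_phaseMul_toLp (schrodingerPhase σ) (𝓕 φ).integrable
      ((𝓕 φ).memLp 2), ae_comp_smul scale_ne_zero (coeFn_fourier_phaseMul_toLp (chirp (4 * σ)⁻¹)
      φ.integrable (φ.memLp 2))] with x hleft hright
  refine (congrArg norm hleft).trans (.trans ?_
    (congrArg (kernelModulus d σ * ‖·‖) hright).symm)
  exact norm_fourierInv_schrodingerPhase_mul_fourier hσ φ.integrable (𝓕 φ).integrable x

theorem exists_seq_schwartzMap_tendsto (f : L2 d) :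
    ∃ φ : ℕ → 𝓢(Space d, ℂ), Tendsto (fun n => ((φ n).toLp 2 : L2 d)) atTop (𝓝 f) := by
  have dense := SchwartzMap.denseRange_toLpCLM (F := ℂ) (E := Space d) (p := 2) (μ := volume)
    ENNReal.ofNat_ne_top
  obtain ⟨g, hg, hlim⟩ := mem_closure_iff_seq_limit.1 (dense f)
  choose φ hφ using hg
  refine ⟨φ, ?_⟩
  convert hlim using 2 with n
  exact hφ n

/-- `e^{iσΔ}` is a chirp followed by the Fourier transform, a dilation and another chirp, the last
of which does not affect the modulus. -/
theorem ae_norm_freeProp_eq {σ : ℝ} (hσ : σ ≠ 0) (f : L2 d) :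
    ∀ᵐ x, ‖freeProp σ f x‖ = kernelModulus d σ *
      ‖(𝓕 (phaseMul (chirp (4 * σ)⁻¹) f) : L2 d) ((4 * Real.pi * σ)⁻¹ • x)‖ := by
  have scale_ne_zero : (4 * Real.pi * σ)⁻¹ ≠ 0 := by simp [hσ, Real.pi_ne_zero]
  obtain ⟨φ, hφ⟩ := exists_seq_schwartzMap_tendsto f
  have tendsto_flow : Tendsto (fun n => freeProp σ ((φ n).toLp 2 : L2 d)) atTop
      (𝓝 (freeProp σ f)) := by
    simp_rw [← freePropIsometry_apply]
    exact ((freePropIsometry σ).continuous.tendsto f).comp hφ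
  have tendsto_fourier : Tendsto
      (fun n => (𝓕 (phaseMul (chirp (4 * σ)⁻¹) ((φ n).toLp 2 : L2 d)) : L2 d)) atTop
      (𝓝 (𝓕 (phaseMul (chirp (4 * σ)⁻¹) f) : L2 d)) :=
    (((Lp.fourierTransformₗᵢ (Space d) ℂ).continuous.comp
      (phaseMul (chirp (4 * σ)⁻¹)).continuous).tendsto f).comp hφ
  obtain ⟨m, hm, flow_ae⟩ := (tendstoInMeasure_of_tendsto_Lp tendsto_flow).exists_seq_tendsto_ae
  obtain ⟨n, hn, fourier_ae⟩ := (tendstoInMeasure_of_tendsto_Lp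
    (tendsto_fourier.comp hm.tendsto_atTop)).exists_seq_tendsto_ae
  filter_upwards [flow_ae, ae_comp_smul scale_ne_zero fourier_ae,
    ae_all_iff.2 fun j => ae_norm_freeProp_toLp_schwartzMap hσ (φ (m (n j)))]
    with x hflow hfourier heq
  refine tendsto_nhds_unique (hflow.comp hn.tendsto_atTop).norm ?_
  exact (hfourier.norm.const_mul (kernelModulus d σ)).congr fun j => (heq j).symm

theorem kernelModulus_eq_mul_kernelModulus_div {l σ : ℝ} (hl : 0 < l) (hσ : σ ≠ 0) :
    kernelModulus d σ = l⁻¹ ^ ((d : ℝ) / 2) * kernelModulus d (σ / l) := by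
  have hpi := Real.pi_ne_zero
  have habs : |σ| ≠ 0 := abs_ne_zero.2 hσ
  rw [kernelModulus, kernelModulus, ← Real.mul_rpow (by positivity) (by positivity), abs_div,
    abs_of_pos hl]
  congr 1
  field_simp

/-- The lens transformation. -/
theorem ae_norm_freeProp_chirp {b σ : ℝ} (hb : 0 < 1 + 4 * b * σ) (f : L2 d) :
    ∀ᵐ x, ‖freeProp σ (phaseMul (chirp b) f) x‖ = (1 + 4 * b * σ)⁻¹ ^ ((d : ℝ) / 2) *
      ‖freeProp (σ / (1 + 4 * b * σ)) f ((1 + 4 * b * σ)⁻¹ • x)‖ := by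
  rcases eq_or_ne σ 0 with rfl | hσ
  · filter_upwards [coeFn_phaseMul (chirp b) f] with x hx
    simp only [mul_zero, add_zero, inv_one, Real.one_rpow, one_mul, one_smul, div_one,
      freeProp_zero, hx, norm_mul, Complex.norm_exp_ofReal_mul_I]
  set l := 1 + 4 * b * σ with hl
  have hpi := Real.pi_ne_zero
  have chirp_mul : phaseMul (chirp (4 * σ)⁻¹) (phaseMul (chirp b) f) =
      phaseMul (chirp (4 * (σ / l))⁻¹) f := by
    rw [phaseMul_phaseMul, chirp_add]
    congr 2
    rw [hl]
    field_simp
  have dilation_mul (x : Space d) :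
      (4 * Real.pi * (σ / l))⁻¹ • l⁻¹ • x = (4 * Real.pi * σ)⁻¹ • x := by
    rw [smul_smul]
    congr 1
    field_simp
  filter_upwards [ae_norm_freeProp_eq hσ (phaseMul (chirp b) f), ae_comp_smul (inv_ne_zero hb.ne')
    (ae_norm_freeProp_eq (div_ne_zero hσ hb.ne') f)] with x hchirp hf
  rw [hchirp, hf, chirp_mul, dilation_mul, kernelModulus_eq_mul_kernelModulus_div hb hσ, mul_assoc]

theorem FlowBoundedOn.chirp {M : ℝ} {f : L2 d} (hf : FlowBoundedOn univ M f) {I : Set ℝ} {b : ℝ}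
    (hb : ∀ σ ∈ I, 1 / 2 ≤ 1 + 4 * b * σ) :
    FlowBoundedOn I (2 ^ ((d : ℝ) / 2) * M) (phaseMul (chirp b) f) := fun σ hσ => by
  have hl : 0 < 1 + 4 * b * σ := by linarith [hb σ hσ]
  filter_upwards [ae_norm_freeProp_chirp hl f,
    ae_comp_smul (inv_ne_zero hl.ne') (hf (σ / (1 + 4 * b * σ)) (mem_univ _))] with x hlens hx
  rw [hlens]
  gcongr
  rw [inv_le_comm₀ hl (by norm_num)]
  linarith [hb σ hσ]

/-! ### The potential energy under the lens transformation -/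

theorem lpMass_freeProp_chirp (p : ℕ) {b σ : ℝ} (hb : 0 < 1 + 4 * b * σ) (f : L2 d) :
    lpMass p (freeProp σ (phaseMul (chirp b) f)) =
      (1 + 4 * b * σ)⁻¹ ^ ((d : ℝ) * p / 2) * lpMass p (freeProp (σ / (1 + 4 * b * σ)) f) := by
  set l := 1 + 4 * b * σ
  have exponent : (l⁻¹ ^ ((d : ℝ) / 2)) ^ (p + 2) = l⁻¹ ^ ((d : ℝ) * p / 2) * l⁻¹ ^ d := by
    rw [← Real.rpow_natCast, ← Real.rpow_mul (by positivity), ← Real.rpow_natCast,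
      ← Real.rpow_add (by positivity)]
    congr 1
    push_cast
    ring
  have integral_lens : ∫ x, ‖freeProp σ (phaseMul (chirp b) f) x‖ ^ (p + 2) =
      ∫ x, l⁻¹ ^ ((d : ℝ) * p / 2) * l⁻¹ ^ d *
        (fun y => ‖freeProp (σ / l) f y‖ ^ (p + 2)) (l⁻¹ • x) := by
    refine integral_congr_ae ?_
    filter_upwards [ae_norm_freeProp_chirp hb f] with x hx
    rw [hx, mul_pow, exponent]
  rw [lpMass, lpMass, integral_lens, integral_const_mul, Measure.integral_comp_inv_smul volume
    (fun y => ‖freeProp (σ / l) f y‖ ^ (p + 2)) l, finrank_euclideanSpace_fin,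
    abs_of_pos (by positivity), smul_eq_mul, ← mul_assoc, mul_assoc _ (l⁻¹ ^ d), inv_pow,
    inv_mul_cancel₀ (by positivity), mul_one]

section Leibniz

variable {F A B : ℝ → ℝ}

theorem hasDerivAt_integral_of_hasDerivAt_endpoints (hF : Continuous F) {A' B' t : ℝ}
    (hA : HasDerivAt A A' t) (hB : HasDerivAt B B' t) :
    HasDerivAt (fun b => ∫ s in A b..B b, F s) (B' * F (B t) - A' * F (A t)) t := by
  have fderiv_integral := intervalIntegral.integral_hasFDerivAt
    (hF.intervalIntegrable (μ := volume) (A t) (B t)) (hF.stronglyMeasurableAtFilter _ _)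
    (hF.stronglyMeasurableAtFilter _ _) hF.continuousAt hF.continuousAt
  refine (fderiv_integral.comp_hasDerivAt t (hA.prodMk hB)).congr_deriv ?_
  simp

theorem exists_eventually_uIcc_subset_Icc {t : ℝ} (hA : ContinuousAt A t)
    (hB : ContinuousAt B t) : ∃ L : ℝ, 0 < L ∧ ∀ᶠ b in 𝓝 t, uIcc (A b) (B b) ⊆ Icc (-L) L := by
  refine ⟨|A t| + |B t| + 1, by positivity, ?_⟩
  have hA_lt : |A t| < |A t| + |B t| + 1 := by linarith [abs_nonneg (B t)]
  have hB_lt : |B t| < |A t| + |B t| + 1 := by linarith [abs_nonneg (A t)]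
  filter_upwards [hA.abs.eventually_lt_const hA_lt, hB.abs.eventually_lt_const hB_lt] with b hAb hBb
  exact uIcc_subset_Icc (abs_le.1 hAb.le) (abs_le.1 hBb.le)

theorem eventually_forall_mem_uIcc_mul (hA : ContinuousAt A 0) (hB : ContinuousAt B 0)
    {P : ℝ → Prop} (hP : ∀ᶠ t in 𝓝 0, P t) :
    ∀ᶠ b in 𝓝 0, ∀ s ∈ uIcc (A b) (B b), P (b * s) := by
  obtain ⟨L, hL, subset_Icc⟩ := exists_eventually_uIcc_subset_Icc hA hB
  obtain ⟨δ, hδ, hball⟩ := Metric.eventually_nhds_iff.1 hP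
  filter_upwards [subset_Icc, Metric.ball_mem_nhds (0 : ℝ) (div_pos hδ hL)] with b hAB hb s hs
  rw [mem_ball_zero_iff, lt_div_iff₀ hL] at hb
  refine hball ?_
  rw [dist_zero_right, norm_mul]
  exact (mul_le_mul_of_nonneg_left (abs_le.2 (hAB hs)) (norm_nonneg b)).trans_lt hb

theorem isLittleO_integral_comp_mul {r : ℝ → ℝ} (hr : r =o[𝓝 0] (id : ℝ → ℝ))
    (hF : Continuous F) (hA : ContinuousAt A 0) (hB : ContinuousAt B 0) :
    (fun b => ∫ s in A b..B b, r (b * s) * F s) =o[𝓝 0] (id : ℝ → ℝ) := by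
  obtain ⟨L, hL, subset_Icc⟩ := exists_eventually_uIcc_subset_Icc hA hB
  obtain ⟨K, hK⟩ := (isCompact_Icc (a := -L) (b := L)).exists_bound_of_continuousOn hF.continuousOn
  have hK_nonneg : 0 ≤ K := (norm_nonneg _).trans (hK 0 ⟨by linarith, hL.le⟩)
  refine Asymptotics.IsLittleO.of_bound fun ε hε => ?_
  have r_le := eventually_forall_mem_uIcc_mul hA hB
    (hr.bound (div_pos hε (by positivity : 0 < 2 * L ^ 2 * (K + 1))))
  filter_upwards [subset_Icc, r_le] with b hAB hrb
  have abs_le_of_mem {s : ℝ} (hs : s ∈ uIcc (A b) (B b)) : |s| ≤ L := abs_le.2 (hAB hs)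
  have length_le : |B b - A b| ≤ 2 * L := (abs_sub _ _).trans
    (by linarith [abs_le_of_mem left_mem_uIcc, abs_le_of_mem right_mem_uIcc])
  refine (intervalIntegral.norm_integral_le_of_norm_le_const
    (C := ε / (2 * L ^ 2 * (K + 1)) * (‖b‖ * L) * (K + 1)) fun s hs => ?_).trans ?_
  · have hs' := uIoc_subset_uIcc hs
    rw [norm_mul]
    gcongr
    · refine (hrb s hs').trans ?_
      rw [id, norm_mul]
      gcongr
      exact abs_le_of_mem hs'
    · linarith [hK s (hAB hs')]
  · calc _ ≤ ε / (2 * L ^ 2 * (K + 1)) * (‖b‖ * L) * (K + 1) * (2 * L) := by gcongr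
      _ = ε * ‖id b‖ := by
        simp only [id]
        field_simp

/-- The change of variables has put the parameter into the smooth profile `g` and the endpoints, so
that `F`, which is merely continuous, is not differentiated. -/
theorem hasDerivAt_integral_comp_mul {g : ℝ → ℝ} {g' A' B' : ℝ} (hg : HasDerivAt g g' 0)
    (hg_cont : ∀ᶠ t in 𝓝 0, ContinuousAt g t) (hF : Continuous F) (hA : HasDerivAt A A' 0)
    (hB : HasDerivAt B B' 0) :
    HasDerivAt (fun b => ∫ s in A b..B b, g (b * s) * F s)
      (g 0 * (B' * F (B 0) - A' * F (A 0)) + g' * ∫ s in A 0..B 0, s * F s) 0 := by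
  set r : ℝ → ℝ := fun t => g t - g 0 - g' * t
  have hr : r =o[𝓝 0] (id : ℝ → ℝ) := by
    simpa [r, mul_comm] using! hg.isLittleO
  have hsF : Continuous fun s => s * F s := continuous_id.mul hF
  have deriv_remainder : HasDerivAt (fun b => ∫ s in A b..B b, r (b * s) * F s) 0 0 := by
    refine hasDerivAt_iff_isLittleO.2 ?_
    simpa [r] using! isLittleO_integral_comp_mul hr hF hA.continuousAt hB.continuousAt
  have expansion : (fun b => ∫ s in A b..B b, g (b * s) * F s) =ᶠ[𝓝 0] fun b =>
      g 0 * (∫ s in A b..B b, F s) + g' * b * (∫ s in A b..B b, s * F s) +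
        ∫ s in A b..B b, r (b * s) * F s := by
    filter_upwards [eventually_forall_mem_uIcc_mul hA.continuousAt hB.continuousAt hg_cont]
      with b hb
    have hgb : ContinuousOn (fun s => g (b * s)) (uIcc (A b) (B b)) := fun s hs =>
      ((hb s hs).comp (f := fun s => b * s) (by fun_prop)).continuousWithinAt
    have hr_cont : ContinuousOn (fun s => r (b * s) * F s) (uIcc (A b) (B b)) :=
      ((hgb.sub continuousOn_const).sub (by fun_prop)).mul hF.continuousOn
    rw [← intervalIntegral.integral_const_mul, ← intervalIntegral.integral_const_mul,
      ← intervalIntegral.integral_add ((hF.intervalIntegrable _ _).const_mul _)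
        ((hsF.intervalIntegrable _ _).const_mul _),
      ← intervalIntegral.integral_add (((hF.intervalIntegrable _ _).const_mul _).add
        ((hsF.intervalIntegrable _ _).const_mul _)) hr_cont.intervalIntegrable]
    refine intervalIntegral.integral_congr fun s _ => ?_
    simp only [r]
    ring
  refine HasDerivAt.congr_of_eventuallyEq ?_ expansion
  refine ((((hasDerivAt_integral_of_hasDerivAt_endpoints hF hA hB).const_mul (g 0)).add
    (((hasDerivAt_id (0 : ℝ)).const_mul g').mul
      (hasDerivAt_integral_of_hasDerivAt_endpoints hsF hA hB))).add deriv_remainder).congr_deriv ?_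
  simp only [id, mul_zero, zero_mul, mul_one, add_zero]

end Leibniz

theorem hasDerivAt_lens_endpoint (y : ℝ) :
    HasDerivAt (fun b : ℝ => y / (1 + 4 * b * y)) (-4 * y ^ 2) 0 := by
  have denominator : HasDerivAt (fun b : ℝ => 1 + 4 * b * y) (4 * y) 0 := by
    simpa using! (((hasDerivAt_id (0 : ℝ)).const_mul 4).mul_const y).const_add 1
  refine ((hasDerivAt_const (0 : ℝ) y).div denominator (by simp)).congr_deriv ?_
  ring

theorem hasDerivAt_lens_time {b σ : ℝ} (h : 1 + 4 * b * σ ≠ 0) :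
    HasDerivAt (fun σ => σ / (1 + 4 * b * σ)) ((1 + 4 * b * σ) ^ 2)⁻¹ σ := by
  have denominator : HasDerivAt (fun σ : ℝ => 1 + 4 * b * σ) (4 * b) σ := by
    simpa using! ((hasDerivAt_id σ).const_mul (4 * b)).const_add 1
  refine ((hasDerivAt_id σ).div denominator h).congr_deriv ?_
  simp only [id]
  field_simp
  ring

theorem one_sub_mul_lens_time {b σ : ℝ} (h : 1 + 4 * b * σ ≠ 0) :
    1 - 4 * b * (σ / (1 + 4 * b * σ)) = (1 + 4 * b * σ)⁻¹ := by
  field_simp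
  ring

theorem eventually_forall_mem_uIcc_half_le_lens (α β : ℝ) :
    ∀ᶠ b in 𝓝 (0 : ℝ), ∀ σ ∈ uIcc α β, 1 / 2 ≤ 1 + 4 * b * σ := by
  have near_zero : ∀ᶠ t in 𝓝 (0 : ℝ), 1 / 2 ≤ 1 + 4 * t :=
    (Continuous.tendsto' (by fun_prop) 0 1 (by norm_num)).eventually_const_le (by norm_num)
  simpa only [mul_assoc] using
    eventually_forall_mem_uIcc_mul (A := fun _ => α) (B := fun _ => β) continuousAt_const
      continuousAt_const near_zero

theorem windowPotential_chirp (p : ℕ) {M : ℝ} {f : L2 d} (hf : FlowBoundedOn univ M f)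
    {α β b : ℝ} (hb : ∀ σ ∈ uIcc α β, 0 < 1 + 4 * b * σ) :
    windowPotential p α β (phaseMul (chirp b) f) =
      ∫ s in (α / (1 + 4 * b * α))..(β / (1 + 4 * b * β)),
        (1 - 4 * b * s) ^ ((d : ℝ) * p / 2 - 2) * lpMass p (freeProp s f) := by
  have hF : Continuous fun s => lpMass p (freeProp s f) :=
    continuousOn_univ.1 (hf.continuousOn_lpMass p)
  have integrand_cont : ContinuousOn
      (fun s => (1 - 4 * b * s) ^ ((d : ℝ) * p / 2 - 2) * lpMass p (freeProp s f))
      ((fun σ => σ / (1 + 4 * b * σ)) '' uIcc α β) := by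
    refine (ContinuousOn.rpow_const (by fun_prop) ?_).mul hF.continuousOn
    rintro _ ⟨σ, hσ, rfl⟩
    exact Or.inl (by simpa only [one_sub_mul_lens_time (hb σ hσ).ne']
      using inv_ne_zero (hb σ hσ).ne')
  rw [windowPotential, ← intervalIntegral.integral_comp_mul_deriv'
    (fun σ hσ => hasDerivAt_lens_time (hb σ hσ).ne')
    (ContinuousOn.inv₀ (by fun_prop) fun σ hσ => (pow_pos (hb σ hσ) 2).ne') integrand_cont]
  refine intervalIntegral.integral_congr fun σ hσ => ?_
  have hl := hb σ hσ
  simp only [Function.comp]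
  rw [lpMass_freeProp_chirp p hl, one_sub_mul_lens_time hl.ne', Real.rpow_sub (inv_pos.2 hl),
    Real.rpow_two]
  field_simp

theorem hasDerivAt_windowPotential_chirp (p : ℕ) {M : ℝ} {f : L2 d} (hf : FlowBoundedOn univ M f)
    (α β : ℝ) :
    HasDerivAt (fun b => windowPotential p α β (phaseMul (chirp b) f))
      (4 * α ^ 2 * lpMass p (freeProp α f) - 4 * β ^ 2 * lpMass p (freeProp β f) -
        (2 * d * p - 8) * ∫ s in α..β, s * lpMass p (freeProp s f)) 0 := by
  have hF : Continuous fun s => lpMass p (freeProp s f) :=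
    continuousOn_univ.1 (hf.continuousOn_lpMass p)
  have profile_base : HasDerivAt (fun t : ℝ => 1 - 4 * t) (-4) 0 := by
    simpa using! ((hasDerivAt_id (0 : ℝ)).const_mul 4).const_sub 1
  have profile : HasDerivAt (fun t : ℝ => (1 - 4 * t) ^ ((d : ℝ) * p / 2 - 2))
      (8 - 2 * d * p) 0 := by
    refine (profile_base.rpow_const (Or.inl (by norm_num))).congr_deriv ?_
    simp only [mul_zero, sub_zero, Real.one_rpow]
    ring
  have profile_cont :
      ∀ᶠ t in 𝓝 (0 : ℝ), ContinuousAt (fun t : ℝ => (1 - 4 * t) ^ ((d : ℝ) * p / 2 - 2)) t := by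
    filter_upwards [profile_base.continuousAt.eventually_ne (by norm_num : (1 - 4 * 0 : ℝ) ≠ 0)]
      with t ht
    exact ContinuousAt.rpow_const (by fun_prop) (Or.inl ht)
  refine HasDerivAt.congr_of_eventuallyEq ((hasDerivAt_integral_comp_mul profile profile_cont hF
    (hasDerivAt_lens_endpoint α) (hasDerivAt_lens_endpoint β)).congr_deriv ?_) ?_
  · simp only [mul_zero, zero_mul, sub_zero, add_zero, div_one, Real.one_rpow, one_mul]
    ring
  · filter_upwards [eventually_forall_mem_uIcc_half_le_lens α β] with b hb
    simpa only [mul_assoc] using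
      windowPotential_chirp p hf fun σ hσ => one_half_pos.trans_le (hb σ hσ)

/-! ### The position operator and the virial identity -/

/-- `g = x_j f`, with both functions in `L²`: the graph of the `j`-th position operator. -/
def IsPosition (j : Fin d) (f g : L2 d) : Prop := g =ᵐ[volume] fun x => (x j : ℂ) * f x

theorem ae_sum_norm_sq_isPosition {f : L2 d} {X : Fin d → L2 d} (hX : ∀ j, IsPosition j f (X j)) :
    ∀ᵐ x, ∑ j, ‖X j x‖ ^ 2 = ‖x‖ ^ 2 * ‖f x‖ ^ 2 := by
  filter_upwards [ae_all_iff.2 hX] with x hx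
  simp_rw [hx, norm_mul, mul_pow, ← Finset.sum_mul, Complex.norm_real, EuclideanSpace.norm_sq_eq]

theorem variance_eq_sum_norm_sq {f : L2 d} {X : Fin d → L2 d} (hX : ∀ j, IsPosition j f (X j)) :
    variance f = ∑ j, ‖X j‖ ^ 2 := by
  simp_rw [norm_sq_eq_integral_norm_sq]
  rw [← integral_finsetSum _ fun j _ => integrable_norm_sq (X j)]
  refine integral_congr_ae ?_
  filter_upwards [ae_sum_norm_sq_isPosition hX] with x hx
  exact hx.symm

section InnerPosition

variable {f g : L2 d} {X Y : Fin d → L2 d}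

theorem ae_sum_inner_isPosition (hX : ∀ j, IsPosition j f (X j)) (hY : ∀ j, IsPosition j g (Y j)) :
    ∀ᵐ x, ∑ j, inner ℂ (Y j x) (X j x) = ((‖x‖ ^ 2 : ℝ) : ℂ) * inner ℂ (g x) (f x) := by
  filter_upwards [ae_all_iff.2 hX, ae_all_iff.2 hY] with x hXx hYx
  simp_rw [hXx, hYx, EuclideanSpace.norm_sq_eq, Complex.ofReal_sum, Finset.sum_mul]
  refine Finset.sum_congr rfl fun j _ => ?_
  rw [← smul_eq_mul, ← smul_eq_mul, inner_smul_left, inner_smul_right, Complex.conj_ofReal,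
    Real.norm_eq_abs, sq_abs]
  push_cast
  ring

theorem integrable_norm_sq_mul_inner (hX : ∀ j, IsPosition j f (X j))
    (hY : ∀ j, IsPosition j g (Y j)) :
    Integrable fun x => ((‖x‖ ^ 2 : ℝ) : ℂ) * inner ℂ (g x) (f x) :=
  (integrable_finsetSum _ fun j _ => L2.integrable_inner (𝕜 := ℂ) (Y j) (X j)).congr
    (ae_sum_inner_isPosition hX hY)

theorem integral_norm_sq_mul_inner (hX : ∀ j, IsPosition j f (X j))
    (hY : ∀ j, IsPosition j g (Y j)) :
    ∫ x, ((‖x‖ ^ 2 : ℝ) : ℂ) * inner ℂ (g x) (f x) = ∑ j, inner ℂ (Y j) (X j) := by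
  rw [← integral_congr_ae (ae_sum_inner_isPosition hX hY),
    integral_finsetSum _ fun j _ => L2.integrable_inner (𝕜 := ℂ) (Y j) (X j)]
  rfl

theorem inner_phaseMul_eq_integral (m : C(Space d, ℝ)) (f g : L2 d) :
    inner ℂ g (phaseMul m f) = ∫ x, Complex.exp (m x * Complex.I) * inner ℂ (g x) (f x) := by
  rw [L2.inner_def]
  refine integral_congr_ae ?_
  filter_upwards [coeFn_phaseMul m f] with x hx
  rw [hx, ← smul_eq_mul, inner_smul_right]

theorem phaseMul_chirp_zero (f : L2 d) : phaseMul (chirp 0) f = f := by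
  have chirp_zero : chirp 0 = (0 : C(Space d, ℝ)) := by
    ext x
    simp [chirp]
  rw [chirp_zero, phaseMul_zero]

theorem hasDerivAt_inner_chirp (hX : ∀ j, IsPosition j f (X j)) (hY : ∀ j, IsPosition j g (Y j)) :
    HasDerivAt (fun b => inner ℂ g (phaseMul (chirp b) f))
      (Complex.I * ∑ j, inner ℂ (Y j) (X j)) 0 := by
  have hinner : AEStronglyMeasurable (fun x => inner ℂ (g x) (f x)) volume :=
    (Lp.memLp g).1.inner (𝕜 := ℂ) (Lp.memLp f).1
  have deriv_integrand (x : Space d) (b : ℝ) :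
      HasDerivAt (fun b : ℝ => Complex.exp (chirp b x * Complex.I) * inner ℂ (g x) (f x))
        (Complex.exp (chirp b x * Complex.I) * ((‖x‖ ^ 2 : ℝ) * Complex.I) * inner ℂ (g x) (f x))
        b := by
    have deriv_phase : HasDerivAt (fun b : ℝ => chirp b x) (‖x‖ ^ 2) b := by
      simpa [chirp] using! (hasDerivAt_id b).mul_const (‖x‖ ^ 2)
    exact ((deriv_phase.ofReal_comp.mul_const Complex.I).cexp).mul_const _
  simp_rw [inner_phaseMul_eq_integral]
  refine (hasDerivAt_integral_of_dominated_loc_of_deriv_le (𝕜 := ℝ) (Metric.ball_mem_nhds 0 one_pos)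
    (Eventually.of_forall fun b =>
      (Continuous.aestronglyMeasurable (by fun_prop)).mul hinner) ?_
    ((Continuous.aestronglyMeasurable (by fun_prop)).mul hinner)
    (Eventually.of_forall fun x b _ => ?_) (integrable_norm_sq_mul_inner hX hY).norm
    (Eventually.of_forall fun x b _ => deriv_integrand x b)).2.congr_deriv ?_
  · exact integrable_phase_mul (chirp 0) (L2.integrable_inner g f)
  · simp only [norm_mul, Complex.norm_exp_ofReal_mul_I, Complex.norm_I, one_mul, mul_one, le_refl]
  · rw [← integral_norm_sq_mul_inner hX hY, ← integral_const_mul]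
    congr 1 with x
    simp [chirp]
    ring

end InnerPosition

theorem norm_isometry_sub_self_sq {E : Type*} [NormedAddCommGroup E] [InnerProductSpace ℂ E]
    (U : E →ₗᵢ[ℂ] E) (f : E) : ‖U f - f‖ ^ 2 = 2 * ‖f‖ ^ 2 - 2 * (inner ℂ f (U f)).re := by
  rw [@norm_sub_sq ℂ, U.norm_map, ← inner_conj_symm, RCLike.conj_re]
  simp only [RCLike.re_to_complex]
  ring

/-- The derivative of `2‖f‖² - 2 Re ⟨f, e^{ib|x|²} f⟩` at `b = 0` is `-2 Re (i ‖x f‖²) = 0`. -/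
theorem hasDerivAt_norm_chirp_sub_sq {f : L2 d} {X : Fin d → L2 d}
    (hX : ∀ j, IsPosition j f (X j)) :
    HasDerivAt (fun b => ‖phaseMul (chirp b) f - f‖ ^ 2) 0 0 := by
  simp_rw [norm_isometry_sub_self_sq]
  refine (((Complex.reCLM.hasFDerivAt.comp_hasDerivAt 0
    (hasDerivAt_inner_chirp hX hX)).const_mul 2).const_sub (2 * ‖f‖ ^ 2)).congr_deriv ?_
  have im_inner_self (j : Fin d) : (inner ℂ (X j) (X j)).im = 0 := inner_self_im (𝕜 := ℂ) (X j)
  rw [Complex.reCLM_apply, Complex.I_mul_re, Complex.im_sum,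
    Finset.sum_eq_zero fun j _ => im_inner_self j]
  simp only [neg_zero, mul_zero]

theorem hasDerivAt_windowPotential_chirp_of_isPosition {p : ℕ} {M : ℝ} {f : L2 d}
    (hf : FlowBoundedOn univ M f) {α β : ℝ} (hαβ : α ≤ β) {X Y : Fin d → L2 d}
    (hX : ∀ j, IsPosition j f (X j)) (hY : ∀ j, IsPosition j (windowNL p α β f) (Y j)) :
    HasDerivAt (fun b => windowPotential p α β (phaseMul (chirp b) f))
      ((p + 2) * ∑ j, (inner ℂ (X j) (Y j)).im) 0 := by
  set H : ℝ → ℝ := fun b => windowPotential p α β (phaseMul (chirp b) f)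
  set g := windowNL p α β f
  set N : ℝ := max M (2 ^ ((d : ℝ) / 2) * M)
  obtain ⟨C, -, taylor⟩ := exists_windowPotential_taylor_bound (d := d) p N hαβ
  have deriv_linear : HasDerivAt (fun b => (p + 2) * (inner ℂ g (phaseMul (chirp b) f)).re)
      ((p + 2) * ∑ j, (inner ℂ (X j) (Y j)).im) 0 := by
    refine ((Complex.reCLM.hasFDerivAt.comp_hasDerivAt 0
      (hasDerivAt_inner_chirp hX hY)).const_mul ((p : ℝ) + 2)).congr_deriv ?_
    rw [Complex.reCLM_apply, Complex.I_mul_re, Complex.im_sum, ← Finset.sum_neg_distrib]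
    simp_rw [← Complex.conj_im, inner_conj_symm]
  have deriv_remainder :
      HasDerivAt (fun b => H b - (p + 2) * (inner ℂ g (phaseMul (chirp b) f)).re) 0 0 := by
    have norm_sq_isLittleO : (fun b => ‖phaseMul (chirp b) f - f‖ ^ 2) =o[𝓝 0] (id : ℝ → ℝ) := by
      simpa [phaseMul_chirp_zero] using!
        hasDerivAt_iff_isLittleO.1 (hasDerivAt_norm_chirp_sub_sq hX)
    refine hasDerivAt_iff_isLittleO.2 (Asymptotics.IsBigO.trans_isLittleO
      (Asymptotics.IsBigO.of_bound C ?_) (by simpa using! norm_sq_isLittleO))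
    filter_upwards [eventually_forall_mem_uIcc_half_le_lens α β] with b hb
    rw [uIcc_of_le hαβ] at hb
    have bound := taylor f (phaseMul (chirp b) f) (hf.mono (subset_univ _) (le_max_left _ _))
      ((hf.chirp hb).mono le_rfl (le_max_right _ _))
    rw [inner_sub_right, Complex.sub_re] at bound
    simp only [H, phaseMul_chirp_zero, smul_zero, sub_zero, Real.norm_eq_abs, abs_pow, abs_norm]
    refine (congrArg abs ?_).trans_le bound
    ring
  refine (deriv_remainder.add deriv_linear).congr_deriv (zero_add _) |>.congr_of_eventuallyEq
    (Eventually.of_forall fun b => ?_)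
  simp only [Pi.add_apply, sub_add_cancel, H]

/-- The virial identity: both sides are the derivative at `b = 0` of the window potential of the
chirped function `e^{ib|x|²} f`, computed once by the chain rule and once by the lens
transformation. -/
theorem sum_im_inner_windowNL {p : ℕ} {M : ℝ} {f : L2 d} (hf : FlowBoundedOn univ M f) {α β : ℝ}
    (hαβ : α ≤ β) {X Y : Fin d → L2 d} (hX : ∀ j, IsPosition j f (X j))
    (hY : ∀ j, IsPosition j (windowNL p α β f) (Y j)) :
    (p + 2) * ∑ j, (inner ℂ (X j) (Y j)).im =
      4 * α ^ 2 * lpMass p (freeProp α f) - 4 * β ^ 2 * lpMass p (freeProp β f) -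
        (2 * d * p - 8) * ∫ s in α..β, s * lpMass p (freeProp s f) :=
  (hasDerivAt_windowPotential_chirp_of_isPosition hf hαβ hX hY).unique
    (hasDerivAt_windowPotential_chirp p hf α β)

/-! ### Position and momentum as generators -/

/-- Multiplication by `exp (i ε x_j)`, the unitary group generated by the position `x_j`. -/
def modulation (j : Fin d) (ε : ℝ) : L2 d →ₗᵢ[ℂ] L2 d :=
  phaseMul (planeWave (EuclideanSpace.single j ε))

/-- The difference quotient `(exp (i ε x_j) - 1) / (i ε)`, a bounded approximation of the
position `x_j`. -/
def positionQuot (j : Fin d) (ε : ℝ) : L2 d →L[ℂ] L2 d :=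
  ((ε : ℂ) * Complex.I)⁻¹ •
    ((modulation j ε).toContinuousLinearMap - ContinuousLinearMap.id ℂ (L2 d))

section Position

variable {j : Fin d} {f X : L2 d}

theorem coeFn_modulation (j : Fin d) (ε : ℝ) (f : L2 d) :
    modulation j ε f =ᵐ[volume] fun x => Complex.exp ((ε * x j : ℝ) * Complex.I) * f x := by
  filter_upwards [coeFn_phaseMul (planeWave (EuclideanSpace.single j ε)) f] with x hx
  rw [modulation, hx, planeWave, ContinuousMap.coe_mk, EuclideanSpace.inner_single_left,
    conj_trivial]

theorem modulation_zero (j : Fin d) (f : L2 d) : modulation j 0 f = f := by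
  refine Lp.ext ?_
  filter_upwards [coeFn_modulation j 0 f] with x hx
  simp [hx]

theorem continuous_modulation (j : Fin d) (f : L2 d) : Continuous fun ε => modulation j ε f := by
  refine continuous_iff_continuousAt.2 fun ε₀ => ?_
  refine tendsto_Lp_two_of_dominated (fun ε => coeFn_modulation j ε f) (coeFn_modulation j ε₀ f)
    (G := fun x => 2 * ‖f x‖) ((Lp.memLp _).norm.const_mul 2)
    (Eventually.of_forall fun ε => Eventually.of_forall fun x => ?_)
    (Eventually.of_forall fun x => ?_)
  · refine (norm_sub_le _ _).trans_eq ?_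
    simp only [norm_mul, Complex.norm_exp_ofReal_mul_I, one_mul, two_mul]
  · exact (by fun_prop : Continuous fun ε : ℝ =>
      Complex.exp ((ε * x j : ℝ) * Complex.I) * f x).tendsto ε₀

theorem positionQuot_apply (j : Fin d) (ε : ℝ) (f : L2 d) :
    positionQuot j ε f = ((ε : ℂ) * Complex.I)⁻¹ • (modulation j ε f - f) := rfl

theorem modulation_eq_add_smul_positionQuot (j : Fin d) (ε : ℝ) (f : L2 d) :
    modulation j ε f = f + ((ε : ℂ) * Complex.I) • positionQuot j ε f := by
  rcases eq_or_ne ε 0 with rfl | hε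
  · simp [modulation_zero]
  · have : (ε : ℂ) * Complex.I ≠ 0 := mul_ne_zero (Complex.ofReal_ne_zero.2 hε) Complex.I_ne_zero
    rw [positionQuot_apply, smul_inv_smul₀ this, add_sub_cancel]

theorem positionQuot_eq_slope (j : Fin d) (ε : ℝ) (f : L2 d) :
    positionQuot j ε f = -Complex.I • slope (fun ε => modulation j ε f) 0 ε := by
  rw [positionQuot_apply, slope_def_module, sub_zero, modulation_zero, mul_inv, Complex.inv_I,
    mul_comm, mul_smul, ← Complex.ofReal_inv, Complex.coe_smul]
  rfl

theorem coeFn_positionQuot (j : Fin d) (ε : ℝ) (f : L2 d) :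
    positionQuot j ε f =ᵐ[volume] fun x =>
      ((Complex.exp ((ε * x j : ℝ) * Complex.I) - 1) / ε) * (-Complex.I * f x) := by
  rw [positionQuot_apply]
  filter_upwards [Lp.coeFn_smul ((ε : ℂ) * Complex.I)⁻¹ (modulation j ε f - f),
    Lp.coeFn_sub (modulation j ε f) f, coeFn_modulation j ε f] with x hsmul hsub hmod
  rw [hsmul, Pi.smul_apply, hsub, Pi.sub_apply, hmod, smul_eq_mul, mul_inv, Complex.inv_I]
  ring

theorem norm_cexp_sub_one_le (r : ℝ) : ‖Complex.exp (r * Complex.I) - 1‖ ≤ |r| := by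
  simpa only [mul_comm Complex.I, Real.norm_eq_abs] using Real.norm_exp_I_mul_ofReal_sub_one_le

theorem norm_cexp_quot_mul_le (ε r : ℝ) (z : ℂ) :
    ‖((Complex.exp ((ε * r : ℝ) * Complex.I) - 1) / ε) * (-Complex.I * z)‖ ≤ ‖(r : ℂ) * z‖ := by
  have quot_le : ‖(Complex.exp ((ε * r : ℝ) * Complex.I) - 1) / ε‖ ≤ |r| := by
    rw [norm_div, Complex.norm_real, Real.norm_eq_abs]
    refine div_le_of_le_mul₀ (abs_nonneg ε) (abs_nonneg r) ?_
    rw [← abs_mul, mul_comm r]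
    exact norm_cexp_sub_one_le _
  rw [norm_mul, norm_mul, norm_neg, Complex.norm_I, one_mul, norm_mul, Complex.norm_real,
    Real.norm_eq_abs]
  gcongr

theorem tendsto_cexp_quot_mul (r : ℝ) (z : ℂ) :
    Tendsto (fun ε : ℝ => ((Complex.exp ((ε * r : ℝ) * Complex.I) - 1) / ε) * (-Complex.I * z))
      (𝓝[≠] 0) (𝓝 ((r : ℂ) * z)) := by
  have hderiv : HasDerivAt (fun ε : ℝ => Complex.exp ((ε * r : ℝ) * Complex.I))
      ((r : ℂ) * Complex.I) 0 := by
    have hphase : HasDerivAt (fun ε : ℝ => ((ε * r : ℝ) : ℂ) * Complex.I) (r * Complex.I) 0 := by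
      simpa using! ((hasDerivAt_id (0 : ℝ)).mul_const r).ofReal_comp.mul_const Complex.I
    simpa using hphase.cexp
  have hlim := (hasDerivAt_iff_tendsto_slope.1 hderiv).mul_const (-Complex.I * z)
  have hlim_eq : (r : ℂ) * Complex.I * (-Complex.I * z) = r * z := by
    linear_combination (-(r : ℂ) * z) * Complex.I_mul_I
  rw [hlim_eq] at hlim
  refine hlim.congr fun ε => ?_
  simp only [slope_def_module, sub_zero, zero_mul, Complex.ofReal_zero, Complex.exp_zero,
    Complex.real_smul, Complex.ofReal_inv, div_eq_inv_mul]

theorem IsPosition.norm_positionQuot_le (h : IsPosition j f X) (ε : ℝ) :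
    ‖positionQuot j ε f‖ ≤ ‖X‖ := by
  refine Lp.norm_le_norm_of_ae_le ?_
  filter_upwards [coeFn_positionQuot j ε f, h] with x hquot hX
  rw [hquot, hX]
  exact norm_cexp_quot_mul_le ε (x j) (f x)

theorem IsPosition.tendsto_positionQuot (h : IsPosition j f X) :
    Tendsto (fun ε => positionQuot j ε f) (𝓝[≠] 0) (𝓝 X) := by
  refine tendsto_Lp_two_of_dominated (fun ε => coeFn_positionQuot j ε f) h
    (G := fun x => 2 * ‖X x‖) ((Lp.memLp _).norm.const_mul 2) (Eventually.of_forall fun ε => ?_)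
    (Eventually.of_forall fun x => tendsto_cexp_quot_mul (x j) (f x))
  filter_upwards [h] with x hX
  rw [two_mul, hX]
  exact (norm_sub_le _ _).trans (add_le_add_left (norm_cexp_quot_mul_le ε (x j) (f x)) _)

/-- By Fatou's lemma along the difference quotients. -/
theorem exists_isPosition_norm_le {C : ℝ} (h : ∀ᶠ ε in 𝓝[>] 0, ‖positionQuot j ε f‖ ≤ C) :
    ∃ X : L2 d, IsPosition j f X ∧ ‖X‖ ≤ C := by
  obtain ⟨ε, hε⟩ := exists_seq_tendsto (𝓝[>] (0 : ℝ))
  have hε_ne : Tendsto ε atTop (𝓝[≠] 0) := hε.mono_right (nhdsGT_le_nhdsNE 0)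
  have hlim : ∀ᵐ x, Tendsto (fun n => positionQuot j (ε n) f x) atTop (𝓝 ((x j : ℂ) * f x)) := by
    filter_upwards [ae_all_iff.2 fun n => coeFn_positionQuot j (ε n) f] with x hx
    exact ((tendsto_cexp_quot_mul (x j) (f x)).comp hε_ne).congr fun n => (hx n).symm
  have hmem : MemLp (fun x : Space d => (x j : ℂ) * f x) 2 volume := by
    refine ⟨(Continuous.aestronglyMeasurable (by fun_prop)).mul (Lp.memLp f).1, ?_⟩
    refine ((Lp.eLpNorm_lim_le_liminf_eLpNorm (fun n => (Lp.memLp _).1) _ hlim).trans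
      (liminf_le_of_frequently_le' ?_)).trans_lt (ENNReal.ofReal_lt_top (r := C))
    refine Eventually.frequently ?_
    filter_upwards [hε.eventually h] with n hn
    rw [← Lp.enorm_def, ← ofReal_norm]
    exact ENNReal.ofReal_le_ofReal hn
  have hX : IsPosition j f hmem.toLp := hmem.coeFn_toLp
  have hX_lim := hX.tendsto_positionQuot.mono_left (nhdsGT_le_nhdsNE 0)
  exact ⟨hmem.toLp, hX, le_of_tendsto hX_lim.norm h⟩

theorem isPosition_of_tendsto_positionQuot
    (h : Tendsto (fun ε => positionQuot j ε f) (𝓝[≠] 0) (𝓝 X)) : IsPosition j f X := by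
  have hbound : ∀ᶠ ε in 𝓝[>] 0, ‖positionQuot j ε f‖ ≤ ‖X‖ + 1 :=
    (h.mono_left (nhdsGT_le_nhdsNE 0)).norm.eventually_le_const (lt_add_one ‖X‖)
  obtain ⟨Y, hY, -⟩ := exists_isPosition_norm_le hbound
  rwa [tendsto_nhds_unique h hY.tendsto_positionQuot]

theorem isPosition_iff_hasDerivAt :
    IsPosition j f X ↔ HasDerivAt (fun ε => modulation j ε f) (Complex.I • X) 0 := by
  rw [hasDerivAt_iff_tendsto_slope]
  refine ⟨fun h => ?_, fun h => isPosition_of_tendsto_positionQuot ?_⟩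
  · refine (h.tendsto_positionQuot.const_smul Complex.I).congr fun ε => ?_
    rw [positionQuot_eq_slope, smul_smul, mul_neg, Complex.I_mul_I, neg_neg, one_smul]
  · have := h.const_smul (-Complex.I)
    rw [smul_smul, neg_mul, Complex.I_mul_I, neg_neg, one_smul] at this
    exact this.congr fun ε => (positionQuot_eq_slope j ε f).symm

end Position

/-- `g` is the image of `f` under the Fourier multiplier with the real symbol `m`. This is a
relation rather than a function since the operator may be unbounded. -/
def IsFourierMultiplier (m : Space d → ℝ) (f g : L2 d) : Prop :=
  (𝓕 g : L2 d) =ᵐ[volume] fun ξ => (m ξ : ℂ) * (𝓕 f : L2 d) ξ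

/-- `k` is the momentum `-i ∂_j f`. -/
def IsMomentum (j : Fin d) (f k : L2 d) : Prop :=
  IsFourierMultiplier (fun ξ => 2 * Real.pi * ξ j) f k

section Momentum

theorem smul_single (c r : ℝ) (j : Fin d) :
    c • EuclideanSpace.single j r = EuclideanSpace.single j (c * r) := by
  ext i
  simp

variable {j : Fin d} {f X k : L2 d}

theorem IsMomentum.isPosition_fourier (h : IsMomentum j f k) :
    IsPosition j (𝓕 f) (((2 * Real.pi)⁻¹ : ℝ) • (𝓕 k : L2 d)) := by
  filter_upwards [Lp.coeFn_smul ((2 * Real.pi)⁻¹ : ℝ) (𝓕 k : L2 d), h] with ξ hsmul hk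
  have hpi : (Real.pi : ℂ) ≠ 0 := Complex.ofReal_ne_zero.2 Real.pi_ne_zero
  rw [hsmul, Pi.smul_apply, hk, Complex.real_smul]
  push_cast
  field_simp

theorem IsMomentum.hasDerivAt_translate (h : IsMomentum j f k) :
    HasDerivAt (fun ε => translate (EuclideanSpace.single j (-ε)) f) (Complex.I • k) 0 := by
  have hpi : 2 * Real.pi ≠ 0 := by positivity
  have hscale : HasDerivAt (fun ε : ℝ => 2 * Real.pi * ε) (2 * Real.pi) 0 := by
    simpa using! (hasDerivAt_id (0 : ℝ)).const_mul (2 * Real.pi)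
  have hmod := isPosition_iff_hasDerivAt.1 h.isPosition_fourier
  rw [← mul_zero (2 * Real.pi)] at hmod
  have hfourier := (Lp.fourierTransformₗᵢ (Space d) ℂ).symm.toContinuousLinearEquiv
    |>.toContinuousLinearMap.restrictScalars ℝ |>.hasFDerivAt.comp_hasDerivAt 0
      (hmod.scomp 0 hscale)
  refine (hfourier.congr_deriv ?_).congr_of_eventuallyEq (Eventually.of_forall fun ε => ?_)
  · rw [smul_comm Complex.I, smul_inv_smul₀ hpi]
    exact ((Lp.fourierTransformₗᵢ (Space d) ℂ).symm.map_smul Complex.I _).trans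
      (congrArg _ ((Lp.fourierTransformₗᵢ (Space d) ℂ).symm_apply_apply k))
  · refine ((Lp.fourierTransformₗᵢ (Space d) ℂ).symm_apply_eq.2 ?_).symm
    change _ = (𝓕 (translate (EuclideanSpace.single j (-ε)) f) : L2 d)
    rw [fourier_translate, smul_single, neg_mul_neg]
    rfl

theorem modulation_freeProp (j : Fin d) (ε a : ℝ) (f : L2 d) :
    modulation j ε (freeProp a f) = freeProp a (Complex.exp ((a * ε ^ 2 : ℝ) * Complex.I) •
      modulation j ε (translate (EuclideanSpace.single j (-(2 * a * ε))) f)) := by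
  have covariance := congrArg (freeProp a)
    (freeProp_phaseMul_planeWave (-a) (EuclideanSpace.single j ε) (freeProp a f))
  rw [freeProp_freeProp, add_neg_cancel, freeProp_zero, freeProp_freeProp, neg_add_cancel,
    freeProp_zero, PiLp.norm_single, Real.norm_eq_abs, sq_abs, smul_single] at covariance
  rw [modulation, covariance]
  simp only [mul_neg, neg_mul, neg_neg]

theorem hasDerivAt_isometry_apply {E : Type*} [NormedAddCommGroup E] [NormedSpace ℂ E]
    {U : ℝ → E →ₗᵢ[ℂ] E} {v : ℝ → E} {v' w : E} {t : ℝ} (hv : HasDerivAt v v' t)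
    (hU : HasDerivAt (fun ε => U ε (v t)) w t) (hcont : ContinuousAt (fun ε => U ε v') t) :
    HasDerivAt (fun ε => U ε (v ε)) (U t v' + w) t := by
  have increment : HasDerivAt (fun ε => U ε (v ε - v t)) (U t v') t := by
    rw [hasDerivAt_iff_tendsto_slope, tendsto_iff_norm_sub_tendsto_zero] at hv ⊢
    have hsum := hv.add (tendsto_iff_norm_sub_tendsto_zero.1
      (hcont.tendsto.mono_left (nhdsWithin_le_nhds (s := {t}ᶜ))))
    rw [add_zero] at hsum
    refine squeeze_zero (fun _ => norm_nonneg _) (fun ε => ?_) hsum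
    have slope_eq : slope (fun ε => U ε (v ε - v t)) t ε = U ε (slope v t ε) := by
      rw [slope_def_module, slope_def_module, sub_self, map_zero, sub_zero]
      exact ((U ε).toLinearMap.map_smul_of_tower (ε - t)⁻¹ (v ε - v t)).symm
    rw [slope_eq, ← (U ε).norm_map (slope v t ε - v'), map_sub]
    exact norm_sub_le_norm_sub_add_norm_sub _ _ _
  refine (increment.add hU).congr_of_eventuallyEq (Eventually.of_forall fun ε => ?_)
  simp only [Pi.add_apply, map_sub, sub_add_cancel]

theorem IsPosition.freeProp (hX : IsPosition j f X) (hk : IsMomentum j f k) (a : ℝ) :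
    IsPosition j (freeProp a f) (freeProp a (X + (2 * a) • k)) := by
  have hphase : HasDerivAt (fun ε : ℝ => Complex.exp ((a * ε ^ 2 : ℝ) * Complex.I)) 0 0 := by
    simpa using ((((hasDerivAt_id (0 : ℝ)).pow 2).const_mul a).ofReal_comp.mul_const
      Complex.I).cexp
  have htranslate : HasDerivAt (fun ε => translate (EuclideanSpace.single j (-(2 * a * ε))) f)
      ((2 * a) • Complex.I • k) 0 := by
    have hscale : HasDerivAt (fun ε : ℝ => 2 * a * ε) (2 * a) 0 := by
      simpa using! (hasDerivAt_id (0 : ℝ)).const_mul (2 * a)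
    have htrans := hk.hasDerivAt_translate
    rw [← mul_zero (2 * a)] at htrans
    exact htrans.scomp 0 hscale
  have translate_start : translate (EuclideanSpace.single j (-(2 * a * 0))) f = f := by
    have single_zero : EuclideanSpace.single j (0 : ℝ) = 0 := by simp
    rw [mul_zero, neg_zero, single_zero, translate_zero]
  have hmod := isPosition_iff_hasDerivAt.1 hX
  rw [← translate_start] at hmod
  have hprod := hphase.smul (hasDerivAt_isometry_apply htranslate hmod
    (continuous_modulation j _).continuousAt)
  have hfree := ((freePropIsometry a).toContinuousLinearMap.restrictScalars ℝ
    ).hasFDerivAt.comp_hasDerivAt 0 hprod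
  refine isPosition_iff_hasDerivAt.2 ((hfree.congr_deriv ?_).congr_of_eventuallyEq
    (Eventually.of_forall fun ε => ?_))
  · refine (freePropIsometry_apply _ _).trans ?_
    simp only [modulation_zero, zero_pow two_ne_zero, mul_zero, Complex.ofReal_zero, zero_mul,
      Complex.exp_zero, one_smul, zero_smul, add_zero, ← freeProp_smul]
    rw [smul_add, add_comm, smul_comm Complex.I]
  · exact (modulation_freeProp j ε a f).trans (freePropIsometry_apply _ _).symm

end Momentum

/-! ### Covariance of the averaged nonlinearity -/

section Covariance

variable {p : ℕ} {I : Set ℝ} {M : ℝ} {f : L2 d}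

theorem powerNL_smul (hf : ∀ᵐ x, ‖f x‖ ≤ M) {c : ℂ} (hc : ‖c‖ = 1) :
    powerNL p (c • f) = c • powerNL p f := by
  have hcf : ∀ᵐ x, ‖(c • f : L2 d) x‖ ≤ M := by
    filter_upwards [Lp.coeFn_smul c f, hf] with x hsmul hx
    rwa [hsmul, Pi.smul_apply, norm_smul, hc, one_mul]
  refine Lp.ext ?_
  filter_upwards [coeFn_powerNL (p := p) hcf, coeFn_powerNL (p := p) hf, Lp.coeFn_smul c f,
    Lp.coeFn_smul c (powerNL p f)] with x hNLsmul hNL hsmul hsmulNL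
  rw [hNLsmul, hsmulNL, Pi.smul_apply, hNL, hsmul, Pi.smul_apply, norm_smul, hc, one_mul,
    smul_eq_mul, smul_eq_mul]
  ring

theorem powerNL_phaseMul (hf : ∀ᵐ x, ‖f x‖ ≤ M) (m : C(Space d, ℝ)) :
    powerNL p (phaseMul m f) = phaseMul m (powerNL p f) := by
  refine Lp.ext ?_
  filter_upwards [coeFn_powerNL (p := p) (ae_norm_phaseMul_le hf m), coeFn_powerNL (p := p) hf,
    coeFn_phaseMul m f, coeFn_phaseMul m (powerNL p f)] with x hNLphase hNL hphase hphaseNL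
  rw [hNLphase, hphaseNL, hNL, hphase, norm_mul, Complex.norm_exp_ofReal_mul_I, one_mul]
  ring

theorem powerNL_translate (hf : ∀ᵐ x, ‖f x‖ ≤ M) (h : Space d) :
    powerNL p (translate h f) = translate h (powerNL p f) := by
  refine Lp.ext ?_
  filter_upwards [coeFn_powerNL (p := p) (ae_norm_translate_le hf h),
    ae_comp_sub h (coeFn_powerNL (p := p) hf), coeFn_translate h f,
    coeFn_translate h (powerNL p f)] with x hNLtrans hNL htrans htransNL
  rw [hNLtrans, htransNL, hNL, htrans]

theorem FlowBoundedOn.phaseMul_planeWave (hf : FlowBoundedOn I M f) (h : Space d) :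
    FlowBoundedOn I M (phaseMul (planeWave h) f) := fun σ hσ => by
  rw [freeProp_phaseMul_planeWave]
  filter_upwards [Lp.coeFn_smul (Complex.exp ((-(σ * ‖h‖ ^ 2) : ℝ) * Complex.I))
    (phaseMul (planeWave h) (translate ((2 * σ) • h) (freeProp σ f))),
    ae_norm_phaseMul_le (ae_norm_translate_le (hf σ hσ) ((2 * σ) • h)) (planeWave h)]
    with x hsmul hx
  rwa [hsmul, Pi.smul_apply, norm_smul, Complex.norm_exp_ofReal_mul_I, one_mul]

theorem FlowBoundedOn.freeProp (hf : FlowBoundedOn univ M f) (a : ℝ) :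
    FlowBoundedOn univ M (freeProp a f) := fun σ _ => by
  rw [freeProp_freeProp]
  exact hf _ (mem_univ _)

theorem freeProp_conjugatedNL (p : ℕ) (f : L2 d) (σ : ℝ) :
    GabitovTuritsyn.freeProp σ (conjugatedNL p f σ) =
      powerNL p (GabitovTuritsyn.freeProp σ f) := by
  rw [conjugatedNL, freeProp_freeProp, add_neg_cancel, freeProp_zero]

theorem conjugatedNL_phaseMul_planeWave (hf : FlowBoundedOn I M f) (h : Space d) {σ : ℝ}
    (hσ : σ ∈ I) :
    conjugatedNL p (phaseMul (planeWave h) f) σ = phaseMul (planeWave h) (conjugatedNL p f σ) := by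
  have hb := hf σ hσ
  rw [conjugatedNL, freeProp_phaseMul_planeWave,
    powerNL_smul (ae_norm_phaseMul_le (ae_norm_translate_le hb _) _)
      (Complex.norm_exp_ofReal_mul_I _),
    powerNL_phaseMul (ae_norm_translate_le hb _), powerNL_translate hb, ← freeProp_conjugatedNL,
    ← freeProp_phaseMul_planeWave, freeProp_freeProp, neg_add_cancel, freeProp_zero]

variable {α β : ℝ}

theorem windowNL_phaseMul_planeWave (hαβ : α ≤ β) (hf : FlowBoundedOn (Icc α β) M f)
    (h : Space d) :
    windowNL p α β (phaseMul (planeWave h) f) = phaseMul (planeWave h) (windowNL p α β f) := by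
  refine Eq.trans ?_ ((phaseMul (planeWave h)).toContinuousLinearMap.intervalIntegral_comp_comm
    (hf.intervalIntegrable_conjugatedNL hαβ p))
  refine intervalIntegral.integral_congr fun σ hσ => ?_
  rw [uIcc_of_le hαβ] at hσ
  exact conjugatedNL_phaseMul_planeWave hf h hσ

theorem norm_positionQuot_windowNL_le (hαβ : α ≤ β) (hf : FlowBoundedOn (Icc α β) M f)
    (j : Fin d) (ε : ℝ) :
    ‖positionQuot j ε (windowNL p α β f)‖ ≤
      (β - α) * ((p + 1) * M ^ p) * ‖positionQuot j ε f‖ := by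
  rw [positionQuot_apply, positionQuot_apply, norm_smul, norm_smul, modulation,
    ← windowNL_phaseMul_planeWave hαβ hf, mul_left_comm]
  gcongr
  exact norm_windowNL_sub_le hαβ (hf.phaseMul_planeWave _) hf

theorem IsPosition.exists_windowNL {j : Fin d} {X : L2 d} (hX : IsPosition j f X) (hαβ : α ≤ β)
    (hM : 0 ≤ M) (hf : FlowBoundedOn (Icc α β) M f) (p : ℕ) :
    ∃ Y, IsPosition j (windowNL p α β f) Y := by
  have hbound (ε : ℝ) : ‖positionQuot j ε (windowNL p α β f)‖ ≤
      (β - α) * ((p + 1) * M ^ p) * ‖X‖ := by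
    refine (norm_positionQuot_windowNL_le hαβ hf j ε).trans ?_
    have := sub_nonneg.2 hαβ
    gcongr
    exact hX.norm_positionQuot_le ε
  obtain ⟨Y, hY, -⟩ := exists_isPosition_norm_le (Eventually.of_forall hbound)
  exact ⟨Y, hY⟩

theorem freeProp_windowNL (hαβ : α ≤ β) (hf : FlowBoundedOn (Icc α β) M f) (a : ℝ) :
    freeProp a (windowNL p α β f) = windowNL p (α - a) (β - a) (freeProp a f) := by
  rw [windowNL, windowNL, ← freePropIsometry_apply]
  refine ((freePropIsometry a).toContinuousLinearMap.intervalIntegral_comp_comm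
    (hf.intervalIntegrable_conjugatedNL hαβ p)).symm.trans ?_
  rw [← intervalIntegral.integral_comp_sub_right]
  refine intervalIntegral.integral_congr fun σ _ => ?_
  refine (freePropIsometry_apply a (conjugatedNL p f σ)).trans ?_
  rw [conjugatedNL, conjugatedNL, freeProp_freeProp, freeProp_freeProp, neg_sub, sub_add_cancel,
    sub_eq_add_neg]

end Covariance

/-! ### The Laplacian and the kinetic energy -/

section FourierMultiplier

variable {m : Space d → ℝ} {f g Lf Lg : L2 d}

theorem isFourierMultiplier_fourierMultiplier
    (h : MemLp (fun ξ => (m ξ : ℂ) * (𝓕 f : L2 d) ξ) 2 volume) :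
    IsFourierMultiplier m f (fourierMultiplier (fun ξ => (m ξ : ℂ)) f) := by
  rw [fourierMultiplier, dif_pos h, IsFourierMultiplier, FourierTransform.fourier_fourierInv_eq]
  exact h.coeFn_toLp

theorem isFourierMultiplier_fourierMultiplier_of_sobolevNorm_lt_top {s : ℝ}
    (hf : sobolevNorm s f < ∞) (hm : Continuous m) (hle : ∀ ξ, |m ξ| ≤ sobolevWeight s ξ) :
    IsFourierMultiplier m f (fourierMultiplier (fun ξ => (m ξ : ℂ)) f) := by
  have hweighted : MemLp (fun ξ => (sobolevWeight s ξ : ℂ) * (𝓕 f : L2 d) ξ) 2 volume :=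
    ⟨(Complex.continuous_ofReal.comp (continuous_sobolevWeight s)).aestronglyMeasurable.mul
      (Lp.memLp _).1, hf⟩
  refine isFourierMultiplier_fourierMultiplier (hweighted.of_le
    ((Complex.continuous_ofReal.comp hm).aestronglyMeasurable.mul (Lp.memLp _).1)
    (Eventually.of_forall fun ξ => ?_))
  rw [norm_mul, norm_mul, Complex.norm_real, Complex.norm_real, Real.norm_eq_abs, Real.norm_eq_abs,
    abs_of_pos (sobolevWeight_pos s ξ)]
  gcongr
  exact hle ξ

theorem IsFourierMultiplier.freeProp (h : IsFourierMultiplier m f g) (a : ℝ) :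
    IsFourierMultiplier m (freeProp a f) (freeProp a g) := by
  rw [IsFourierMultiplier, fourier_freeProp, fourier_freeProp]
  filter_upwards [coeFn_phaseMul (schrodingerPhase a) (𝓕 f : L2 d),
    coeFn_phaseMul (schrodingerPhase a) (𝓕 g : L2 d), h] with ξ hphase_f hphase_g hg
  rw [hphase_f, hphase_g, hg]
  ring

theorem inner_ofReal_mul_left (r : ℝ) (z w : ℂ) : inner ℂ ((r : ℂ) * z) w = r * inner ℂ z w := by
  rw [← smul_eq_mul, inner_smul_left, Complex.conj_ofReal]

theorem inner_ofReal_mul_right (r : ℝ) (z w : ℂ) : inner ℂ z ((r : ℂ) * w) = r * inner ℂ z w := by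
  rw [← smul_eq_mul, inner_smul_right]

theorem IsFourierMultiplier.inner_comm (hf : IsFourierMultiplier m f Lf)
    (hg : IsFourierMultiplier m g Lg) : inner ℂ f Lg = inner ℂ Lf g := by
  rw [← Lp.inner_fourier_eq f, ← Lp.inner_fourier_eq Lf, L2.inner_def, L2.inner_def]
  refine integral_congr_ae ?_
  filter_upwards [hf, hg] with ξ hLf hLg
  rw [hLf, hLg, inner_ofReal_mul_left, inner_ofReal_mul_right]

theorem IsFourierMultiplier.inner_eq_integral (hf : IsFourierMultiplier m f Lf) :
    inner ℂ f Lf = ((∫ ξ, m ξ * ‖(𝓕 f : L2 d) ξ‖ ^ 2 : ℝ) : ℂ) := by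
  rw [← Lp.inner_fourier_eq, L2.inner_def, ← integral_complex_ofReal]
  refine integral_congr_ae ?_
  filter_upwards [hf] with ξ hξ
  rw [hξ, inner_ofReal_mul_right, inner_self_eq_norm_sq_to_K, Complex.ofReal_mul,
    Complex.ofReal_pow]
  rfl

theorem IsFourierMultiplier.im_inner_eq_zero (hf : IsFourierMultiplier m f Lf) :
    (inner ℂ f Lf).im = 0 := by
  rw [hf.inner_eq_integral, Complex.ofReal_im]

end FourierMultiplier

/-- `g = Δ f`. -/
def IsLaplacian (f g : L2 d) : Prop :=
  IsFourierMultiplier (fun ξ => -(2 * Real.pi * ‖ξ‖) ^ 2) f g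

section Kinetic

variable {s : ℝ} {f Lf k : L2 d} {j : Fin d} {P : Fin d → L2 d}

theorem one_add_sq_le_sobolevWeight (hs : 2 ≤ s) (ξ : Space d) :
    1 + (2 * Real.pi * ‖ξ‖) ^ 2 ≤ sobolevWeight s ξ := by
  have one_le : 1 ≤ 1 + (2 * Real.pi * ‖ξ‖) ^ 2 := le_add_of_nonneg_right (sq_nonneg _)
  calc 1 + (2 * Real.pi * ‖ξ‖) ^ 2 = (1 + (2 * Real.pi * ‖ξ‖) ^ 2) ^ (1 : ℝ) :=
        (Real.rpow_one _).symm
    _ ≤ sobolevWeight s ξ := Real.rpow_le_rpow_of_exponent_le one_le (by linarith)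

theorem isLaplacian_laplacian (hs : 2 ≤ s) (hf : sobolevNorm s f < ∞) :
    IsLaplacian f (laplacian f) := by
  refine isFourierMultiplier_fourierMultiplier_of_sobolevNorm_lt_top hf (by fun_prop) fun ξ => ?_
  rw [abs_neg, abs_of_nonneg (by positivity)]
  linarith [one_add_sq_le_sobolevWeight hs ξ]

theorem exists_isMomentum (hs : 2 ≤ s) (hf : sobolevNorm s f < ∞) (j : Fin d) :
    ∃ k : L2 d, IsMomentum j f k := by
  refine ⟨_, isFourierMultiplier_fourierMultiplier_of_sobolevNorm_lt_top hf (by fun_prop)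
    fun ξ => ?_⟩
  have coord_le : 2 * Real.pi * |ξ j| ≤ 2 * Real.pi * ‖ξ‖ := by
    gcongr
    simpa using PiLp.norm_apply_le ξ j
  rw [abs_mul, abs_of_pos (by positivity : 0 < 2 * Real.pi)]
  nlinarith [one_add_sq_le_sobolevWeight hs ξ, sq_nonneg (2 * Real.pi * ‖ξ‖ - 1)]

theorem kinetic_nonneg (f : L2 d) : 0 ≤ kinetic f :=
  integral_nonneg fun _ => by positivity

theorem kinetic_eq_sum_norm_sq (hP : ∀ j, IsMomentum j f (P j)) :
    kinetic f = ∑ j, ‖P j‖ ^ 2 := by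
  have plancherel (j : Fin d) : ‖P j‖ ^ 2 = ∫ ξ, ‖(𝓕 (P j) : L2 d) ξ‖ ^ 2 := by
    rw [← norm_sq_eq_integral_norm_sq, Lp.norm_fourier_eq]
  simp_rw [plancherel]
  rw [← integral_finsetSum _ fun j _ => integrable_norm_sq _]
  refine integral_congr_ae ?_
  filter_upwards [ae_all_iff.2 hP] with ξ hξ
  simp_rw [hξ, norm_mul, mul_pow, ← Finset.sum_mul, Complex.norm_real, norm_mul, mul_pow,
    ← Finset.mul_sum, EuclideanSpace.norm_sq_eq, Real.norm_eq_abs, sq_abs]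

theorem IsMomentum.norm_sq_le_kinetic (hs : 2 ≤ s) (hf : sobolevNorm s f < ∞)
    (hk : IsMomentum j f k) : ‖k‖ ^ 2 ≤ kinetic f := by
  choose P hP using exists_isMomentum hs hf
  have hkP : k = P j := eq_of_fourier_eq (Lp.ext (EventuallyEq.trans hk (hP j).symm))
  rw [hkP, kinetic_eq_sum_norm_sq hP]
  exact Finset.single_le_sum (f := fun j => ‖P j‖ ^ 2) (fun i _ => sq_nonneg _)
    (Finset.mem_univ j)

theorem IsLaplacian.kinetic_eq (hf : IsLaplacian f Lf) : kinetic f = -(inner ℂ f Lf).re := by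
  rw [IsFourierMultiplier.inner_eq_integral hf, Complex.ofReal_re, kinetic, ← integral_neg]
  simp only [neg_mul, neg_neg]

theorem fourier_modulation (j : Fin d) (ε : ℝ) (f : L2 d) :
    (𝓕 (modulation j ε f) : L2 d) =ᵐ[volume]
      fun ξ => (𝓕 f : L2 d) (ξ - (2 * Real.pi)⁻¹ • EuclideanSpace.single j ε) := by
  rw [modulation, fourier_phaseMul_planeWave]
  exact coeFn_translate _ _

theorem neg_sq_norm_sub_single (j : Fin d) (ε : ℝ) (ξ : Space d) :
    -(2 * Real.pi * ‖ξ - (2 * Real.pi)⁻¹ • EuclideanSpace.single j ε‖) ^ 2 =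
      -(2 * Real.pi * ‖ξ‖) ^ 2 + 2 * ε * (2 * Real.pi * ξ j) - ε ^ 2 := by
  rw [smul_single, mul_pow, norm_sub_sq_real, EuclideanSpace.inner_single_right,
    PiLp.norm_single, Real.norm_eq_abs, sq_abs, conj_trivial]
  have := Real.pi_ne_zero
  field_simp
  ring

theorem inner_modulation_commutator (hL : IsLaplacian f Lf) (hk : IsMomentum j f k) (ε : ℝ) :
    inner ℂ f (modulation j ε Lf) - inner ℂ Lf (modulation j ε f) =
      2 * ε * inner ℂ k (modulation j ε f) - ε ^ 2 * inner ℂ f (modulation j ε f) := by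
  simp only [← Lp.inner_fourier_eq _ (modulation j ε _), L2.inner_def]
  have hint (a b : L2 d) : Integrable fun x => inner ℂ (a x) (b x) :=
    L2.integrable_inner (𝕜 := ℂ) a b
  rw [← integral_sub (hint _ _) (hint _ _), ← integral_const_mul, ← integral_const_mul,
    ← integral_sub ((hint _ _).const_mul _) ((hint _ _).const_mul _)]
  refine integral_congr_ae ?_
  filter_upwards [fourier_modulation j ε f, fourier_modulation j ε Lf, hL, hk,
    ae_comp_sub ((2 * Real.pi)⁻¹ • EuclideanSpace.single j ε) hL]
    with ξ hmod hmodL hLξ hkξ hL_shift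
  rw [hmod, hmodL, hLξ, hkξ, hL_shift, neg_sq_norm_sub_single]
  simp only [inner_ofReal_mul_left, inner_ofReal_mul_right]
  push_cast
  ring

theorem sq_mul_re_inner_positionQuot (j : Fin d) (ε : ℝ) (f g : L2 d) :
    ε ^ 2 * (inner ℂ (positionQuot j ε f) (positionQuot j ε g)).re =
      2 * (inner ℂ f g).re - (inner ℂ f (modulation j ε g)).re -
        (inner ℂ g (modulation j ε f)).re := by
  have increment (h : L2 d) :
      ((ε : ℂ) * Complex.I) • positionQuot j ε h = modulation j ε h - h := by
    rw [modulation_eq_add_smul_positionQuot, add_sub_cancel_left]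
  have hscale : ((ε ^ 2 : ℝ) : ℂ) * inner ℂ (positionQuot j ε f) (positionQuot j ε g) =
      inner ℂ (modulation j ε f - f) (modulation j ε g - g) := by
    rw [← increment, ← increment, inner_smul_left, inner_smul_right, map_mul, Complex.conj_ofReal,
      Complex.conj_I]
    push_cast
    linear_combination
      (-(ε : ℂ) ^ 2 * inner ℂ (positionQuot j ε f) (positionQuot j ε g)) * -Complex.I_mul_I
  rw [← Complex.re_ofReal_mul, hscale, inner_sub_left, inner_sub_right, inner_sub_right,
    LinearIsometry.inner_map_map, ← inner_conj_symm (modulation j ε f) g]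
  simp only [Complex.sub_re, Complex.conj_re]
  ring

theorem im_inner_modulation (j : Fin d) (ε : ℝ) (f g : L2 d) :
    (inner ℂ g (modulation j ε f)).im =
      (inner ℂ g f).im + ε * (inner ℂ g (positionQuot j ε f)).re := by
  rw [modulation_eq_add_smul_positionQuot, inner_add_right, inner_smul_right, Complex.add_im,
    mul_assoc, Complex.im_ofReal_mul, Complex.I_mul_im]

theorem re_inner_positionQuot_laplacian (hL : IsLaplacian f Lf) (hk : IsMomentum j f k) {ε : ℝ}
    (hε : ε ≠ 0) :
    (inner ℂ (positionQuot j ε f) (positionQuot j ε (-Complex.I • Lf))).re =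
      ε * (inner ℂ f (positionQuot j ε f)).re - 2 * (inner ℂ k (positionQuot j ε f)).re := by
  have commutator := congrArg Complex.im (inner_modulation_commutator hL hk ε)
  have im_Lf : (inner ℂ f Lf).im = 0 := IsFourierMultiplier.im_inner_eq_zero hL
  have im_k : (inner ℂ k f).im = 0 := by
    rw [← inner_conj_symm, Complex.conj_im, IsFourierMultiplier.im_inner_eq_zero hk, neg_zero]
  have im_f : (inner ℂ f f).im = 0 := inner_self_im (𝕜 := ℂ) f
  have polar := sq_mul_re_inner_positionQuot j ε f (-Complex.I • Lf)
  rw [map_smul (modulation j ε), inner_smul_right, inner_smul_right, inner_smul_left, map_neg,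
    Complex.conj_I, neg_neg] at polar
  have cast_mul (r : ℝ) (z : ℂ) : 2 * (r : ℂ) * z = ((2 * r : ℝ) : ℂ) * z := by push_cast; rfl
  rw [cast_mul, ← Complex.ofReal_pow, Complex.sub_im, Complex.sub_im, Complex.im_ofReal_mul,
    Complex.im_ofReal_mul, im_inner_modulation j ε f k, im_inner_modulation j ε f f] at commutator
  simp only [neg_mul, Complex.neg_re, Complex.I_mul_re, neg_neg] at polar
  refine mul_left_cancel₀ (pow_ne_zero 2 hε) ?_
  linear_combination polar - commutator + 2 * im_Lf - 2 * ε * im_k + ε ^ 2 * im_f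

end Kinetic

/-! ### Regularity of solutions and conservation of energy -/

theorem sobolevNorm_le_add (s : ℝ) (f g : L2 d) :
    sobolevNorm s f ≤ sobolevNorm s (f - g) + sobolevNorm s g := by
  have measurable_weighted (h : L2 d) : AEStronglyMeasurable
      (fun ξ => (sobolevWeight s ξ : ℂ) * (𝓕 h : L2 d) ξ) volume :=
    (Complex.continuous_ofReal.comp (continuous_sobolevWeight s)).aestronglyMeasurable.mul
      (Lp.memLp _).1
  have decomposition : (fun ξ => (sobolevWeight s ξ : ℂ) * (𝓕 f : L2 d) ξ) =ᵐ[volume]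
      (fun ξ => (sobolevWeight s ξ : ℂ) * (𝓕 (f - g) : L2 d) ξ) +
        fun ξ => (sobolevWeight s ξ : ℂ) * (𝓕 g : L2 d) ξ := by
    have fourier_f : (𝓕 f : L2 d) = 𝓕 (f - g) + 𝓕 g := by
      rw [← FourierTransform.fourier_add, sub_add_cancel]
    filter_upwards [Lp.coeFn_add (𝓕 (f - g) : L2 d) (𝓕 g : L2 d)] with ξ hξ
    rw [fourier_f, hξ, Pi.add_apply, Pi.add_apply, mul_add]
  exact (eLpNorm_congr_ae decomposition).trans_le
    (eLpNorm_add_le (measurable_weighted _) (measurable_weighted _) one_le_two)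

theorem IsLaplacian.norm_le {s : ℝ} (hs : 2 ≤ s) {f Lf : L2 d} (hL : IsLaplacian f Lf)
    (hf : sobolevNorm s f < ∞) : ‖Lf‖ ≤ (sobolevNorm s f).toReal := by
  rw [← Lp.norm_fourier_eq, Lp.norm_def]
  refine ENNReal.toReal_mono hf.ne (eLpNorm_mono_ae ?_)
  filter_upwards [hL] with ξ hξ
  rw [hξ, norm_mul, norm_mul, Complex.norm_real, Complex.norm_real, norm_neg,
    Real.norm_of_nonneg (by positivity), Real.norm_of_nonneg (by positivity)]
  gcongr
  linarith [show (1 + (2 * Real.pi * ‖ξ‖) ^ 2) ≤ (1 + (2 * Real.pi * ‖ξ‖) ^ 2) ^ (s / 2) from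
    one_add_sq_le_sobolevWeight hs ξ]

theorem IsFourierMultiplier.sub {m : Space d → ℝ} {f g Lf Lg : L2 d}
    (hf : IsFourierMultiplier m f Lf) (hg : IsFourierMultiplier m g Lg) :
    IsFourierMultiplier m (f - g) (Lf - Lg) := by
  have fourier_sub (a b : L2 d) : (𝓕 (a - b) : L2 d) = 𝓕 a - 𝓕 b :=
    map_sub (Lp.fourierTransformₗᵢ (Space d) ℂ) a b
  rw [IsFourierMultiplier, fourier_sub, fourier_sub]
  filter_upwards [Lp.coeFn_sub (𝓕 f : L2 d) (𝓕 g : L2 d),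
    Lp.coeFn_sub (𝓕 Lf : L2 d) (𝓕 Lg : L2 d), hf, hg] with ξ sub_fg sub_L hξf hξg
  rw [sub_fg, sub_L, Pi.sub_apply, Pi.sub_apply, hξf, hξg, mul_sub]

theorem IsLaplacian.kinetic_sub_kinetic {f g Lf Lg : L2 d} (hf : IsLaplacian f Lf)
    (hg : IsLaplacian g Lg) :
    kinetic f - kinetic g = -2 * (inner ℂ Lg (f - g)).re - (inner ℂ (Lf - Lg) (f - g)).re := by
  have re_symm (a b : L2 d) : (inner ℂ a b).re = (inner ℂ b a).re := inner_re_symm (𝕜 := ℂ) a b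
  have symm_fg : (inner ℂ Lf g).re = (inner ℂ f Lg).re := by
    rw [IsFourierMultiplier.inner_comm hf hg]
  rw [hf.kinetic_eq, hg.kinetic_eq]
  simp only [inner_sub_left, inner_sub_right, Complex.sub_re, symm_fg]
  rw [re_symm f Lf, re_symm g Lg, re_symm f Lg]
  ring

/-- The velocity `i (γ Δ f + N(f))` that the Gabitov–Turitsyn equation prescribes at the state
`f`. -/
def velocity (γ : ℝ) (p : ℕ) (f : L2 d) : L2 d :=
  Complex.I • ((γ : ℂ) • laplacian f + nonlinearity p f)

/-- The real-linear functional `h ↦ Re ⟨g, h⟩`. -/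
def reInner (g : L2 d) : L2 d →L[ℝ] ℝ :=
  Complex.reCLM.comp ((innerSL ℂ g).restrictScalars ℝ)

theorem reInner_apply (g h : L2 d) : reInner g h = (inner ℂ g h).re :=
  rfl

theorem continuousOn_windowNL {p : ℕ} {M α β : ℝ} (hαβ : α ≤ β) {v : ℝ → L2 d} {J : Set ℝ}
    (hv : ContinuousOn v J) (hM : ∀ t ∈ J, FlowBoundedOn (Icc α β) M (v t)) :
    ContinuousOn (fun t => windowNL p α β (v t)) J := by
  intro t₀ ht₀
  rw [ContinuousWithinAt, tendsto_iff_norm_sub_tendsto_zero]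
  have hlim := (tendsto_iff_norm_sub_tendsto_zero.1 (hv t₀ ht₀)).const_mul
    ((β - α) * ((p + 1) * M ^ p))
  rw [mul_zero] at hlim
  refine squeeze_zero' (Eventually.of_forall fun _ => norm_nonneg _) ?_ hlim
  filter_upwards [self_mem_nhdsWithin] with t ht
  exact norm_windowNL_sub_le hαβ (hM t ht) (hM t₀ ht₀)

theorem hasDerivWithinAt_of_abs_sub_sub_le {E : Type*} [NormedAddCommGroup E] [NormedSpace ℝ E]
    {F : E → ℝ} (A : E →L[ℝ] ℝ) {u : ℝ → E} {u' : E} {J : Set ℝ} {t₀ : ℝ} {ρ : ℝ → ℝ}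
    (hu : HasDerivWithinAt u u' J t₀) (hρ : Tendsto ρ (𝓝[J] t₀) (𝓝 0))
    (hF : ∀ t ∈ J, |F (u t) - F (u t₀) - A (u t - u t₀)| ≤ ρ t * ‖u t - u t₀‖) :
    HasDerivWithinAt (fun t => F (u t)) (A u') J t₀ := by
  have remainder : (fun t => F (u t) - F (u t₀) - A (u t - u t₀)) =o[𝓝[J] t₀] fun t => t - t₀ := by
    have bound : (fun t => F (u t) - F (u t₀) - A (u t - u t₀)) =O[𝓝[J] t₀]
        fun t => ρ t * ‖u t - u t₀‖ :=
      Asymptotics.IsBigO.of_norm_eventuallyLE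
        (by filter_upwards [self_mem_nhdsWithin] with t ht using hF t ht)
    simpa only [one_mul] using bound.trans_isLittleO
      (((Asymptotics.isLittleO_one_iff ℝ).2 hρ).mul_isBigO
        hu.differentiableWithinAt.isBigO_sub.norm_left)
  have hasDeriv_remainder : HasDerivWithinAt (fun t => F (u t) - A (u t)) 0 J t₀ := by
    refine .of_isLittleO (remainder.congr_left fun t => ?_)
    rw [map_sub, smul_zero]
    ring
  have hasDeriv_sum := hasDeriv_remainder.fun_add (A.hasFDerivAt.comp_hasDerivWithinAt t₀ hu)
  simpa only [sub_add_cancel, zero_add, Function.comp_apply] using hasDeriv_sum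

section IsSolution

variable {γ s : ℝ} {p : ℕ} {J : Set ℝ} {u : ℝ → L2 d}

theorem IsSolution.exists_flowBoundedOn (hu : IsSolution γ p s J u) (hs : (d : ℝ) / 2 < s)
    (hJ : IsCompact J) : ∃ M, 0 ≤ M ∧ ∀ t ∈ J, FlowBoundedOn univ M (u t) := by
  obtain rfl | hne := J.eq_empty_or_nonempty
  · exact ⟨0, le_rfl, fun t ht => ht.elim⟩
  have upperSemicontinuous : UpperSemicontinuousOn (fun t => sobolevNorm s (u t)) J := by
    intro t₀ ht₀ y hy
    have hlim : Tendsto (fun t => sobolevNorm s (u t - u t₀) + sobolevNorm s (u t₀)) (𝓝[J] t₀)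
        (𝓝 (sobolevNorm s (u t₀))) := by
      simpa only [zero_add] using (hu.continuous_sobolev t₀ ht₀).add_const (sobolevNorm s (u t₀))
    filter_upwards [hlim.eventually_lt_const hy] with t ht
    exact (sobolevNorm_le_add s (u t) (u t₀)).trans_lt ht
  obtain ⟨t₀, ht₀, hmax⟩ := upperSemicontinuous.exists_isMaxOn hne hJ
  obtain ⟨M, hM, hbound⟩ := exists_flowBoundedOn_of_sobolevNorm_le hs (hu.mem_sobolev t₀ ht₀).ne
  exact ⟨M, hM, fun t ht => hbound (u t) (hmax ht)⟩

theorem IsSolution.hasDerivWithinAt (hu : IsSolution γ p s J u) {t : ℝ} (ht : t ∈ J) :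
    HasDerivWithinAt u (velocity γ p (u t)) J t := by
  obtain ⟨u', hderiv, heq⟩ := hu.equation t ht
  have hu' : u' = velocity γ p (u t) := by
    rw [add_assoc] at heq
    rw [velocity, ← neg_eq_of_add_eq_zero_right heq, smul_neg, smul_smul, Complex.I_mul_I,
      neg_one_smul, neg_neg]
  exact hu' ▸ hderiv

theorem IsSolution.continuousOn (hu : IsSolution γ p s J u) : ContinuousOn u J :=
  fun _ ht => (hu.hasDerivWithinAt ht).continuousWithinAt

theorem IsSolution.isLaplacian (hu : IsSolution γ p s J u) (hs : 2 ≤ s) {t : ℝ} (ht : t ∈ J) :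
    IsLaplacian (u t) (laplacian (u t)) :=
  isLaplacian_laplacian hs (hu.mem_sobolev t ht)

theorem IsSolution.continuousOn_laplacian (hu : IsSolution γ p s J u) (hs : 2 ≤ s) :
    ContinuousOn (fun t => laplacian (u t)) J := by
  intro t₀ ht₀
  rw [ContinuousWithinAt, tendsto_iff_norm_sub_tendsto_zero]
  have hlim := hu.continuous_sobolev t₀ ht₀
  refine squeeze_zero' (Eventually.of_forall fun _ => norm_nonneg _) ?_
    ((ENNReal.tendsto_toReal ENNReal.zero_ne_top).comp hlim)
  filter_upwards [self_mem_nhdsWithin, hlim.eventually_lt_const ENNReal.zero_lt_top]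
    with t ht hfin
  exact IsLaplacian.norm_le hs (IsFourierMultiplier.sub (hu.isLaplacian hs ht)
    (hu.isLaplacian hs ht₀)) hfin

theorem IsSolution.hasDerivWithinAt_kinetic (hu : IsSolution γ p s J u) (hs : 2 ≤ s) {t₀ : ℝ}
    (ht₀ : t₀ ∈ J) : HasDerivWithinAt (fun t => kinetic (u t))
      (-2 * (inner ℂ (laplacian (u t₀)) (velocity γ p (u t₀))).re) J t₀ := by
  have hlim := tendsto_iff_norm_sub_tendsto_zero.1 (hu.continuousOn_laplacian hs t₀ ht₀)
  refine hasDerivWithinAt_of_abs_sub_sub_le ((-2 : ℝ) • reInner (laplacian (u t₀)))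
    (hu.hasDerivWithinAt ht₀) hlim fun t ht => ?_
  rw [(hu.isLaplacian hs ht).kinetic_sub_kinetic (hu.isLaplacian hs ht₀)]
  simp only [_root_.smul_apply, reInner_apply, smul_eq_mul]
  rw [sub_sub_cancel_left, abs_neg]
  exact (Complex.abs_re_le_norm _).trans (norm_inner_le_norm _ _)

theorem IsSolution.hasDerivWithinAt_potential (hu : IsSolution γ p s J u) {M : ℝ}
    (hM : ∀ t ∈ J, FlowBoundedOn univ M (u t)) {t₀ : ℝ} (ht₀ : t₀ ∈ J) :
    HasDerivWithinAt (fun t => potential p (u t))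
      ((p + 2) * (inner ℂ (nonlinearity p (u t₀)) (velocity γ p (u t₀))).re) J t₀ := by
  obtain ⟨C, -, taylor⟩ := exists_windowPotential_taylor_bound (d := d) p M zero_le_one
  have hlim := (tendsto_iff_norm_sub_tendsto_zero.1 (hu.continuousOn t₀ ht₀)).const_mul C
  rw [mul_zero] at hlim
  refine hasDerivWithinAt_of_abs_sub_sub_le (((p : ℝ) + 2) • reInner (nonlinearity p (u t₀)))
    (hu.hasDerivWithinAt ht₀) hlim fun t ht => ?_
  rw [mul_assoc, ← sq]
  exact taylor (u t₀) (u t) ((hM t₀ ht₀).mono (subset_univ _) le_rfl)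
    ((hM t ht).mono (subset_univ _) le_rfl)

theorem re_inner_velocity (γ : ℝ) (p : ℕ) (f : L2 d) :
    γ * (inner ℂ (laplacian f) (velocity γ p f)).re +
      (inner ℂ (nonlinearity p f) (velocity γ p f)).re = 0 := by
  have orthogonal :
      (inner ℂ ((γ : ℂ) • laplacian f + nonlinearity p f) (velocity γ p f)).re = 0 := by
    rw [velocity, inner_smul_right, Complex.I_mul_re, neg_eq_zero]
    exact inner_self_im (𝕜 := ℂ) _
  rwa [inner_add_left, inner_smul_left, Complex.conj_ofReal, Complex.add_re,
    Complex.re_ofReal_mul] at orthogonal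

theorem IsSolution.hasDerivWithinAt_energy (hu : IsSolution γ p s J u) (hs : 2 ≤ s) {M : ℝ}
    (hM : ∀ t ∈ J, FlowBoundedOn univ M (u t)) {t : ℝ} (ht : t ∈ J) :
    HasDerivWithinAt (fun t => energy γ p (u t)) 0 J t := by
  refine (((hu.hasDerivWithinAt_kinetic hs ht).const_mul (-(γ / 2))).add
    ((hu.hasDerivWithinAt_potential hM ht).const_mul (1 / ((p : ℝ) + 2)))).congr_deriv ?_
  have hp : (p : ℝ) + 2 ≠ 0 := by positivity
  rw [← re_inner_velocity γ p (u t)]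
  field_simp

end IsSolution

theorem IsSolution.energy_eq {γ s a b : ℝ} {p : ℕ} {u : ℝ → L2 d}
    (hu : IsSolution γ p s (Icc a b) u) (hs : 2 ≤ s) {M : ℝ}
    (hM : ∀ t ∈ Icc a b, FlowBoundedOn univ M (u t)) {t : ℝ} (ht : t ∈ Icc a b) :
    energy γ p (u t) = energy γ p (u b) := by
  have hderiv := fun t ht => hu.hasDerivWithinAt_energy hs hM (t := t) ht
  have hconst := constant_of_derivWithin_zero (fun t ht => (hderiv t ht).differentiableWithinAt)
    fun t ht => (hderiv t (Ico_subset_Icc_self ht)).derivWithin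
      (uniqueDiffOn_Icc (ht.1.trans_lt ht.2) t (Ico_subset_Icc_self ht))
  exact (hconst t ht).trans (hconst b ⟨ht.1.trans ht.2, le_rfl⟩).symm

theorem potential_nonneg (p : ℕ) (f : L2 d) : 0 ≤ potential p f :=
  intervalIntegral.integral_nonneg zero_le_one fun _ _ => lpMass_nonneg p _

theorem energy_neg_one (p : ℕ) (f : L2 d) :
    energy (-1) p f = kinetic f / 2 + potential p f / (p + 2) := by
  rw [energy]
  ring

theorem energy_neg_one_nonneg (p : ℕ) (f : L2 d) : 0 ≤ energy (-1) p f := by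
  have := kinetic_nonneg f
  have := potential_nonneg p f
  rw [energy_neg_one]
  positivity

theorem kinetic_le_two_mul_energy (p : ℕ) (f : L2 d) : kinetic f ≤ 2 * energy (-1) p f := by
  have : 0 ≤ potential p f / (p + 2) := div_nonneg (potential_nonneg p f) (by positivity)
  rw [energy_neg_one]
  linarith

theorem potential_div_le_energy_neg_one (p : ℕ) (f : L2 d) :
    potential p f / (p + 2) ≤ energy (-1) p f := by
  rw [energy_neg_one]
  linarith [kinetic_nonneg f]

theorem energy_neg_one_le_potential {p : ℕ} {f : L2 d} (h : kinetic f ≤ potential p f) :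
    energy (-1) p f ≤ potential p f := by
  have : potential p f / (p + 2) ≤ potential p f / 2 := by
    gcongr
    exacts [potential_nonneg p f, le_add_of_nonneg_left p.cast_nonneg]
  rw [energy_neg_one]
  linarith

/-! ### Evolution of the position observables -/

section PositionQuot

variable {j : Fin d} {ε κ : ℝ} {f N Lf k : L2 d}

theorem two_mul_re_inner_positionQuot_velocity (hL : IsLaplacian f Lf) (hk : IsMomentum j f k)
    (hε : ε ≠ 0) (N : L2 d) :
    2 * (inner ℂ (positionQuot j ε f) (positionQuot j ε (Complex.I • (N - Lf)))).re =
      2 * ε * (inner ℂ f (positionQuot j ε f)).re - 4 * (inner ℂ k (positionQuot j ε f)).re -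
        2 * (inner ℂ (positionQuot j ε f) (positionQuot j ε N)).im := by
  have velocity_eq : Complex.I • (N - Lf) = -Complex.I • Lf + Complex.I • N := by module
  rw [velocity_eq, map_add, inner_add_right, Complex.add_re,
    re_inner_positionQuot_laplacian hL hk hε, map_smul _ Complex.I N, inner_smul_right,
    Complex.I_mul_re]
  ring

theorem abs_two_mul_re_inner_positionQuot_velocity_le (hL : IsLaplacian f Lf)
    (hk : IsMomentum j f k) (hε : ε ∈ Ioc 0 1) (hfκ : ‖f‖ ≤ κ) (hkκ : ‖k‖ ≤ κ) {Λ : ℝ}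
    (hN : ‖positionQuot j ε N‖ ≤ Λ * ‖positionQuot j ε f‖) :
    |2 * (inner ℂ (positionQuot j ε f) (positionQuot j ε (Complex.I • (N - Lf)))).re| ≤
      6 * κ * ‖positionQuot j ε f‖ + 2 * Λ * ‖positionQuot j ε f‖ ^ 2 := by
  rw [two_mul_re_inner_positionQuot_velocity hL hk hε.1.ne']
  set Q := positionQuot j ε f
  have bound_mass : |ε * (inner ℂ f Q).re| ≤ κ * ‖Q‖ := by
    rw [abs_mul, abs_of_pos hε.1]
    calc ε * |(inner ℂ f Q).re| ≤ 1 * (‖f‖ * ‖Q‖) := by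
          gcongr
          exacts [hε.2, (Complex.abs_re_le_norm _).trans (norm_inner_le_norm _ _)]
      _ ≤ κ * ‖Q‖ := by rw [one_mul]; gcongr
  have bound_momentum : |(inner ℂ k Q).re| ≤ κ * ‖Q‖ :=
    ((Complex.abs_re_le_norm _).trans (norm_inner_le_norm _ _)).trans (by gcongr)
  have bound_nonlinear : |(inner ℂ Q (positionQuot j ε N)).im| ≤ Λ * ‖Q‖ ^ 2 :=
    calc |(inner ℂ Q (positionQuot j ε N)).im| ≤ ‖Q‖ * ‖positionQuot j ε N‖ :=
          (Complex.abs_im_le_norm _).trans (norm_inner_le_norm _ _)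
      _ ≤ ‖Q‖ * (Λ * ‖Q‖) := by gcongr
      _ = Λ * ‖Q‖ ^ 2 := by ring
  rw [abs_le] at *
  constructor <;> linarith

end PositionQuot

theorem hasDerivWithinAt_norm_sq_apply (Q : L2 d →L[ℂ] L2 d) {J : Set ℝ} {v : ℝ → L2 d}
    {v' : L2 d} {t : ℝ} (hv : HasDerivWithinAt v v' J t) :
    HasDerivWithinAt (fun t => ‖Q (v t)‖ ^ 2) (2 * (inner ℂ (Q (v t)) (Q v')).re) J t := by
  have hQv : HasDerivWithinAt (fun t => Q (v t)) (Q v') J t :=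
    (Q.restrictScalars ℝ).hasFDerivAt.comp_hasDerivWithinAt t hv
  let _ : InnerProductSpace ℝ (L2 d) := InnerProductSpace.rclikeToReal ℂ (L2 d)
  exact hQv.norm_sq

theorem norm_le_gronwallBound_of_norm_deriv_left_le {E : Type*} [NormedAddCommGroup E]
    [NormedSpace ℝ E] {f f' : ℝ → E} {a b δ K ε : ℝ}
    (hf : ∀ t ∈ Icc a b, HasDerivWithinAt f (f' t) (Icc a b) t) (hb : ‖f b‖ ≤ δ)
    (bound : ∀ t ∈ Icc a b, ‖f' t‖ ≤ K * ‖f t‖ + ε) {t : ℝ} (ht : t ∈ Icc a b) :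
    ‖f t‖ ≤ gronwallBound δ K ε (b - t) := by
  have reflect : MapsTo (fun x => -x) (Icc (-b) (-a)) (Icc a b) := fun x hx =>
    ⟨le_neg_of_le_neg hx.2, neg_le.1 hx.1⟩
  have hderiv (x : ℝ) (hx : x ∈ Icc (-b) (-a)) :
      HasDerivWithinAt (fun x => f (-x)) (-f' (-x)) (Icc (-b) (-a)) x := by
    have chain := (hf (-x) (reflect hx)).scomp x (hasDerivAt_neg x).hasDerivWithinAt reflect
    rwa [neg_one_smul] at chain
  have gronwall := norm_le_gronwallBound_of_norm_deriv_right_le (δ := δ) (K := K) (ε := ε)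
    (fun x hx => (hderiv x hx).continuousWithinAt)
    (fun x hx => (hderiv x (Ico_subset_Icc_self hx)).mono_of_mem_nhdsWithin
      (Icc_mem_nhdsGE_of_mem hx)) (by rwa [neg_neg])
    (fun x hx => by rw [norm_neg]; exact bound _ (reflect (Ico_subset_Icc_self hx)))
    (-t) ⟨neg_le_neg ht.2, neg_le_neg ht.1⟩
  rwa [neg_neg, neg_sub_neg] at gronwall

/-- `v` solves `v_t = i (N(v) - Δ v)` on `J`, where `N` is the nonlinearity averaged over the window
`[α, β]`, with Laplacian `L` and momenta `P j`, and with uniform bounds: `κ` for the `L²` norms of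
`v` and of its momenta, `M` for the `L^∞` norm of its free evolution. Applying `e^{iaΔ}` to a
solution of the Gabitov–Turitsyn equation gives such a flow with the window `[-a, 1 - a]`. -/
structure IsBoundedWindowFlow (p : ℕ) (α β M κ : ℝ) (J : Set ℝ) (v L : ℝ → L2 d)
    (P : Fin d → ℝ → L2 d) : Prop where
  window_le : α ≤ β
  bound_nonneg : 0 ≤ M
  hasDerivWithinAt : ∀ t ∈ J,
    HasDerivWithinAt v (Complex.I • (windowNL p α β (v t) - L t)) J t
  continuousOn_laplacian : ContinuousOn L J
  isLaplacian : ∀ t ∈ J, IsLaplacian (v t) (L t)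
  isMomentum : ∀ j, ∀ t ∈ J, IsMomentum j (v t) (P j t)
  flowBoundedOn : ∀ t ∈ J, FlowBoundedOn univ M (v t)
  norm_le : ∀ t ∈ J, ‖v t‖ ≤ κ
  norm_momentum_le : ∀ j, ∀ t ∈ J, ‖P j t‖ ≤ κ

namespace IsBoundedWindowFlow

variable {p : ℕ} {α β M κ a b : ℝ} {J : Set ℝ} {v L : ℝ → L2 d} {P : Fin d → ℝ → L2 d}
  {j : Fin d} {t : ℝ}

theorem mono (hv : IsBoundedWindowFlow p α β M κ J v L P) {I : Set ℝ} (hI : I ⊆ J) :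
    IsBoundedWindowFlow p α β M κ I v L P where
  window_le := hv.window_le
  bound_nonneg := hv.bound_nonneg
  hasDerivWithinAt t ht := (hv.hasDerivWithinAt t (hI ht)).mono hI
  continuousOn_laplacian := hv.continuousOn_laplacian.mono hI
  isLaplacian t ht := hv.isLaplacian t (hI ht)
  isMomentum j t ht := hv.isMomentum j t (hI ht)
  flowBoundedOn t ht := hv.flowBoundedOn t (hI ht)
  norm_le t ht := hv.norm_le t (hI ht)
  norm_momentum_le j t ht := hv.norm_momentum_le j t (hI ht)

theorem freeProp (hv : IsBoundedWindowFlow p α β M κ J v L P) (a : ℝ) :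
    IsBoundedWindowFlow p (α - a) (β - a) M κ J (fun t => freeProp a (v t))
      (fun t => freeProp a (L t)) (fun j t => freeProp a (P j t)) where
  window_le := sub_le_sub_right hv.window_le a
  bound_nonneg := hv.bound_nonneg
  hasDerivWithinAt t ht := by
    have velocity_eq : GabitovTuritsyn.freeProp a (Complex.I • (windowNL p α β (v t) - L t)) =
        Complex.I • (windowNL p (α - a) (β - a) (GabitovTuritsyn.freeProp a (v t)) -
          GabitovTuritsyn.freeProp a (L t)) := by
      rw [freeProp_smul, freeProp_sub, freeProp_windowNL hv.window_le
        ((hv.flowBoundedOn t ht).mono (subset_univ _) le_rfl)]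
    rw [← velocity_eq]
    simp only [← freePropIsometry_apply]
    exact ((freePropIsometry a).toContinuousLinearMap.restrictScalars
      ℝ).hasFDerivAt.comp_hasDerivWithinAt t (hv.hasDerivWithinAt t ht)
  continuousOn_laplacian := by
    simpa only [Function.comp_def, freePropIsometry_apply] using
      (freePropIsometry a).continuous.comp_continuousOn hv.continuousOn_laplacian
  isLaplacian t ht := IsFourierMultiplier.freeProp (hv.isLaplacian t ht) a
  isMomentum j t ht := IsFourierMultiplier.freeProp (hv.isMomentum j t ht) a
  flowBoundedOn t ht := (hv.flowBoundedOn t ht).freeProp a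
  norm_le t ht := (norm_freeProp a _).trans_le (hv.norm_le t ht)
  norm_momentum_le j t ht := (norm_freeProp a _).trans_le (hv.norm_momentum_le j t ht)

theorem flowBoundedOn_Icc (hv : IsBoundedWindowFlow p α β M κ J v L P) (ht : t ∈ J) :
    FlowBoundedOn (Icc α β) M (v t) :=
  (hv.flowBoundedOn t ht).mono (subset_univ _) le_rfl

theorem continuousOn (hv : IsBoundedWindowFlow p α β M κ J v L P) : ContinuousOn v J :=
  fun t ht => (hv.hasDerivWithinAt t ht).continuousWithinAt

theorem abs_deriv_norm_sq_positionQuot_le (hv : IsBoundedWindowFlow p α β M κ J v L P)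
    (ht : t ∈ J) (j : Fin d) {ε : ℝ} (hε : ε ∈ Ioc 0 1) :
    |2 * (inner ℂ (positionQuot j ε (v t))
        (positionQuot j ε (Complex.I • (windowNL p α β (v t) - L t)))).re| ≤
      6 * κ * ‖positionQuot j ε (v t)‖ +
        2 * ((β - α) * ((p + 1) * M ^ p)) * ‖positionQuot j ε (v t)‖ ^ 2 :=
  abs_two_mul_re_inner_positionQuot_velocity_le (hv.isLaplacian t ht) (hv.isMomentum j t ht) hε
    (hv.norm_le t ht) (hv.norm_momentum_le j t ht)
    (norm_positionQuot_windowNL_le hv.window_le (hv.flowBoundedOn_Icc ht) j ε)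

theorem abs_deriv_norm_sq_positionQuot_le_of_isPosition
    (hv : IsBoundedWindowFlow p α β M κ J v L P) (ht : t ∈ J) {X : L2 d} {C : ℝ}
    (hX : IsPosition j (v t) X) (hXC : ‖X‖ ≤ C) {ε : ℝ} (hε : ε ∈ Ioc 0 1) :
    |2 * (inner ℂ (positionQuot j ε (v t))
        (positionQuot j ε (Complex.I • (windowNL p α β (v t) - L t)))).re| ≤
      6 * κ * C + 2 * ((β - α) * ((p + 1) * M ^ p)) * C ^ 2 := by
  have hM := hv.bound_nonneg
  have hwindow := sub_nonneg.2 hv.window_le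
  have hκ : 0 ≤ κ := (norm_nonneg _).trans (hv.norm_le t ht)
  have hQ : ‖positionQuot j ε (v t)‖ ≤ C := (hX.norm_positionQuot_le ε).trans hXC
  exact (hv.abs_deriv_norm_sq_positionQuot_le ht j hε).trans (by gcongr)

theorem exists_isPosition (hv : IsBoundedWindowFlow p α β M κ (Icc a b) v L P) {X₀ : L2 d}
    (hX₀ : IsPosition j (v b) X₀) :
    ∃ C, ∀ t ∈ Icc a b, ∃ X : L2 d, IsPosition j (v t) X ∧ ‖X‖ ≤ C := by
  have hM := hv.bound_nonneg
  set Λ := (β - α) * ((p + 1) * M ^ p) with hΛ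
  have hΛ₀ : 0 ≤ Λ := mul_nonneg (sub_nonneg.2 hv.window_le) (by positivity)
  refine ⟨√(gronwallBound (‖X₀‖ ^ 2) (1 + 2 * Λ) (9 * κ ^ 2) (b - a)), fun t ht =>
    exists_isPosition_norm_le ?_⟩
  filter_upwards [Ioc_mem_nhdsGT one_pos] with ε hε
  have gronwall := norm_le_gronwallBound_of_norm_deriv_left_le (δ := ‖X₀‖ ^ 2) (K := 1 + 2 * Λ)
    (ε := 9 * κ ^ 2)
    (fun t ht => hasDerivWithinAt_norm_sq_apply (positionQuot j ε) (hv.hasDerivWithinAt t ht))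
    ?_ ?_ ht
  · rw [Real.norm_of_nonneg (by positivity)] at gronwall
    exact Real.le_sqrt_of_sq_le (gronwall.trans
      (gronwallBound_mono (by positivity) (by positivity) (by positivity) (by linarith [ht.1])))
  · rw [Real.norm_of_nonneg (by positivity)]
    gcongr
    exact hX₀.norm_positionQuot_le ε
  · intro t ht
    have bound := hv.abs_deriv_norm_sq_positionQuot_le ht j hε
    rw [← hΛ] at bound
    rw [Real.norm_eq_abs, Real.norm_of_nonneg (by positivity)]
    nlinarith [sq_nonneg (3 * κ - ‖positionQuot j ε (v t)‖)]

theorem continuousOn_deriv_norm_sq_positionQuot (hv : IsBoundedWindowFlow p α β M κ J v L P)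
    (j : Fin d) (ε : ℝ) :
    ContinuousOn (fun t => 2 * (inner ℂ (positionQuot j ε (v t))
      (positionQuot j ε (Complex.I • (windowNL p α β (v t) - L t)))).re) J := by
  have hN := continuousOn_windowNL (p := p) hv.window_le hv.continuousOn fun t ht =>
    hv.flowBoundedOn_Icc ht
  exact continuousOn_const.mul (Complex.continuous_re.comp_continuousOn
    (((positionQuot j ε).continuous.comp_continuousOn hv.continuousOn).inner (𝕜 := ℂ)
      ((positionQuot j ε).continuous.comp_continuousOn
        ((hN.sub hv.continuousOn_laplacian).const_smul Complex.I))))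

theorem tendsto_deriv_norm_sq_positionQuot (hv : IsBoundedWindowFlow p α β M κ J v L P)
    (ht : t ∈ J) {X Y : L2 d} (hX : IsPosition j (v t) X)
    (hY : IsPosition j (windowNL p α β (v t)) Y) :
    Tendsto (fun ε => 2 * (inner ℂ (positionQuot j ε (v t))
      (positionQuot j ε (Complex.I • (windowNL p α β (v t) - L t)))).re) (𝓝[>] 0)
      (𝓝 (-(4 * (inner ℂ (P j t) X).re + 2 * (inner ℂ X Y).im))) := by
  have hε : Tendsto (fun ε : ℝ => ε) (𝓝[>] 0) (𝓝 0) := nhdsWithin_le_nhds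
  have hQX := hX.tendsto_positionQuot.mono_left (nhdsWithin_mono 0 fun _ => ne_of_gt)
  have hQY := hY.tendsto_positionQuot.mono_left (nhdsWithin_mono 0 fun _ => ne_of_gt)
  have hre (f : L2 d) := Complex.continuous_re.continuousAt.tendsto.comp
    ((tendsto_const_nhds (x := f)).inner hQX (𝕜 := ℂ))
  have him := Complex.continuous_im.continuousAt.tendsto.comp (hQX.inner hQY (𝕜 := ℂ))
  have hlim := (((hε.const_mul 2).mul (hre (v t))).sub ((hre (P j t)).const_mul 4)).sub
    (him.const_mul 2)
  rw [mul_zero, zero_mul, zero_sub, ← neg_add'] at hlim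
  refine hlim.congr' ?_
  filter_upwards [self_mem_nhdsWithin] with ε hε
  exact (two_mul_re_inner_positionQuot_velocity (hv.isLaplacian t ht) (hv.isMomentum j t ht)
    (ne_of_gt hε) _).symm

theorem integral_deriv_norm_sq_positionQuot
    (hv : IsBoundedWindowFlow p α β M κ (Icc a b) v L P) (hab : a ≤ b) (j : Fin d) (ε : ℝ) :
    ∫ t in a..b, 2 * (inner ℂ (positionQuot j ε (v t))
      (positionQuot j ε (Complex.I • (windowNL p α β (v t) - L t)))).re =
      ‖positionQuot j ε (v b)‖ ^ 2 - ‖positionQuot j ε (v a)‖ ^ 2 := by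
  have hderiv (t) (ht : t ∈ Icc a b) :=
    hasDerivWithinAt_norm_sq_apply (positionQuot j ε) (hv.hasDerivWithinAt t ht)
  exact intervalIntegral.integral_eq_sub_of_hasDerivAt_of_le hab
    (fun t ht => (hderiv t ht).continuousWithinAt)
    (fun t ht => (hderiv t (Ioo_subset_Icc_self ht)).hasDerivAt (Icc_mem_nhds ht.1 ht.2))
    ((hv.continuousOn_deriv_norm_sq_positionQuot j ε).intervalIntegrable_of_Icc hab)

theorem norm_sq_isPosition_sub (hv : IsBoundedWindowFlow p α β M κ (Icc a b) v L P) (hab : a ≤ b)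
    {X Y : ℝ → L2 d} {C : ℝ} (hX : ∀ t ∈ Icc a b, IsPosition j (v t) (X t))
    (hXC : ∀ t ∈ Icc a b, ‖X t‖ ≤ C)
    (hY : ∀ t ∈ Icc a b, IsPosition j (windowNL p α β (v t)) (Y t)) :
    IntervalIntegrable (fun t => 4 * (inner ℂ (P j t) (X t)).re + 2 * (inner ℂ (X t) (Y t)).im)
        volume a b ∧
      ‖X a‖ ^ 2 - ‖X b‖ ^ 2 =
        ∫ t in a..b, (4 * (inner ℂ (P j t) (X t)).re + 2 * (inner ℂ (X t) (Y t)).im) := by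
  have hsub : uIoc a b ⊆ Icc a b := uIoc_of_le hab ▸ Ioc_subset_Icc_self
  have hab_ae : ∀ᵐ t ∂volume.restrict (uIoc a b), t ∈ Icc a b :=
    (ae_restrict_mem measurableSet_uIoc).mono fun t ht => hsub ht
  have hmeas (ε : ℝ) := (hv.continuousOn_deriv_norm_sq_positionQuot j ε).intervalIntegrable_of_Icc
    (μ := volume) hab |>.def'.aestronglyMeasurable
  have hlim (t) (ht : t ∈ Icc a b) :=
    hv.tendsto_deriv_norm_sq_positionQuot ht (hX t ht) (hY t ht)
  have hbound {ε : ℝ} (hε : ε ∈ Ioc 0 1) (t) (ht : t ∈ Icc a b) :=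
    hv.abs_deriv_norm_sq_positionQuot_le_of_isPosition ht (hX t ht) (hXC t ht) hε
  have hε : ∀ᶠ ε : ℝ in 𝓝[>] 0, ε ∈ Ioc 0 1 := Ioc_mem_nhdsGT one_pos
  have hint : IntervalIntegrable
      (fun t => -(4 * (inner ℂ (P j t) (X t)).re + 2 * (inner ℂ (X t) (Y t)).im)) volume a b := by
    refine (intervalIntegrable_const (c := 6 * κ * C + 2 * ((β - α) * ((p + 1) * M ^ p)) * C ^ 2)
      ).mono_fun'
      (aestronglyMeasurable_of_tendsto_ae (𝓝[>] 0) hmeas (hab_ae.mono hlim)) ?_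
    filter_upwards [hab_ae] with t ht
    exact le_of_tendsto (hlim t ht).norm (hε.mono fun ε hε => hbound hε t ht)
  have hlim_integral := intervalIntegral.tendsto_integral_filter_of_dominated_convergence _
    (Eventually.of_forall hmeas)
    (hε.mono fun ε hε => Eventually.of_forall fun t ht => hbound hε t (hsub ht))
    intervalIntegrable_const (Eventually.of_forall fun t ht => hlim t (hsub ht))
  have hlim_norm (t) (ht : t ∈ Icc a b) :
      Tendsto (fun ε => ‖positionQuot j ε (v t)‖ ^ 2) (𝓝[>] 0) (𝓝 (‖X t‖ ^ 2)) :=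
    ((hX t ht).tendsto_positionQuot.mono_left (nhdsWithin_mono 0 fun _ => ne_of_gt)).norm.pow 2
  have increment_eq := tendsto_nhds_unique hlim_integral
    (((hlim_norm b (right_mem_Icc.2 hab)).sub (hlim_norm a (left_mem_Icc.2 hab))).congr
      fun ε => (hv.integral_deriv_norm_sq_positionQuot hab j ε).symm)
  rw [intervalIntegral.integral_neg] at increment_eq
  exact ⟨by simpa only [Pi.neg_def, neg_neg] using hint.neg, by linarith⟩

end IsBoundedWindowFlow

/-! ### The virial identities -/

theorem integral_window_mul_lpMass_freeProp (p : ℕ) (f : L2 d) (a : ℝ) :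
    ∫ σ in (0 - a)..(1 - a), σ * lpMass p (freeProp σ (freeProp a f)) =
      ∫ σ in (0 : ℝ)..1, (σ - a) * lpMass p (freeProp σ f) := by
  rw [← intervalIntegral.integral_comp_sub_right
    (fun σ => σ * lpMass p (freeProp σ (freeProp a f))) a]
  simp only [freeProp_freeProp, sub_add_cancel]

theorem sum_im_inner_windowNL_freeProp {p : ℕ} {M : ℝ} {f : L2 d} (hf : FlowBoundedOn univ M f)
    (a : ℝ) {X Y : Fin d → L2 d} (hX : ∀ j, IsPosition j (freeProp a f) (X j))
    (hY : ∀ j, IsPosition j (windowNL p (0 - a) (1 - a) (freeProp a f)) (Y j)) :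
    (p + 2) * ∑ j, (inner ℂ (X j) (Y j)).im =
      4 * a ^ 2 * lpMass p f - 4 * (1 - a) ^ 2 * lpMass p (freeProp 1 f) -
        (2 * d * p - 8) * ∫ σ in (0 : ℝ)..1, (σ - a) * lpMass p (freeProp σ f) := by
  rw [sum_im_inner_windowNL (hf.freeProp a) (sub_le_sub_right zero_le_one a) hX hY,
    integral_window_mul_lpMass_freeProp, freeProp_freeProp, freeProp_freeProp, sub_add_cancel,
    sub_add_cancel, freeProp_zero]
  ring

/-- The derivative of `t ↦ -‖x e^{iaΔ} u(t)‖²` along the flow, where `A` stands for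
`Re ⟨-i∇u, x u⟩`. -/
def virialDensity (p : ℕ) (a A : ℝ) (f : L2 d) : ℝ :=
  4 * A + 8 * a * kinetic f + 2 / (p + 2) *
    (4 * a ^ 2 * lpMass p f - 4 * (1 - a) ^ 2 * lpMass p (freeProp 1 f) -
      (2 * d * p - 8) * ∫ σ in (0 : ℝ)..1, (σ - a) * lpMass p (freeProp σ f))

theorem virialDensity_eq {p : ℕ} {M : ℝ} {f : L2 d} (hf : FlowBoundedOn univ M f)
    (a : ℝ) {P X Y : Fin d → L2 d} (hP : ∀ j, IsMomentum j f (P j))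
    (hX : ∀ j, IsPosition j (freeProp a f) (freeProp a (X j + (2 * a) • P j)))
    (hY : ∀ j, IsPosition j (windowNL p (0 - a) (1 - a) (freeProp a f)) (Y j)) :
    virialDensity p a (∑ j, (inner ℂ (P j) (X j)).re) f =
      ∑ j, (4 * (inner ℂ (freeProp a (P j)) (freeProp a (X j + (2 * a) • P j))).re +
        2 * (inner ℂ (freeProp a (X j + (2 * a) • P j)) (Y j)).im) := by
  have re_inner_position (j : Fin d) :
      (inner ℂ (freeProp a (P j)) (freeProp a (X j + (2 * a) • P j))).re =
        (inner ℂ (P j) (X j)).re + 2 * a * ‖P j‖ ^ 2 := by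
    rw [inner_freeProp, inner_add_right, inner_smul_right_eq_smul, Complex.add_re,
      Complex.smul_re, smul_eq_mul, ← inner_self_eq_norm_sq (𝕜 := ℂ)]
    rfl
  simp only [re_inner_position, mul_add, Finset.sum_add_distrib, ← Finset.mul_sum]
  have hp : (p : ℝ) + 2 ≠ 0 := by positivity
  rw [virialDensity, ← sum_im_inner_windowNL_freeProp hf a hX hY, kinetic_eq_sum_norm_sq hP]
  field_simp
  ring

theorem virialDensity_zero_le {p : ℕ} (hdp : 4 ≤ d * p) (A : ℝ) (f : L2 d) :
    virialDensity p 0 A f ≤ 4 * A := by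
  have hdp' : (4 : ℝ) ≤ d * p := mod_cast hdp
  have hI : 0 ≤ ∫ σ in (0 : ℝ)..1, (σ - 0) * lpMass p (freeProp σ f) :=
    intervalIntegral.integral_nonneg zero_le_one fun σ hσ =>
      mul_nonneg (sub_nonneg.2 hσ.1) (lpMass_nonneg _ _)
  have hF := lpMass_nonneg p (freeProp 1 f)
  have potential_term : 2 / ((p : ℝ) + 2) * (4 * 0 ^ 2 * lpMass p f -
      4 * (1 - 0) ^ 2 * lpMass p (freeProp 1 f) -
      (2 * d * p - 8) * ∫ σ in (0 : ℝ)..1, (σ - 0) * lpMass p (freeProp σ f)) ≤ 0 :=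
    mul_nonpos_of_nonneg_of_nonpos (by positivity) (by nlinarith)
  rw [virialDensity]
  linarith

theorem virialDensity_one_sub_virialDensity_neg_one {p : ℕ} {M : ℝ} {f : L2 d}
    (hf : FlowBoundedOn univ M f) (A : ℝ) :
    virialDensity p 1 A f - virialDensity p (-1) A f = 16 * kinetic f +
      (32 * lpMass p (freeProp 1 f) + (8 * d * p - 32) * potential p f) / (p + 2) := by
  have hint (a : ℝ) :
      IntervalIntegrable (fun σ => (σ - a) * lpMass p (freeProp σ f)) volume 0 1 :=
    ((continuous_id.sub continuous_const).mul
      (continuousOn_univ.1 (hf.continuousOn_lpMass p))).intervalIntegrable 0 1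
  have integral_sub : (∫ σ in (0 : ℝ)..1, (σ - -1) * lpMass p (freeProp σ f)) -
      ∫ σ in (0 : ℝ)..1, (σ - 1) * lpMass p (freeProp σ f) = 2 * potential p f := by
    rw [← intervalIntegral.integral_sub (hint (-1)) (hint 1), potential,
      ← intervalIntegral.integral_const_mul]
    refine intervalIntegral.integral_congr fun σ _ => ?_
    simp only [lpMass]
    ring
  rw [virialDensity, virialDensity]
  linear_combination (2 * (2 * d * p - 8) / ((p : ℝ) + 2)) * integral_sub

theorem le_virialDensity_sub {p : ℕ} (hdp : 8 ≤ d * p) {M : ℝ} {f : L2 d}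
    (hf : FlowBoundedOn univ M f) (A : ℝ) :
    32 * energy (-1) p f ≤ virialDensity p 1 A f - virialDensity p (-1) A f := by
  have hdp' : (8 : ℝ) ≤ d * p := mod_cast hdp
  have hF := lpMass_nonneg p (freeProp 1 f)
  have hU := potential_nonneg p f
  calc 32 * energy (-1) p f = 16 * kinetic f + 32 * potential p f / (p + 2) := by
        rw [energy_neg_one]
        ring
    _ ≤ 16 * kinetic f +
        (32 * lpMass p (freeProp 1 f) + (8 * d * p - 32) * potential p f) / (p + 2) := by
      gcongr
      nlinarith
    _ = virialDensity p 1 A f - virialDensity p (-1) A f :=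
      (virialDensity_one_sub_virialDensity_neg_one hf A).symm

theorem sum_re_inner_sq_le (P X : Fin d → L2 d) :
    (∑ j, (inner ℂ (P j) (X j)).re) ^ 2 ≤ (∑ j, ‖X j‖ ^ 2) * ∑ j, ‖P j‖ ^ 2 := by
  have abs_le : |∑ j, (inner ℂ (P j) (X j)).re| ≤ ∑ j, ‖X j‖ * ‖P j‖ :=
    (Finset.abs_sum_le_sum_abs _ _).trans <| Finset.sum_le_sum fun j _ =>
      (Complex.abs_re_le_norm _).trans
        ((norm_inner_le_norm (𝕜 := ℂ) _ _).trans_eq (mul_comm _ _))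
  exact (sq_le_sq.2 (abs_le.trans (le_abs_self _))).trans
    (Finset.sum_mul_sq_le_sq_mul_sq _ _ _)

theorem norm_add_smul_sq_sub_norm_add_neg_smul_sq (X P : L2 d) :
    ‖X + (2 * 1 : ℝ) • P‖ ^ 2 - ‖X + (2 * -1 : ℝ) • P‖ ^ 2 = 8 * (inner ℂ P X).re := by
  rw [@norm_add_sq ℂ, @norm_add_sq ℂ, norm_smul, norm_smul, inner_smul_right_eq_smul,
    inner_smul_right_eq_smul, RCLike.smul_re, RCLike.smul_re, inner_re_symm]
  norm_num
  ring

theorem four_mul_le_of_sq_le {A S E τ : ℝ} (hS : 0 ≤ S) (hE : 0 ≤ E) (hτ : 0 < τ)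
    (h : A ^ 2 ≤ S * (2 * E)) : 4 * A ≤ S / (2 * τ) + 16 * τ * E := by
  refine (abs_le_of_sq_le_sq' ?_ (by positivity)).2
  have square : (S / (2 * τ) + 16 * τ * E) ^ 2 =
      16 * (S * (2 * E)) + (S / (2 * τ) - 16 * τ * E) ^ 2 := by
    field_simp
    ring
  nlinarith [sq_nonneg (S / (2 * τ) - 16 * τ * E)]

theorem le_two_mul_of_forall_le_add_half_sSup {V : ℝ → ℝ} {J : Set ℝ} {b : ℝ}
    (h : ∀ t ∈ J, V t ≤ b + sSup (V '' J) / 2) {t : ℝ} (ht : t ∈ J) :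
    V t ≤ 2 * b := by
  have sSup_le : sSup (V '' J) ≤ b + sSup (V '' J) / 2 :=
    csSup_le ⟨V t, mem_image_of_mem V ht⟩ (forall_mem_image.2 h)
  linarith [h t ht]

namespace IsBoundedWindowFlow

section Virial

variable {p : ℕ} {M κ C t₀ t₁ : ℝ} {v L : ℝ → L2 d} {P X : Fin d → ℝ → L2 d}

theorem sum_norm_sq_sub (hv : IsBoundedWindowFlow p 0 1 M κ (Icc t₀ t₁) v L P) (ht : t₀ ≤ t₁)
    (hX : ∀ j, ∀ t ∈ Icc t₀ t₁, IsPosition j (v t) (X j t))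
    (hXC : ∀ j, ∀ t ∈ Icc t₀ t₁, ‖X j t‖ ≤ C) (a : ℝ) :
    IntervalIntegrable (fun t => virialDensity p a (∑ j, (inner ℂ (P j t) (X j t)).re) (v t))
        volume t₀ t₁ ∧
      ∑ j, ‖X j t₀ + (2 * a) • P j t₀‖ ^ 2 - ∑ j, ‖X j t₁ + (2 * a) • P j t₁‖ ^ 2 =
        ∫ t in t₀..t₁, virialDensity p a (∑ j, (inner ℂ (P j t) (X j t)).re) (v t) := by
  have hva := hv.freeProp a
  have hZ (j) (t) (ht : t ∈ Icc t₀ t₁) := (hX j t ht).freeProp (hv.isMomentum j t ht) a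
  have hZC (j) (t) (ht : t ∈ Icc t₀ t₁) :
      ‖GabitovTuritsyn.freeProp a (X j t + (2 * a) • P j t)‖ ≤ C + |2 * a| * κ := by
    rw [norm_freeProp]
    refine (norm_add_le _ _).trans (add_le_add (hXC j t ht) ?_)
    rw [norm_smul, Real.norm_eq_abs]
    exact mul_le_mul_of_nonneg_left (hv.norm_momentum_le j t ht) (abs_nonneg _)
  have hYex (j) (t) (ht : t ∈ Icc t₀ t₁) :=
    (hZ j t ht).exists_windowNL hva.window_le hva.bound_nonneg (hva.flowBoundedOn_Icc ht) p
  choose! Y hY using hYex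
  have increment (j) := hva.norm_sq_isPosition_sub ht (hZ j) (hZC j) (hY j)
  have density_eq : EqOn
      (fun t => ∑ j, (4 * (inner ℂ (GabitovTuritsyn.freeProp a (P j t))
          (GabitovTuritsyn.freeProp a (X j t + (2 * a) • P j t))).re +
        2 * (inner ℂ (GabitovTuritsyn.freeProp a (X j t + (2 * a) • P j t)) (Y j t)).im))
      (fun t => virialDensity p a (∑ j, (inner ℂ (P j t) (X j t)).re) (v t)) (Icc t₀ t₁) :=
    fun t ht => (virialDensity_eq (hv.flowBoundedOn t ht) a (fun j => hv.isMomentum j t ht)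
      (fun j => hZ j t ht) fun j => hY j t ht).symm
  rw [← uIcc_of_le ht] at density_eq
  constructor
  · refine (IntervalIntegrable.sum Finset.univ fun j _ => (increment j).1).congr_uIoo ?_
    intro t ht
    simpa only [Finset.sum_apply] using density_eq (Ioo_subset_Icc_self ht)
  · rw [← intervalIntegral.integral_congr density_eq,
      intervalIntegral.integral_finsetSum fun j _ => (increment j).1, ← Finset.sum_sub_distrib]
    exact Finset.sum_congr rfl fun j _ => by rw [← (increment j).2, norm_freeProp, norm_freeProp]

theorem sum_re_inner_add_le (hdp : 8 ≤ d * p)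
    (hv : IsBoundedWindowFlow p 0 1 M κ (Icc t₀ t₁) v L P) (ht : t₀ ≤ t₁)
    (hX : ∀ j, ∀ t ∈ Icc t₀ t₁, IsPosition j (v t) (X j t))
    (hXC : ∀ j, ∀ t ∈ Icc t₀ t₁, ‖X j t‖ ≤ C) {E : ℝ}
    (hE : ∀ t ∈ Icc t₀ t₁, energy (-1) p (v t) = E) :
    ∑ j, (inner ℂ (P j t₁) (X j t₁)).re + 4 * E * (t₁ - t₀) ≤
      ∑ j, (inner ℂ (P j t₀) (X j t₀)).re := by
  obtain ⟨hint_pos, increment_pos⟩ := hv.sum_norm_sq_sub ht hX hXC 1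
  obtain ⟨hint_neg, increment_neg⟩ := hv.sum_norm_sq_sub ht hX hXC (-1)
  have polarization (t : ℝ) : ∑ j, ‖X j t + (2 * 1 : ℝ) • P j t‖ ^ 2 -
      ∑ j, ‖X j t + (2 * -1 : ℝ) • P j t‖ ^ 2 = 8 * ∑ j, (inner ℂ (P j t) (X j t)).re := by
    rw [← Finset.sum_sub_distrib, Finset.mul_sum]
    exact Finset.sum_congr rfl fun j _ => norm_add_smul_sq_sub_norm_add_neg_smul_sq _ _
  have integral_le := intervalIntegral.integral_mono_on ht
    (intervalIntegrable_const (c := 32 * E)) (hint_pos.sub hint_neg) fun t ht =>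
      hE t ht ▸ le_virialDensity_sub hdp (hv.flowBoundedOn t ht) _
  rw [intervalIntegral.integral_sub hint_pos hint_neg, ← increment_pos, ← increment_neg,
    intervalIntegral.integral_const, smul_eq_mul] at integral_le
  linarith [polarization t₀, polarization t₁]

theorem four_mul_sum_re_inner_le (hv : IsBoundedWindowFlow p 0 1 M κ (Icc t₀ t₁) v L P) {E S t : ℝ}
    (ht : t ∈ Icc t₀ t₁) (hE : energy (-1) p (v t) = E) (hS : ∑ j, ‖X j t‖ ^ 2 ≤ S) {τ : ℝ}
    (hτ : 0 < τ) : 4 * ∑ j, (inner ℂ (P j t) (X j t)).re ≤ S / (2 * τ) + 16 * τ * E := by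
  have hS₀ : 0 ≤ S := (Finset.sum_nonneg fun _ _ => sq_nonneg _).trans hS
  refine four_mul_le_of_sq_le hS₀ (hE ▸ energy_neg_one_nonneg p (v t)) hτ
    ((sum_re_inner_sq_le _ _).trans (mul_le_mul hS ?_ (Finset.sum_nonneg fun _ _ => sq_nonneg _)
      hS₀))
  rw [← hE, ← kinetic_eq_sum_norm_sq fun j => hv.isMomentum j t ht]
  exact kinetic_le_two_mul_energy p (v t)

theorem sum_norm_sq_le (hdp : 4 ≤ d * p)
    (hv : IsBoundedWindowFlow p 0 1 M κ (Icc t₀ t₁) v L P) (ht : t₀ < t₁)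
    (hX : ∀ j, ∀ t ∈ Icc t₀ t₁, IsPosition j (v t) (X j t))
    (hXC : ∀ j, ∀ t ∈ Icc t₀ t₁, ‖X j t‖ ≤ C) {E : ℝ}
    (hE : ∀ t ∈ Icc t₀ t₁, energy (-1) p (v t) = E) :
    ∑ j, ‖X j t₀‖ ^ 2 ≤ 2 * ∑ j, ‖X j t₁‖ ^ 2 + 32 * E * (t₁ - t₀) ^ 2 := by
  set τ := t₁ - t₀
  have hτ₀ : 0 < τ := sub_pos.2 ht
  set V : ℝ → ℝ := fun t => ∑ j, ‖X j t‖ ^ 2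
  have hbdd : BddAbove (V '' Icc t₀ t₁) := by
    refine ⟨∑ _ : Fin d, C ^ 2, forall_mem_image.2 fun t ht => ?_⟩
    exact Finset.sum_le_sum fun j _ => pow_le_pow_left₀ (norm_nonneg _) (hXC j t ht) 2
  set S := sSup (V '' Icc t₀ t₁)
  have hVS (t) (ht : t ∈ Icc t₀ t₁) : V t ≤ S := le_csSup hbdd (mem_image_of_mem V ht)
  have hbound (r) (hr : r ∈ Icc t₀ t₁) : V r ≤ V t₁ + 16 * τ ^ 2 * E + S / 2 := by
    have hsub : Icc r t₁ ⊆ Icc t₀ t₁ := Icc_subset_Icc_left hr.1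
    obtain ⟨hint, increment⟩ := (hv.mono hsub).sum_norm_sq_sub hr.2
      (fun j t ht => hX j t (hsub ht)) (fun j t ht => hXC j t (hsub ht)) 0
    have integral_le := intervalIntegral.integral_mono_on hr.2 hint intervalIntegrable_const
      fun t ht => (virialDensity_zero_le hdp _ _).trans
        (hv.four_mul_sum_re_inner_le (hsub ht) (hE t (hsub ht)) (hVS t (hsub ht)) hτ₀)
    simp only [← increment, intervalIntegral.integral_const, smul_eq_mul, mul_zero, zero_smul,
      add_zero] at integral_le
    have hS₀ : 0 ≤ S := (Finset.sum_nonneg fun _ _ => sq_nonneg _).trans (hVS r hr)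
    have hE₀ : 0 ≤ E := hE r hr ▸ energy_neg_one_nonneg p (v r)
    calc V r ≤ V t₁ + (t₁ - r) * (S / (2 * τ) + 16 * τ * E) := by linarith
      _ ≤ V t₁ + τ * (S / (2 * τ) + 16 * τ * E) := by
        gcongr
        linarith [hr.1]
      _ = V t₁ + 16 * τ ^ 2 * E + S / 2 := by
        field_simp
        ring
  linarith [le_two_mul_of_forall_le_add_half_sSup hbound (left_mem_Icc.2 ht.le)]

end Virial

end IsBoundedWindowFlow

/-! ### Growth of the kinetic energy -/

theorem im_inner_eq_zero_of_ae_im_eq_zero {f g : L2 d} (hf : ∀ᵐ x, (f x).im = 0)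
    (hg : ∀ᵐ x, (g x).im = 0) : (inner ℂ f g).im = 0 := by
  rw [L2.inner_def]
  refine (integral_im (𝕜 := ℂ) (L2.integrable_inner f g)).symm.trans
    (integral_eq_zero_of_ae ?_)
  filter_upwards [hf, hg] with x hfx hgx
  simp [RCLike.inner_apply, hfx, hgx]

/-- The inner product of `x_j f` with a translate of `f` is real; differentiate in the translation
parameter. -/
theorem re_inner_momentum_position_eq_zero {j : Fin d} {f k X : L2 d}
    (hf : ∀ᵐ x, (f x).im = 0) (hk : IsMomentum j f k) (hX : IsPosition j f X) :
    (inner ℂ k X).re = 0 := by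
  have hX_real : ∀ᵐ x, (X x).im = 0 := by
    filter_upwards [hf, hX] with x hfx hXx
    rw [hXx, Complex.im_ofReal_mul, hfx, mul_zero]
  have inner_translate_real (ε : ℝ) :
      (inner ℂ X (translate (EuclideanSpace.single j (-ε)) f)).im = 0 := by
    refine im_inner_eq_zero_of_ae_im_eq_zero hX_real ?_
    filter_upwards [coeFn_translate _ f, ae_comp_sub (EuclideanSpace.single j (-ε)) hf]
      with x htrans hfx
    rwa [htrans]
  have hconst (ε : ℝ) :
      reInner (Complex.I • X) (translate (EuclideanSpace.single j (-ε)) f) = 0 := by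
    rw [reInner_apply, inner_smul_left, Complex.conj_I, neg_mul, Complex.neg_re, Complex.I_mul_re,
      neg_neg, inner_translate_real]
  have hderiv := (reInner (Complex.I • X)).hasFDerivAt.comp_hasDerivAt 0 hk.hasDerivAt_translate
  have inner_eq_zero := hderiv.unique ((hasDerivAt_const (0 : ℝ) (0 : ℝ)).congr_of_eventuallyEq
    (Eventually.of_forall hconst))
  rw [reInner_apply, inner_smul_left, inner_smul_right, ← mul_assoc, Complex.conj_I, neg_mul,
    Complex.I_mul_I, neg_neg, one_mul] at inner_eq_zero
  rw [← inner_conj_symm, Complex.conj_re, inner_eq_zero]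

theorem exists_isPosition_of_memLp {f : L2 d}
    (hf : MemLp (fun x : Space d => (‖x‖ : ℂ) * f x) 2 volume) (j : Fin d) :
    ∃ X : L2 d, IsPosition j f X := by
  have hxf : MemLp (fun x : Space d => (x j : ℂ) * f x) 2 volume := by
    refine hf.of_le ((Continuous.aestronglyMeasurable (by fun_prop)).mul (Lp.memLp f).1)
      (Eventually.of_forall fun x => ?_)
    rw [norm_mul, norm_mul, Complex.norm_real, Complex.norm_real, norm_norm]
    gcongr
    exact PiLp.norm_apply_le x j
  exact ⟨hxf.toLp, hxf.coeFn_toLp⟩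

theorem IsBoundedWindowFlow.exists_isPosition_of_memLp {p : ℕ} {α β M κ a b : ℝ}
    {v L : ℝ → L2 d} {P : Fin d → ℝ → L2 d}
    (hv : IsBoundedWindowFlow p α β M κ (Icc a b) v L P)
    (hvar : MemLp (fun x : Space d => (‖x‖ : ℂ) * v b x) 2 volume) :
    ∃ (C : ℝ) (X : Fin d → ℝ → L2 d), (∀ j, ∀ t ∈ Icc a b, IsPosition j (v t) (X j t)) ∧
      ∀ j, ∀ t ∈ Icc a b, ‖X j t‖ ≤ C := by
  choose X₀ hX₀ using GabitovTuritsyn.exists_isPosition_of_memLp hvar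
  choose B hB using fun j => hv.exists_isPosition (hX₀ j)
  choose! X hX hXB using hB
  obtain ⟨C, hC⟩ := Finite.exists_le B
  exact ⟨C, X, hX, fun j t ht => (hXB j t ht).trans (hC j)⟩

section Growth

variable {p : ℕ} {s a b T : ℝ} {u : ℝ → L2 d}

theorem velocity_neg_one (p : ℕ) (f : L2 d) :
    velocity (-1) p f = Complex.I • (windowNL p 0 1 f - laplacian f) := by
  rw [velocity, Complex.ofReal_neg, Complex.ofReal_one, neg_one_smul, neg_add_eq_sub]
  rfl

theorem IsSolution.exists_isBoundedWindowFlow (hu : IsSolution (-1) p s (Icc a b) u) (hs : 2 ≤ s)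
    (hds : (d : ℝ) / 2 < s) :
    ∃ (M κ : ℝ) (P : Fin d → ℝ → L2 d),
      IsBoundedWindowFlow p 0 1 M κ (Icc a b) u (fun t => laplacian (u t)) P := by
  obtain ⟨M, hM₀, hM⟩ := hu.exists_flowBoundedOn hds isCompact_Icc
  obtain ⟨B, hB⟩ := isCompact_Icc.exists_bound_of_continuousOn hu.continuousOn
  have hPex (j : Fin d) (t) (ht : t ∈ Icc a b) := exists_isMomentum hs (hu.mem_sobolev t ht) j
  choose! P hP using hPex
  have norm_momentum_le (j t) (ht : t ∈ Icc a b) :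
      ‖P j t‖ ≤ √(2 * energy (-1) p (u b)) := by
    refine Real.le_sqrt_of_sq_le ?_
    rw [← hu.energy_eq hs hM ht]
    exact ((hP j t ht).norm_sq_le_kinetic hs (hu.mem_sobolev t ht)).trans
      (kinetic_le_two_mul_energy p (u t))
  exact ⟨M, max B √(2 * energy (-1) p (u b)), P,
    { window_le := zero_le_one
      bound_nonneg := hM₀
      hasDerivWithinAt := fun t ht => velocity_neg_one p (u t) ▸ hu.hasDerivWithinAt ht
      continuousOn_laplacian := hu.continuousOn_laplacian hs
      isLaplacian := fun t ht => hu.isLaplacian hs ht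
      isMomentum := hP
      flowBoundedOn := hM
      norm_le := fun t ht => (hB t ht).trans (le_max_left _ _)
      norm_momentum_le := fun j t ht => (norm_momentum_le j t ht).trans (le_max_right _ _) }⟩

theorem mul_le_of_sq_le_mul {κ V E K τ : ℝ} (hκ : 0 < κ) (hE : 0 ≤ E) (hK : 0 ≤ K) (hτ : 0 < τ)
    (hV : κ * V ≤ τ ^ 2 * E) (h : (4 * E * τ) ^ 2 ≤ (2 * V + 32 * E * τ ^ 2) * K) :
    16 / (2 / κ + 32) * E ≤ K := by
  obtain rfl | hE := hE.eq_or_lt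
  · rwa [mul_zero]
  have hVκ : V ≤ τ ^ 2 * E / κ := by rwa [le_div_iff₀' hκ]
  rw [div_mul_eq_mul_div, div_le_iff₀ (by positivity)]
  refine le_of_mul_le_mul_left ?_ (by positivity : 0 < τ ^ 2 * E)
  calc τ ^ 2 * E * (16 * E) = (4 * E * τ) ^ 2 := by ring
    _ ≤ (2 * (τ ^ 2 * E / κ) + 32 * E * τ ^ 2) * K := h.trans (by gcongr)
    _ = τ ^ 2 * E * (K * (2 / κ + 32)) := by ring

theorem IsSolution.mul_energy_le_kinetic (hdp : 8 ≤ d * p) (hs : 2 ≤ s) (hds : (d : ℝ) / 2 < s)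
    (hT : T < 0) (hu : IsSolution (-1) p s (Icc T 0) u) (hreal : ∀ᵐ x, (u 0 x).im = 0)
    (hvar : MemLp (fun x => (‖x‖ : ℂ) * u 0 x) 2 volume) {κ : ℝ} (hκ : 0 < κ)
    (hV : κ * variance (u 0) ≤ T ^ 2 * energy (-1) p (u 0)) :
    16 / (2 / κ + 32) * energy (-1) p (u 0) ≤ kinetic (u T) := by
  have h0 : (0 : ℝ) ∈ Icc T 0 := right_mem_Icc.2 hT.le
  have hTmem : T ∈ Icc T 0 := left_mem_Icc.2 hT.le
  obtain ⟨M, B, P, hv⟩ := hu.exists_isBoundedWindowFlow hs hds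
  obtain ⟨C, X, hX, hXC⟩ := hv.exists_isPosition_of_memLp hvar
  have hE (t) (ht : t ∈ Icc T 0) := hu.energy_eq hs hv.flowBoundedOn ht
  have hE₀ := energy_neg_one_nonneg p (u 0)
  have initial_eq_zero : ∑ j, (inner ℂ (P j 0) (X j 0)).re = 0 :=
    Finset.sum_eq_zero fun j _ =>
      re_inner_momentum_position_eq_zero hreal (hv.isMomentum j 0 h0) (hX j 0 h0)
  have growth := hv.sum_re_inner_add_le hdp hT.le hX hXC hE
  have variance_le := hv.sum_norm_sq_le (by lia) hT hX hXC hE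
  rw [initial_eq_zero, zero_add, zero_sub] at growth
  rw [← variance_eq_sum_norm_sq fun j => hX j 0 h0, zero_sub] at variance_le
  refine mul_le_of_sq_le_mul hκ hE₀ (kinetic_nonneg _) (neg_pos.2 hT) (by rwa [neg_sq]) ?_
  calc (4 * energy (-1) p (u 0) * -T) ^ 2 ≤ (∑ j, (inner ℂ (P j T) (X j T)).re) ^ 2 := by
        gcongr
        exact mul_nonneg (by positivity) (neg_pos.2 hT).le
    _ ≤ (∑ j, ‖X j T‖ ^ 2) * kinetic (u T) := by
      rw [kinetic_eq_sum_norm_sq fun j => hv.isMomentum j T hTmem]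
      exact sum_re_inner_sq_le _ _
    _ ≤ _ := mul_le_mul_of_nonneg_right variance_le (kinetic_nonneg _)

end Growth

theorem exists_mem_Icc_mul_le_and_le {f g : ℝ → ℝ} {a b c : ℝ} (hab : a ≤ b)
    (hf : ContinuousOn f (Icc a b)) (hg : ContinuousOn g (Icc a b))
    (hg₀ : ∀ t ∈ Icc a b, 0 ≤ g t) (hc : c ≤ 1) (ha : c * g a ≤ f a) (hb : f b ≤ g b) :
    ∃ t ∈ Icc a b, c * g t ≤ f t ∧ f t ≤ g t := by
  obtain hfa | hfa := le_total (f a) (g a)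
  · exact ⟨a, left_mem_Icc.2 hab, ha, hfa⟩
  · obtain ⟨t, ht, heq⟩ := isPreconnected_Icc.intermediate_value₂ (left_mem_Icc.2 hab)
      (right_mem_Icc.2 hab) hg hf hfa hb
    exact ⟨t, ht, (mul_le_of_le_one_left (hg₀ t ht) hc).trans_eq heq, heq.ge⟩

theorem mul_le_mul_of_comparable_div {κ₁ κ₂ V E τ : ℝ} (hE : 0 ≤ E) (hτ : 0 < τ)
    (h₁ : κ₁ * (V / E) ≤ τ) (h₂ : τ ≤ κ₂ * (V / E)) : κ₁ * V ≤ τ * E := by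
  obtain rfl | hE := hE.eq_or_lt
  · rw [div_zero, mul_zero] at h₂
    exact absurd h₂ hτ.not_ge
  · rwa [← mul_div_assoc, div_le_iff₀ hE] at h₁

end GabitovTuritsyn

end

open GabitovTuritsyn in
theorem mainTheorem6_general (d p : ℕ) (hdp : 8 ≤ d * p) (κ : ℝ) (hκ : 0 < κ) :
    ∃ c : ℝ, 0 < c ∧
      ∀ s : ℝ, 2 ≤ s → (d : ℝ) / 2 < s →
      ∀ (T : ℝ) (u : ℝ → L2 d), T < 0 → IsSolution (-1) p s (Icc T 0) u →
        (∀ᵐ x, (u 0 x).im = 0) →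
        MemLp (fun x => (‖x‖ : ℂ) * u 0 x) 2 volume →
        κ * variance (u 0) ≤ T ^ 2 * energy (-1) p (u 0) →
        c * potential p (u T) ≤ kinetic (u T) ∧
        (kinetic (u 0) ≤ potential p (u 0) →
          (c * potential p (u 0) ≤ kinetic (u T) ∧ kinetic (u T) ≤ 2 * potential p (u 0)) ∧
          ∃ t ∈ Icc T 0, c * potential p (u t) ≤ kinetic (u t) ∧
            kinetic (u t) ≤ potential p (u t)) := by
  set c₀ := 16 / (2 / κ + 32)
  have hc₁ : c₀ / (p + 2) ≤ 1 := by
    rw [div_div, div_le_one (by positivity)]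
    calc (16 : ℝ) ≤ (0 + 32) * (0 + 1) := by norm_num
      _ ≤ (2 / κ + 32) * (p + 2) := by
        gcongr
        · positivity
        · positivity
        · norm_num
  refine ⟨c₀ / (p + 2), by positivity, fun s hs hds T u hT hu hreal hvar hV => ?_⟩
  obtain ⟨M, -, hM⟩ := hu.exists_flowBoundedOn hds isCompact_Icc
  have potential_le (t) (ht : t ∈ Icc T 0) : c₀ / (p + 2) * potential p (u t) ≤ kinetic (u T) :=
    calc c₀ / (p + 2) * potential p (u t) = c₀ * (potential p (u t) / (p + 2)) := by ring
      _ ≤ c₀ * energy (-1) p (u t) := by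
        gcongr
        exact potential_div_le_energy_neg_one p (u t)
      _ ≤ kinetic (u T) := hu.energy_eq hs hM ht ▸
        hu.mul_energy_le_kinetic hdp hs hds hT hreal hvar hκ hV
  have hTmem : T ∈ Icc T 0 := left_mem_Icc.2 hT.le
  refine ⟨potential_le T hTmem, fun hK => ⟨⟨potential_le 0 (right_mem_Icc.2 hT.le), ?_⟩, ?_⟩⟩
  · calc kinetic (u T) ≤ 2 * energy (-1) p (u T) := kinetic_le_two_mul_energy p (u T)
      _ = 2 * energy (-1) p (u 0) := by rw [hu.energy_eq hs hM hTmem]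
      _ ≤ 2 * potential p (u 0) := by
        gcongr
        exact energy_neg_one_le_potential hK
  · exact exists_mem_Icc_mul_le_and_le hT.le
      (fun t ht => (hu.hasDerivWithinAt_kinetic hs ht).continuousWithinAt)
      (fun t ht => (hu.hasDerivWithinAt_potential hM ht).continuousWithinAt)
      (fun t _ => potential_nonneg p (u t)) hc₁ (potential_le T hTmem) hK

open GabitovTuritsyn in
theorem mainTheorem6 (d p : ℕ) (hp : 2 ≤ p) (hp_even : Even p) (hdp : 8 ≤ d * p)
    (κ₁ κ₂ : ℝ) (hκ₁ : 0 < κ₁) (hκ : κ₁ ≤ κ₂) :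
    ∃ c C : ℝ, 0 < c ∧ 0 < C ∧
      ∀ s : ℝ, 2 ≤ s → (d : ℝ) / 2 < s →
      ∀ (T : ℝ) (u : ℝ → L2 d), T < 0 → -(1 / 2) ≤ T →
        IsSolution (-1) p s (Set.Icc T 0) u →
        -- the data are real-valued and of finite variance
        (∀ᵐ x, (u 0 x).im = 0) →
        MeasureTheory.MemLp (fun x => (‖x‖ : ℂ) * u 0 x) 2 MeasureTheory.volume →
        -- `T ^ 2` is comparable to variance / energy
        κ₁ * (variance (u 0) / energy (-1) p (u 0)) ≤ T ^ 2 →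
        T ^ 2 ≤ κ₂ * (variance (u 0) / energy (-1) p (u 0)) →
        c * potential p (u T) ≤ kinetic (u T) ∧
        (kinetic (u 0) ≤ potential p (u 0) →
          (c * potential p (u 0) ≤ kinetic (u T) ∧
            kinetic (u T) ≤ C * potential p (u 0)) ∧
          ∃ t ∈ Set.Icc T 0,
            c * potential p (u t) ≤ kinetic (u t) ∧
            kinetic (u t) ≤ C * potential p (u t)) := by
  obtain ⟨c, hc, h⟩ := mainTheorem6_general d p hdp κ₁ hκ₁
  refine ⟨c, 2, hc, two_pos, fun s hs hds T u hT _ hu hreal hvar h₁ h₂ => ?_⟩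
  obtain ⟨hKT, hK⟩ := h s hs hds T u hT hu hreal hvar <|
    mul_le_mul_of_comparable_div (energy_neg_one_nonneg p (u 0)) (sq_pos_of_neg hT) h₁ h₂
  exact ⟨hKT, fun hKU => (hK hKU).imp_right fun ⟨t, ht, hl, hle⟩ =>
    ⟨t, ht, hl, hle.trans (le_mul_of_one_le_left (potential_nonneg p (u t)) one_le_two)⟩⟩
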